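/- **Notation.** Let $n\ge 1$. Fix a Meyer scaling profile: an even function $\phi^0\in C_c^\infty(\mathbb R)$ supported in $[-\frac{4\pi}3,\frac{4\pi}3]$, with $0\le\phi^0\le1$, $\phi^0(\xi)=1$ for $|\xi|\le\frac{2\pi}3$, and $\phi^0(\xi)^2+\phi^0(2\pi-\xi)^2=1$ for $\frac{2\pi}3\le\xi\le\frac{4\pi}3$. Put $\phi^1(\xi)=e^{-i\xi/2}\,[\phi^0(\xi/2)^2-\phi^0(\xi)^2]^{1/2}$. For $\epsilon\in\{0,1\}^n$ let $\phi^\epsilon$ be the Schwartz function on $\mathbb R^n$ with $\widehat{\phi^\epsilon}(\xi)=\prod_{i=1}^n\phi^{\epsilon_i}(\xi_i)$, where $\hat f(\xi)=\int f(x)e^{-ix\cdot\xi}\,dx$; for $j\in\mathbb Z$, $k\in\mathbb Z^n$ let $\phi^\epsilon_{j,k}(x)=2^{nj/2}\phi^\epsilon(2^jx-k)$. Let $E_n=\{0,1\}^n\setminus\{0\}$. For a tempered distribution $f$ put $f^\epsilon_{j,k}=\langle f,\phi^\epsilon_{j,k}\rangle$ and $Q_jf=\sum_{\epsilon\in E_n}\sum_{k\in\mathbb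 Z^n}f^\epsilon_{j,k}\,\phi^\epsilon_{j,k}$. **Flow space.** Let $1\le p<\infty$, $1\le q\le\infty$, $m'\ge0$, $m>0$, and let $\chi$ be the characteristic function of $[0,1]^n$. For a family $f=(f(t))_{t>0}$ of tempered distributions on $\mathbb R^n$, weakly measurable in $t$, and for $j,j_t\in\mathbb Z$, $\mu\in\mathbb R$, set $$f_j(t,x)=2^{\frac{nj}2}\sum_{\epsilon\in E_n,\,k\in\mathbb Z^n}|f(t)^\epsilon_{j,k}|\,\chi(2^jx-k),\qquad f_{j,j_t}(x)=\sup_{2^{-2j_t}\le t<2^{2-2j_t}}f_j(t,x),$$ $$A^{p,\mu}_{j,j_t}=2^{2(j-j_t)\mu}\,2^{j(\frac np-1)}\sup_{\lambda>0}\lambda\,\bigl|\{x:f_{j,j_t}(x)>\lambda\}\bigr|^{1/p}.$$ Then $f\in{}^{m'}_{m}\dot B^{\frac np-1,q}_{p,\infty}$ means $$\sup_{j_t\in\mathbb Z}\Bigl(\sum_{j\ge j_t}(A^{p,m}_{j,j_t})^q+\sum_{j<j_t}(A^{p,m'}_{j,j_t})^q\Bigr)<\infty\quad(q<\infty),\qquad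 \sup_{j_t\in\mathbb Z,\,j\ge j_t}A^{p,m}_{j,j_t}+\sup_{j_t\in\mathbb Z,\,j<j_t}A^{p,m'}_{j,j_t}<\infty\quad(q=\infty).$$ **Coupling flows.** For $l,l',l''\in\{1,\dots,n\}$ and $t>0$ set $$C_l(u,v)(t)=\int_0^te^{(t-s)\Delta}\partial_{x_l}\Bigl(\sum_{j\in\mathbb Z}Q_ju(s)\,Q_jv(s)\Bigr)ds,$$ $$C_{l,l',l''}(u,v)(t)=\int_0^te^{(t-s)\Delta}\partial_{x_l}\partial_{x_{l'}}\partial_{x_{l''}}(-\Delta)^{-1}\Bigl(\sum_{j\in\mathbb Z}Q_ju(s)\,Q_jv(s)\Bigr)ds,$$ where the operators are Fourier multipliers and the time integrals are taken weakly, that is, after pairing with an arbitrary Schwartz function. **Theorem.** Let $l,l',l''\in\{1,\dots,n\}$, $1<p<\infty$, $1\le q\le\infty$, $0\le m'<\frac12$, $m>1$. If $u,v\in{}^{m'}_{m}\dot B^{\frac np-1,q}_{p,\infty}$, then $C_l(u,v)$ and $C_{l,l',l''}(u,v)$ are well defined (the series and integrals converge absolutely, and for every $t>0$ the result is a tempered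 distribution) and $$C_l(u,v),\ C_{l,l',l''}(u,v)\in{}^{m'}_{m}\dot B^{\frac np-1,q}_{p,\infty}.$$ -/

import Mathlib

open scoped ENNReal FourierTransform SchwartzMap ContDiff
open MeasureTheory

noncomputable section

namespace CouplingFlow

/-! ### Meyer wavelets -/

/-- The one-dimensional Meyer scaling profile `φ⁰` (on the Fourier side, in the convention
`f̂(ξ) = ∫ f(x) e^{-i x ξ} dx`): an even function in `C_c^∞([-4π/3, 4π/3])` with values in `[0,1]`,
equal to `1` on `[-2π/3, 2π/3]`, and satisfying the quadrature identity
`φ⁰(ξ)² + φ⁰(2π - ξ)² = 1` on `[2π/3, 4π/3]`, which is what makes the system orthonormal. -/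
structure MeyerProfile where
  toFun : ℝ → ℝ
  smooth : ContDiff ℝ ∞ toFun
  even : ∀ ξ, toFun (-ξ) = toFun ξ
  support : ∀ ξ, 4 * Real.pi / 3 < |ξ| → toFun ξ = 0
  eq_one : ∀ ξ, |ξ| ≤ 2 * Real.pi / 3 → toFun ξ = 1
  nonneg : ∀ ξ, 0 ≤ toFun ξ
  le_one : ∀ ξ, toFun ξ ≤ 1
  quadrature : ∀ ξ, 2 * Real.pi / 3 ≤ ξ → ξ ≤ 4 * Real.pi / 3 →
    toFun ξ ^ 2 + toFun (2 * Real.pi - ξ) ^ 2 = 1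

namespace MeyerProfile

/-- `φ(ξ) = (φ⁰(ξ/2)² - φ⁰(ξ)²)^{1/2}`. -/
def bump (Φ : MeyerProfile) (ξ : ℝ) : ℝ :=
  Real.sqrt (Φ.toFun (ξ / 2) ^ 2 - Φ.toFun ξ ^ 2)

/-- The two one-dimensional symbols: `φ⁰(ξ)` and `φ¹(ξ) = e^{-iξ/2} φ(ξ)`. -/
def symbol (Φ : MeyerProfile) (e : Fin 2) (ξ : ℝ) : ℂ :=
  if e = 0 then (Φ.toFun ξ : ℂ)
  else Complex.exp (-(Complex.I * (ξ : ℂ) / 2)) * (Φ.bump ξ : ℂ)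

theorem bump_eq_of_nonneg (Φ : MeyerProfile) {ξ : ℝ} (h0 : 0 ≤ ξ) :
    Φ.bump ξ = Φ.toFun (ξ / 2) *
      (Φ.toFun (2 * Real.pi - ξ) + Φ.toFun (2 * Real.pi + ξ)) := by
  have hpi := Real.pi_pos
  have hz : Φ.toFun (2 * Real.pi + ξ) = 0 := by
    apply Φ.support
    rw [abs_of_nonneg (by linarith)]
    linarith
  rw [hz, add_zero]
  unfold bump
  by_cases h1 : ξ < 2 * Real.pi / 3
  · have a : Φ.toFun (ξ / 2) = 1 := Φ.eq_one _ (by rw [abs_of_nonneg (by linarith)]; linarith)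
    have b : Φ.toFun ξ = 1 := Φ.eq_one _ (by rw [abs_of_nonneg h0]; linarith)
    have c : Φ.toFun (2 * Real.pi - ξ) = 0 :=
      Φ.support _ (by rw [abs_of_nonneg (by linarith)]; linarith)
    simp [a, b, c]
  · push Not at h1
    by_cases h2 : ξ ≤ 4 * Real.pi / 3
    · have a : Φ.toFun (ξ / 2) = 1 := Φ.eq_one _ (by rw [abs_of_nonneg (by linarith)]; linarith)
      have q := Φ.quadrature ξ h1 h2
      rw [a, show (1 : ℝ) ^ 2 - Φ.toFun ξ ^ 2 = Φ.toFun (2 * Real.pi - ξ) ^ 2 by linarith,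
        Real.sqrt_sq (Φ.nonneg _), one_mul]
    · push Not at h2
      have b : Φ.toFun ξ = 0 := Φ.support _ (by rw [abs_of_nonneg h0]; linarith)
      rw [b, show Φ.toFun (ξ / 2) ^ 2 - (0 : ℝ) ^ 2 = Φ.toFun (ξ / 2) ^ 2 by ring,
        Real.sqrt_sq (Φ.nonneg _)]
      by_cases h3 : ξ ≤ 8 * Real.pi / 3
      · have c : Φ.toFun (2 * Real.pi - ξ) = 1 :=
          Φ.eq_one _ (by rw [abs_le]; constructor <;> linarith)
        rw [c, mul_one]
      · push Not at h3
        have a : Φ.toFun (ξ / 2) = 0 :=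
          Φ.support _ (by rw [abs_of_nonneg (by linarith)]; linarith)
        rw [a, zero_mul]

theorem bump_even (Φ : MeyerProfile) (ξ : ℝ) : Φ.bump (-ξ) = Φ.bump ξ := by
  unfold bump
  rw [neg_div, Φ.even, Φ.even]

theorem bump_eq (Φ : MeyerProfile) (ξ : ℝ) :
    Φ.bump ξ = Φ.toFun (ξ / 2) *
      (Φ.toFun (2 * Real.pi - ξ) + Φ.toFun (2 * Real.pi + ξ)) := by
  rcases le_total 0 ξ with h | h
  · exact Φ.bump_eq_of_nonneg h
  · rw [← Φ.bump_even, Φ.bump_eq_of_nonneg (ξ := -ξ) (by linarith), neg_div, Φ.even,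
      sub_neg_eq_add, ← sub_eq_add_neg, add_comm]

theorem bump_contDiff (Φ : MeyerProfile) : ContDiff ℝ ∞ Φ.bump := by
  have h : Φ.bump = fun ξ => Φ.toFun (ξ / 2) *
      (Φ.toFun (2 * Real.pi - ξ) + Φ.toFun (2 * Real.pi + ξ)) := funext Φ.bump_eq
  rw [h]
  have hs := Φ.smooth
  refine ContDiff.mul (hs.comp (contDiff_id.div_const 2)) (ContDiff.add ?_ ?_)
  · exact hs.comp (contDiff_const.sub contDiff_id)
  · exact hs.comp (contDiff_const.add contDiff_id)

theorem symbol_contDiff (Φ : MeyerProfile) (e : Fin 2) : ContDiff ℝ ∞ (Φ.symbol e) := by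
  unfold symbol
  by_cases h : e = 0
  · simp only [h, if_true]
    exact Complex.ofRealCLM.contDiff.comp Φ.smooth
  · simp only [h, if_false]
    refine ContDiff.mul ?_ (Complex.ofRealCLM.contDiff.comp Φ.bump_contDiff)
    refine ContDiff.cexp (ContDiff.neg (ContDiff.div_const (ContDiff.mul contDiff_const ?_) 2))
    exact Complex.ofRealCLM.contDiff

theorem symbol_eq_zero (Φ : MeyerProfile) (e : Fin 2) {ξ : ℝ} (h : 8 * Real.pi / 3 < |ξ|) :
    Φ.symbol e ξ = 0 := by
  have hpi := Real.pi_pos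
  have a : Φ.toFun ξ = 0 := Φ.support _ (by linarith)
  have b : Φ.toFun (ξ / 2) = 0 := Φ.support _ (by
    rw [abs_div, abs_of_pos (by norm_num : (0 : ℝ) < 2)]; linarith)
  unfold symbol
  split_ifs
  · simp [a]
  · simp [bump, a, b]

end MeyerProfile

/-- `ℝⁿ` with its Euclidean structure. -/
abbrev Space (n : ℕ) : Type := EuclideanSpace ℝ (Fin n)

variable {n : ℕ}

/-- `ξ ↦ ∏ᵢ φ^{εᵢ}(2π ξᵢ)`: the Fourier transform of `φ^ε`, the factor `2π` translating the
convention `∫ f(x) e^{-i x·ξ} dx` into Mathlib's `∫ f(x) e^{-2π i x·ξ} dx`. -/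
def waveletSymbol (Φ : MeyerProfile) (ε : Fin n → Fin 2) (ξ : Space n) : ℂ :=
  ∏ i, Φ.symbol (ε i) (2 * Real.pi * ξ i)

theorem waveletSymbol_contDiff (Φ : MeyerProfile) (ε : Fin n → Fin 2) :
    ContDiff ℝ ∞ (waveletSymbol Φ ε) := by
  unfold waveletSymbol
  refine contDiff_prod fun i _ => (Φ.symbol_contDiff (ε i)).comp ?_
  exact contDiff_const.mul (EuclideanSpace.proj (𝕜 := ℝ) i).contDiff

theorem waveletSymbol_hasCompactSupport (Φ : MeyerProfile) (ε : Fin n → Fin 2) :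
    HasCompactSupport (waveletSymbol Φ ε) := by
  have hpi := Real.pi_pos
  refine HasCompactSupport.intro (K := (EuclideanSpace.equiv (Fin n) ℝ).toHomeomorph ⁻¹'
    (Set.univ.pi fun _ => Set.Icc (-(4 / 3)) (4 / 3))) ?_ ?_
  · rw [Homeomorph.isCompact_preimage]
    exact isCompact_univ_pi fun _ => isCompact_Icc
  · intro ξ hξ
    simp only [Set.mem_preimage, Set.mem_pi, Set.mem_univ, true_imp_iff, not_forall] at hξ
    obtain ⟨i, hi⟩ := hξ
    have hi' : ¬ |ξ i| ≤ 4 / 3 := fun h => hi (abs_le.mp h)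
    refine Finset.prod_eq_zero (Finset.mem_univ i) (Φ.symbol_eq_zero _ ?_)
    rw [abs_mul, abs_of_pos (by positivity)]
    push Not at hi'
    nlinarith

/-- The function `φ^ε`, `ε ∈ {0,1}ⁿ`, with `φ̂^ε(ξ) = ∏ᵢ φ^{εᵢ}(ξᵢ)`, as a Schwartz function. -/
def wavelet (Φ : MeyerProfile) (ε : Fin n → Fin 2) : 𝓢(Space n, ℂ) :=
  𝓕⁻ ((waveletSymbol_hasCompactSupport Φ ε).toSchwartzMap (waveletSymbol_contDiff Φ ε))

/-- The lattice point `k ∈ ℤⁿ` as a vector. -/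
def latticePoint (k : Fin n → ℤ) : Space n := WithLp.toLp 2 fun i => (k i : ℝ)

/-- `φ^ε_{j,k}(x) = 2^{nj/2} φ^ε(2^j x - k)` as a Schwartz function. -/
def waveletAt (Φ : MeyerProfile) (ε : Fin n → Fin 2) (j : ℤ) (k : Fin n → ℤ) :
    𝓢(Space n, ℂ) :=
  (((2 : ℝ) ^ ((n : ℝ) * j / 2) : ℝ) : ℂ) •
    SchwartzMap.compCLMOfContinuousLinearEquiv ℂ
      (ContinuousLinearEquiv.smulLeft (Units.mk0 ((2 : ℝ) ^ j) (zpow_ne_zero j two_ne_zero)))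
      (SchwartzMap.compSubConstCLM ℂ (latticePoint k) (wavelet Φ ε))

theorem waveletAt_apply (Φ : MeyerProfile) (ε : Fin n → Fin 2) (j : ℤ) (k : Fin n → ℤ)
    (x : Space n) :
    waveletAt Φ ε j k x = (((2 : ℝ) ^ ((n : ℝ) * j / 2) : ℝ) : ℂ) *
      wavelet Φ ε ((2 : ℝ) ^ j • x - latticePoint k) := by
  simp [waveletAt, ContinuousLinearEquiv.smulLeft, Units.smul_def]

/-- The index set `E_n = {0,1}ⁿ \ {0}`. -/
abbrev Direction (n : ℕ) : Type := {ε : Fin n → Fin 2 // ε ≠ 0}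

/-- The wavelet coefficient `f^ε_{j,k} = ⟨f, φ^ε_{j,k}⟩` of a tempered distribution. (The wavelets
are real valued.) -/
def coeff (Φ : MeyerProfile) (f : 𝓢'(Space n, ℂ)) (ε : Fin n → Fin 2) (j : ℤ) (k : Fin n → ℤ) :
    ℂ :=
  f (waveletAt Φ ε j k)

/-- `Q_j f(x) = ∑_{ε ∈ E_n} ∑_{k ∈ ℤⁿ} f^ε_{j,k} φ^ε_{j,k}(x)`. -/
def Qproj (Φ : MeyerProfile) (j : ℤ) (f : 𝓢'(Space n, ℂ)) (x : Space n) : ℂ :=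
  ∑ ε : Direction n, ∑' k : Fin n → ℤ, coeff Φ f ε j k * waveletAt Φ ε j k x

/-! ### The parametric flow space -/

/-- Characteristic function of the unit cube `[0,1]ⁿ`. -/
def cubeIndicator (x : Space n) : ℝ≥0∞ :=
  Set.indicator {y : Space n | ∀ i, 0 ≤ y i ∧ y i ≤ 1} (fun _ => 1) x

/-- `f_j(t,x) = 2^{nj/2} ∑_{(ε,k)} |f^ε_{j,k}(t)| χ(2^j x - k)`. -/
def levelFun (Φ : MeyerProfile) (f : ℝ → 𝓢'(Space n, ℂ)) (j : ℤ) (t : ℝ) (x : Space n) : ℝ≥0∞ :=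
  ENNReal.ofReal ((2 : ℝ) ^ ((n : ℝ) * j / 2)) *
    ∑ ε : Direction n, ∑' k : Fin n → ℤ,
      ‖coeff Φ (f t) ε j k‖ₑ * cubeIndicator ((2 : ℝ) ^ j • x - latticePoint k)

/-- `f_{j,j_t}(x) = sup_{2^{-2 j_t} ≤ t < 2^{2 - 2 j_t}} f_j(t,x)`. -/
def ringFun (Φ : MeyerProfile) (f : ℝ → 𝓢'(Space n, ℂ)) (j jt : ℤ) (x : Space n) : ℝ≥0∞ :=
  ⨆ t ∈ Set.Ico ((2 : ℝ) ^ (-2 * jt)) ((2 : ℝ) ^ (2 - 2 * jt)), levelFun Φ f j t x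

/-- The weak-`L^p` quasi-norm `sup_{λ > 0} λ |{x : g(x) > λ}|^{1/p}`. -/
def weakNorm (p : ℝ) (g : Space n → ℝ≥0∞) : ℝ≥0∞ :=
  ⨆ r : {r : ℝ // 0 < r}, ENNReal.ofReal r * volume {x | ENNReal.ofReal r < g x} ^ (1 / p)

/-- `A^{p,m}_{j,j_t} = 2^{2(j-j_t)m} 2^{j(n/p-1)} sup_{λ>0} λ |{x : f_{j,j_t}(x) > λ}|^{1/p}`. -/
def ringNorm (Φ : MeyerProfile) (p m : ℝ) (f : ℝ → 𝓢'(Space n, ℂ)) (j jt : ℤ) : ℝ≥0∞ :=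
  ENNReal.ofReal ((2 : ℝ) ^ (2 * ((j : ℝ) - jt) * m)) *
    ENNReal.ofReal ((2 : ℝ) ^ ((j : ℝ) * ((n : ℝ) / p - 1))) *
    weakNorm p (ringFun Φ f j jt)

/-- The quantity whose finiteness defines the flow space. -/
def flowNorm (Φ : MeyerProfile) (p : ℝ) (q : ℝ≥0∞) (m' m : ℝ) (f : ℝ → 𝓢'(Space n, ℂ)) : ℝ≥0∞ :=
  if q = ⊤ then
    (⨆ jt : ℤ, ⨆ j : Set.Ici jt, ringNorm Φ p m f j jt) +
      (⨆ jt : ℤ, ⨆ j : Set.Iio jt, ringNorm Φ p m' f j jt)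
  else
    ⨆ jt : ℤ, ((∑' j : Set.Ici jt, ringNorm Φ p m f j jt ^ q.toReal) +
      ∑' j : Set.Iio jt, ringNorm Φ p m' f j jt ^ q.toReal)

/-- Membership in the parametric flow space `^{m'}_m Ḃ^{n/p-1,q}_{p,∞}`: the family
`f(t) ∈ 𝓢'(ℝⁿ)`, `t > 0`, is (weakly) measurable in time and its norm is finite.
Only the values at times `t > 0` matter. -/
structure MemFlowSpace (Φ : MeyerProfile) (p : ℝ) (q : ℝ≥0∞) (m' m : ℝ)
    (f : ℝ → 𝓢'(Space n, ℂ)) : Prop where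
  measurable : ∀ φ : 𝓢(Space n, ℂ), AEMeasurable (fun t => f t φ) (volume.restrict (Set.Ioi 0))
  norm_lt_top : flowNorm Φ p q m' m f < ⊤

/-! ### The coupling flows -/

/-- The coupling product `∑_j Q_j u Q_j v` at a fixed time. -/
def couplingProduct (Φ : MeyerProfile) (u v : 𝓢'(Space n, ℂ)) (x : Space n) : ℂ :=
  ∑' j : ℤ, Qproj Φ j u x * Qproj Φ j v x

/-- Fourier multiplier of `e^{τΔ} ∂_l` (frequency variable as in `∫ f(x) e^{-2π i x·ξ} dx`). -/
def symbolOne (l : Fin n) (τ : ℝ) (ξ : Space n) : ℂ :=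
  (Real.exp (-τ * (4 * Real.pi ^ 2 * ‖ξ‖ ^ 2)) : ℂ) * (2 * Real.pi * Complex.I * (ξ l : ℂ))

/-- Fourier multiplier of `e^{τΔ} ∂_l ∂_{l'} ∂_{l''} (-Δ)^{-1}`. -/
def symbolThree (l l' l'' : Fin n) (τ : ℝ) (ξ : Space n) : ℂ :=
  (Real.exp (-τ * (4 * Real.pi ^ 2 * ‖ξ‖ ^ 2)) : ℂ) *
    ((2 * Real.pi * Complex.I * (ξ l : ℂ)) * (2 * Real.pi * Complex.I * (ξ l' : ℂ)) *
      (2 * Real.pi * Complex.I * (ξ l'' : ℂ))) / (4 * Real.pi ^ 2 * ‖ξ‖ ^ 2 : ℝ)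

/-- The transpose of the Fourier multiplier operator `g ↦ 𝓕⁻¹(σ 𝓕 g)` applied to a test function:
`σ(D)ᵗ φ = 𝓕(σ 𝓕⁻¹ φ)`, so that `⟨σ(D) g, φ⟩ = ⟨g, σ(D)ᵗ φ⟩`. -/
def transposeMultiplier (σ : Space n → ℂ) (φ : 𝓢(Space n, ℂ)) : Space n → ℂ :=
  𝓕 (fun ξ : Space n => σ ξ * (𝓕⁻ φ : 𝓢(Space n, ℂ)) ξ)

/-- The pairing `⟨σ(D) g, φ⟩` for a function `g` and a test function `φ`. -/
def multiplierPairing (σ : Space n → ℂ) (g : Space n → ℂ) (φ : 𝓢(Space n, ℂ)) : ℂ :=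
  ∫ x, g x * transposeMultiplier σ φ x

/-- `F` is the flow `F(t) = ∫₀ᵗ A_{t-s} (∑_j Q_j u(s) Q_j v(s)) ds`, `t > 0`, where `A_τ` is the
Fourier multiplier with symbol `σ τ`: all the series and integrals involved converge absolutely,
and `⟨F(t), φ⟩ = ∫₀ᵗ ⟨A_{t-s} (∑_j Q_j u(s) Q_j v(s)), φ⟩ ds` for all Schwartz functions `φ`. In
particular `F(t)` is determined by `u` and `v` for every `t > 0`. -/
structure IsCouplingFlow (Φ : MeyerProfile) (σ : ℝ → Space n → ℂ) (u v F : ℝ → 𝓢'(Space n, ℂ)) :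
    Prop where
  summable_left : ∀ s, 0 < s → ∀ (ε : Direction n) (j : ℤ) (x : Space n),
    Summable fun k : Fin n → ℤ => coeff Φ (u s) ε j k * waveletAt Φ ε j k x
  summable_right : ∀ s, 0 < s → ∀ (ε : Direction n) (j : ℤ) (x : Space n),
    Summable fun k : Fin n → ℤ => coeff Φ (v s) ε j k * waveletAt Φ ε j k x
  summable_product : ∀ s, 0 < s → ∀ x : Space n,
    Summable fun j : ℤ => Qproj Φ j (u s) x * Qproj Φ j (v s) x
  integrable_space : ∀ s t, 0 < s → s < t → ∀ φ : 𝓢(Space n, ℂ),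
    Integrable fun x => couplingProduct Φ (u s) (v s) x * transposeMultiplier (σ (t - s)) φ x
  integrable_time : ∀ t, 0 < t → ∀ φ : 𝓢(Space n, ℂ),
    IntervalIntegrable
      (fun s => multiplierPairing (σ (t - s)) (couplingProduct Φ (u s) (v s)) φ) volume 0 t
  pairing_eq : ∀ t, 0 < t → ∀ φ : 𝓢(Space n, ℂ),
    F t φ = ∫ s in (0 : ℝ)..t,
      multiplierPairing (σ (t - s)) (couplingProduct Φ (u s) (v s)) φ

end CouplingFlow

end

/-!
Why the coupling flows stay in the flow space.

Only two consequences of `u, v` lying in the flow space enter: on every time ring `j_t` (times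
`t ≈ 4^{-j_t}`) the function `sup_t |Q_j u(t)|` is controlled in weak `L^p`, and, since a step
function on dyadic cubes of side `2^{-j}` is bounded by its weak norm, also uniformly. The product
`Q_j u Q_j v` therefore has, for all times of the ring, a majorant `D_{j,j_t}` bounded by
`4^{j_t} ω(j - j_t)` uniformly and by `2^{-jn/p} 4^{j_t} ω(j - j_t)` in weak `L^p`
(`exists_couplingBound`). The factor `ω` (`couplingWeight`) decays geometrically in both directions:
like `4^{-(2m-1)d}` as `d → ∞` since `m > 1/2`, and like `4^{(1-2m')d}` as `d → -∞` since
`m' < 1/2`.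

*Convergence.* Summing over `j` with the uniform bound for `j < 0` and the weak bound for `j ≥ 0`,
and then over the rings before `t`, whose lengths `3 · 4^{-j_t}` compensate the factor `4^{j_t}`,
shows that Duhamel's integral converges absolutely against `e^{(t-s)Δ} P(D) φ` for a test function
`φ`. This uses that `e^{τΔ} P(D)` maps test functions to `L¹ ∩ L^∞` uniformly in `τ > 0`
(`IsFirstOrder`). For the symbol `P` of `∂_l ∂_{l'} ∂_{l''} (-Δ)⁻¹` this is not automatic, as `P` is
not smooth at the origin; it follows from `(-Δ)⁻¹ = ∫_0^∞ e^{rΔ} dr`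
(`wienerNorm_heat_mul_rieszSymbol_le`). See `exists_isCouplingFlow`.

*The norm.* The wavelet coefficient of the flow at `(ε, j, k)` is Duhamel's integral with `φ` the
wavelet. There the kernel is at most
`2^{nj/2} 2^j (1 + 4^j (t-s))^{-M} (1 + |2^j x - k|)^{-n-1}` for every `M`
(`norm_transposeMultiplier_waveletAt_le`), and the levels `j' < j - 3` of the product drop out by
their frequency supports (`integral_Qproj_mul_eq_zero`). The sum over `k` turns into a convolution
with an integrable kernel, bounded on weak `L^p`, so that everything reduces to the numerical sum
`residualSum` over the levels `j' = j - 3 + i` and the rings `j_t + r`. The heat decay, of any order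
for the rings `r ≥ 2` that lie at a distance from `t` and of order one in `4^{j - j_t}` after
integration in time for `r ≤ 1`, makes this sum `O(2^{-2b|j - j_t|})` relative to the weights of the
flow norm, for some `b > 0` (`heatGain_mul_couplingWeight_le`). This is summable to any power `q`.

Weak `L^p` is handled through the equivalent norm `avgNorm`, which is countably subadditive, with
values in `ℝ≥0∞` throughout, so that no finiteness has to be tracked in the sums.
-/

noncomputable section

namespace CouplingFlow

variable {n : ℕ}

/-! ### Weak Lebesgue spaces -/

/-- The norm `sup_E |E|^{1/p-1} ∫_E g` over measurable sets `E`, which for `p > 1` is equivalent to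
the weak-`L^p` quasi-norm. In contrast to the latter it is countably subadditive. The conventions
`0 * ∞ = 0` and `∞ ^ (1/p-1) = 0` make sets of measure `0` and `∞` contribute nothing. -/
def avgNorm (p : ℝ) (g : Space n → ℝ≥0∞) : ℝ≥0∞ :=
  ⨆ E : {E : Set (Space n) // MeasurableSet E},
    volume (E : Set (Space n)) ^ (1 / p - 1) * ∫⁻ x in (E : Set (Space n)), g x

theorem le_avgNorm (p : ℝ) (g : Space n → ℝ≥0∞) {E : Set (Space n)} (hE : MeasurableSet E) :
    volume E ^ (1 / p - 1) * ∫⁻ x in E, g x ≤ avgNorm p g :=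
  le_iSup (fun E : {E : Set (Space n) // MeasurableSet E} =>
    volume (E : Set (Space n)) ^ (1 / p - 1) * ∫⁻ x in (E : Set (Space n)), g x) ⟨E, hE⟩

theorem avgNorm_le {p : ℝ} {g : Space n → ℝ≥0∞} {c : ℝ≥0∞}
    (h : ∀ E : Set (Space n), MeasurableSet E →
      volume E ^ (1 / p - 1) * ∫⁻ x in E, g x ≤ c) : avgNorm p g ≤ c :=
  iSup_le fun E => h E.1 E.2

theorem avgNorm_mono {p : ℝ} {g h : Space n → ℝ≥0∞} (hgh : ∀ x, g x ≤ h x) :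
    avgNorm p g ≤ avgNorm p h :=
  avgNorm_le fun _ hE => (mul_le_mul_right (lintegral_mono hgh) _).trans (le_avgNorm p h hE)

theorem avgNorm_const_mul_le {p : ℝ} (c : ℝ≥0∞) {g : Space n → ℝ≥0∞} (hg : Measurable g) :
    avgNorm p (fun x => c * g x) ≤ c * avgNorm p g :=
  avgNorm_le fun E hE => by
    rw [lintegral_const_mul _ hg, mul_left_comm]
    exact mul_le_mul_right (le_avgNorm p g hE) _

theorem avgNorm_mul_le {p : ℝ} {c : ℝ≥0∞} {g h : Space n → ℝ≥0∞} (hg : ∀ x, g x ≤ c)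
    (hh : Measurable h) : avgNorm p (fun x => g x * h x) ≤ c * avgNorm p h :=
  (avgNorm_mono fun x => mul_le_mul_left (hg x) (h x)).trans (avgNorm_const_mul_le c hh)

theorem avgNorm_tsum_le {p : ℝ} {ι : Type*} [Countable ι] {g : ι → Space n → ℝ≥0∞}
    (hg : ∀ i, Measurable (g i)) : avgNorm p (fun x => ∑' i, g i x) ≤ ∑' i, avgNorm p (g i) :=
  avgNorm_le fun E hE => by
    rw [lintegral_tsum fun i => (hg i).aemeasurable, ← ENNReal.tsum_mul_left]
    exact ENNReal.tsum_le_tsum fun i => le_avgNorm p (g i) hE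

theorem avgNorm_sum_le {p : ℝ} {ι : Type*} [Fintype ι] {g : ι → Space n → ℝ≥0∞}
    (hg : ∀ i, Measurable (g i)) : avgNorm p (fun x => ∑ i, g i x) ≤ ∑ i, avgNorm p (g i) := by
  simpa only [tsum_fintype] using avgNorm_tsum_le (p := p) hg

/-- Translations preserve the norm. -/
theorem avgNorm_comp_sub_le {p : ℝ} (g : Space n → ℝ≥0∞) (a : Space n) :
    avgNorm p (fun x => g (x - a)) ≤ avgNorm p g :=
  avgNorm_le fun E hE => by
    have hm : MeasurableSet ((fun x => x + a) ⁻¹' E) := measurable_add_const a hE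
    have h1 : ∫⁻ x in E, g (x - a) = ∫⁻ x in (fun x => x + a) ⁻¹' E, g x := by
      rw [← lintegral_indicator hE, ← lintegral_indicator hm,
        ← lintegral_add_right_eq_self (fun x => E.indicator (fun x => g (x - a)) x) a]
      refine lintegral_congr fun x => ?_
      by_cases h : x + a ∈ E <;> simp [Set.indicator, h]
    rw [h1, ← measure_preimage_add_right volume a E]
    exact le_avgNorm p g hm

/-- Young's inequality: convolution with an integrable kernel is bounded. -/
theorem avgNorm_convolution_le {p : ℝ} {g κ : Space n → ℝ≥0∞} (hg : Measurable g)
    (hκ : Measurable κ) :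
    avgNorm p (fun y => ∫⁻ x, g x * κ (y - x)) ≤ (∫⁻ z, κ z) * avgNorm p g :=
  avgNorm_le fun E hE => by
    have h1 : ∀ y, ∫⁻ x, g x * κ (y - x) = ∫⁻ z, g (y - z) * κ z := fun y => by
      have h := lintegral_sub_left_eq_self (μ := volume) (fun z => g (y - z) * κ z) y
      simpa only [sub_sub_cancel] using h
    simp only [h1]
    rw [lintegral_lintegral_swap (by fun_prop)]
    have h2 : ∀ z, ∫⁻ y in E, g (y - z) * κ z = κ z * ∫⁻ y in E, g (y - z) := fun z => by
      rw [lintegral_mul_const _ (by fun_prop), mul_comm]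
    simp only [h2]
    calc volume E ^ (1 / p - 1) * ∫⁻ z, κ z * ∫⁻ y in E, g (y - z)
        ≤ ∫⁻ z, volume E ^ (1 / p - 1) * (κ z * ∫⁻ y in E, g (y - z)) :=
          lintegral_const_mul_le _ _
      _ ≤ ∫⁻ z, κ z * avgNorm p g := lintegral_mono fun z => by
          rw [mul_left_comm]
          exact mul_le_mul_right
            ((le_avgNorm p (fun y => g (y - z)) hE).trans (avgNorm_comp_sub_le g z)) _
      _ = _ := lintegral_mul_const _ hκ

theorem weakNorm_mono {p : ℝ} (hp : 0 < p) {g h : Space n → ℝ≥0∞} (hgh : ∀ x, g x ≤ h x) :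
    weakNorm p g ≤ weakNorm p h :=
  iSup_mono fun r => mul_le_mul_right (ENNReal.rpow_le_rpow
    (measure_mono fun _ hx => lt_of_lt_of_le hx (hgh _)) (by positivity)) _

theorem mul_measure_rpow_le_weakNorm (p : ℝ) (g : Space n → ℝ≥0∞) {r : ℝ} (hr : 0 < r) :
    ENNReal.ofReal r * volume {x | ENNReal.ofReal r < g x} ^ (1 / p) ≤ weakNorm p g :=
  le_iSup (fun r : {r : ℝ // 0 < r} =>
    ENNReal.ofReal r * volume {x | ENNReal.ofReal r < g x} ^ (1 / p)) ⟨r, hr⟩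

/-- Chebyshev's inequality. -/
theorem weakNorm_le_avgNorm {p : ℝ} (hp : 1 < p) {g : Space n → ℝ≥0∞} (hg : Measurable g) :
    weakNorm p g ≤ avgNorm p g := by
  have hp0 : 0 < p := by linarith
  refine iSup_le fun ⟨r, hr⟩ => ?_
  have hr' : ENNReal.ofReal r ≠ 0 := by simpa using hr
  have hS : MeasurableSet {x | ENNReal.ofReal r < g x} := measurableSet_lt measurable_const hg
  -- the estimate for subsets of finite measure
  have key : ∀ E ⊆ {x | ENNReal.ofReal r < g x}, MeasurableSet E → volume E ≠ ⊤ →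
      ENNReal.ofReal r * volume E ^ (1 / p) ≤ avgNorm p g := by
    intro E hES hE hfin
    rcases eq_or_ne (volume E) 0 with h0 | h0
    · simp [h0, ENNReal.zero_rpow_of_pos (inv_pos.2 hp0)]
    · refine le_trans ?_ (le_avgNorm p g hE)
      have h1 : ENNReal.ofReal r * volume E ≤ ∫⁻ x in E, g x := by
        rw [← setLIntegral_const]
        exact setLIntegral_mono' hE fun x hx => (hES hx).le
      calc ENNReal.ofReal r * volume E ^ (1 / p)
          = volume E ^ (1 / p - 1) * (ENNReal.ofReal r * volume E) := by
            rw [mul_left_comm]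
            nth_rewrite 3 [← ENNReal.rpow_one (volume E)]
            rw [← ENNReal.rpow_add _ _ h0 hfin]
            simp
        _ ≤ _ := mul_le_mul_right h1 _
  refine le_of_forall_lt fun c hc => ?_
  have h2 : (c / ENNReal.ofReal r) ^ p < volume {x | ENNReal.ofReal r < g x} := by
    have := ENNReal.div_lt_of_lt_mul' hc
    calc (c / ENNReal.ofReal r) ^ p < (volume {x | ENNReal.ofReal r < g x} ^ (1 / p)) ^ p :=
          ENNReal.rpow_lt_rpow this hp0
      _ = _ := by rw [← ENNReal.rpow_mul]; simp [hp0.ne']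
  obtain ⟨E, hE, hES, h3, h4⟩ := Measure.exists_subset_measure_lt_top hS h2
  refine lt_of_lt_of_le ?_ (key E hES hE h4.ne)
  have h5 : c / ENNReal.ofReal r < volume E ^ (1 / p) := by
    have := ENNReal.rpow_lt_rpow h3 (z := 1 / p) (by positivity)
    rwa [← ENNReal.rpow_mul, mul_one_div_cancel hp0.ne', ENNReal.rpow_one] at this
  rw [mul_comm]
  exact (ENNReal.div_lt_iff (Or.inl hr') (Or.inl ENNReal.ofReal_ne_top)).1 h5

/-- A number is at most `r` plus the dyadic multiples of `r` up to twice its size. -/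
theorem le_dyadic_sum (y : ℝ≥0∞) {r : ℝ} (hr : 0 < r) :
    y ≤ ENNReal.ofReal r + ∑' i : ℕ, if ENNReal.ofReal (2 ^ i * r) < y then
      ENNReal.ofReal (2 ^ (i + 1) * r) else 0 := by
  have hunb : ∀ c : ℝ, ∃ i : ℕ, c < 2 ^ i * r := fun c => by
    obtain ⟨i, hi⟩ := pow_unbounded_of_one_lt (c / r) (one_lt_two : (1 : ℝ) < 2)
    exact ⟨i, (div_lt_iff₀ hr).1 hi⟩
  have hterm : ∀ i : ℕ, ENNReal.ofReal (2 ^ i * r) < y → ENNReal.ofReal (2 ^ (i + 1) * r) ≤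
      ∑' i : ℕ, if ENNReal.ofReal (2 ^ i * r) < y then
        ENNReal.ofReal (2 ^ (i + 1) * r) else 0 := fun i hi => by
    refine le_trans ?_ (ENNReal.le_tsum i)
    rw [if_pos hi]
  rcases eq_or_ne y ⊤ with rfl | hy
  · refine le_of_forall_lt fun c hc => ?_
    obtain ⟨i, hi⟩ := hunb c.toReal
    refine lt_of_lt_of_le ?_ ((hterm i ENNReal.ofReal_lt_top).trans le_add_self)
    rw [ENNReal.lt_ofReal_iff_toReal_lt hc.ne]
    refine hi.trans_le ?_
    rw [pow_succ]
    nlinarith [pow_pos (two_pos : (0 : ℝ) < 2) i]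
  · by_cases h : y ≤ ENNReal.ofReal r
    · exact h.trans le_self_add
    · have hex : ∃ i : ℕ, y ≤ ENNReal.ofReal (2 ^ i * r) := by
        obtain ⟨i, hi⟩ := hunb y.toReal
        exact ⟨i, (ENNReal.le_ofReal_iff_toReal_le hy (by positivity)).2 hi.le⟩
      classical
      obtain ⟨i, hi⟩ : ∃ i, Nat.find hex = i + 1 := Nat.exists_eq_succ_of_ne_zero fun h0 => h (by
        have := Nat.find_spec hex
        rw [h0] at this
        simpa using this)
      have h1 := Nat.find_spec hex
      have h2 := Nat.find_min hex (m := i) (by omega)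
      rw [hi] at h1
      exact h1.trans ((hterm i (not_le.1 h2)).trans le_add_self)

/-- A constant `C` with `avgNorm p g ≤ C * weakNorm p g`. -/
def weakConst (p : ℝ) : ℝ := 1 + 2 * ∑' i : ℕ, ((2 : ℝ) ^ (1 - p)) ^ i

/-- For `p > 1` the weak-`L^p` quasi-norm controls averages: `g` is split along the dyadic levels
above the height `w |E|^{-1/p}`. -/
theorem avgNorm_le_of_weakNorm_le {p : ℝ} (hp : 1 < p) {g : Space n → ℝ≥0∞} (hg : Measurable g)
    {w : ℝ} (hw : 0 < w) (h : weakNorm p g ≤ ENNReal.ofReal w) :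
    avgNorm p g ≤ ENNReal.ofReal (weakConst p * w) := by
  have hp0 : 0 < p := by linarith
  refine avgNorm_le fun E hE => ?_
  rcases eq_or_ne (volume E) 0 with h0 | h0
  · simp [setLIntegral_measure_zero E g h0]
  rcases eq_or_ne (volume E) ⊤ with hT | hT
  · rw [hT, ENNReal.top_rpow_of_neg (by
      rw [sub_neg, div_lt_one hp0]; exact hp), zero_mul]
    exact zero_le
  obtain ⟨a, ha, hEa⟩ : ∃ a : ℝ, 0 < a ∧ volume E = ENNReal.ofReal a :=
    ⟨(volume E).toReal, ENNReal.toReal_pos h0 hT, (ENNReal.ofReal_toReal hT).symm⟩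
  set r : ℝ := w * a ^ (-(1 / p)) with hr
  have hr0 : 0 < r := by positivity
  have hlevel : ∀ i : ℕ, volume {x | ENNReal.ofReal (2 ^ i * r) < g x} ≤
      ENNReal.ofReal (a * ((2 : ℝ) ^ (-p)) ^ i) := by
    intro i
    have hs : 0 < 2 ^ i * r := by positivity
    have h1 := (mul_measure_rpow_le_weakNorm p g hs).trans h
    have h2 : volume {x | ENNReal.ofReal (2 ^ i * r) < g x} ^ (1 / p) ≤
        ENNReal.ofReal (w / (2 ^ i * r)) := by
      rw [ENNReal.ofReal_div_of_pos hs, ENNReal.le_div_iff_mul_le (Or.inl (by simpa using hs))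
        (Or.inl ENNReal.ofReal_ne_top), mul_comm]
      exact h1
    have h3 := ENNReal.rpow_le_rpow h2 hp0.le
    rw [← ENNReal.rpow_mul, one_div_mul_cancel hp0.ne', ENNReal.rpow_one,
      ENNReal.ofReal_rpow_of_pos (by positivity)] at h3
    refine h3.trans (ENNReal.ofReal_le_ofReal (le_of_eq ?_))
    have h4 : w / (2 ^ i * r) = a ^ (1 / p) * ((2 : ℝ) ^ i)⁻¹ := by
      rw [hr, Real.rpow_neg ha.le]
      field_simp
    rw [h4, Real.mul_rpow (by positivity) (by positivity), ← Real.rpow_mul ha.le,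
      one_div_mul_cancel hp0.ne', Real.rpow_one, Real.inv_rpow (by positivity),
      ← Real.rpow_natCast, ← Real.rpow_mul two_pos.le, ← Real.rpow_neg two_pos.le,
      ← Real.rpow_natCast, ← Real.rpow_mul two_pos.le]
    ring_nf
  have hsum : Summable fun i : ℕ => ((2 : ℝ) ^ (1 - p)) ^ i :=
    summable_geometric_of_lt_one (by positivity)
      (Real.rpow_lt_one_of_one_lt_of_neg one_lt_two (by linarith))
  have hint : ∫⁻ x in E, g x ≤ ENNReal.ofReal (r * a * weakConst p) := by
    calc ∫⁻ x in E, g x ≤ ∫⁻ x in E, (ENNReal.ofReal r + ∑' i : ℕ,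
          Set.indicator {x | ENNReal.ofReal (2 ^ i * r) < g x}
            (fun _ => ENNReal.ofReal (2 ^ (i + 1) * r)) x) := by
          refine lintegral_mono fun x => (le_dyadic_sum (g x) hr0).trans (le_of_eq ?_)
          simp [Set.indicator_apply]
      _ = ENNReal.ofReal r * volume E + ∑' i : ℕ, ENNReal.ofReal (2 ^ (i + 1) * r) *
            volume.restrict E {x | ENNReal.ofReal (2 ^ i * r) < g x} := by
          have hm : ∀ i : ℕ, MeasurableSet {x | ENNReal.ofReal (2 ^ i * r) < g x} :=
            fun i => measurableSet_lt measurable_const hg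
          rw [lintegral_add_left measurable_const, setLIntegral_const, lintegral_tsum
            fun i => (measurable_const.indicator (hm i)).aemeasurable]
          congr 1
          refine tsum_congr fun i => ?_
          rw [lintegral_indicator_const (hm i)]
      _ ≤ ENNReal.ofReal r * ENNReal.ofReal a + ∑' i : ℕ, ENNReal.ofReal (2 ^ (i + 1) * r) *
            ENNReal.ofReal (a * ((2 : ℝ) ^ (-p)) ^ i) := by
          rw [hEa]
          gcongr with i
          exact (Measure.restrict_apply_le _ _).trans (hlevel i)
      _ = ENNReal.ofReal (r * a) +
            ∑' i : ℕ, ENNReal.ofReal (2 * (r * a) * ((2 : ℝ) ^ (1 - p)) ^ i) := by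
          rw [ENNReal.ofReal_mul hr0.le]
          congr 1
          refine tsum_congr fun i => ?_
          rw [← ENNReal.ofReal_mul (by positivity)]
          congr 1
          rw [show (1 : ℝ) - p = 1 + -p by ring, Real.rpow_add two_pos, Real.rpow_one, mul_pow]
          ring
      _ = _ := by
          rw [← ENNReal.ofReal_tsum_of_nonneg (fun i => by positivity) (hsum.mul_left _),
            ← ENNReal.ofReal_add (by positivity) (tsum_nonneg fun i => by positivity),
            tsum_mul_left, weakConst]
          ring_nf
  calc volume E ^ (1 / p - 1) * ∫⁻ x in E, g x
      ≤ ENNReal.ofReal (a ^ (1 / p - 1)) * ENNReal.ofReal (r * a * weakConst p) := by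
        rw [hEa, ENNReal.ofReal_rpow_of_pos ha]
        gcongr
    _ = _ := by
        rw [← ENNReal.ofReal_mul (by positivity)]
        congr 1
        rw [hr, Real.rpow_sub ha, Real.rpow_neg ha.le, Real.rpow_one]
        field_simp

theorem weakConst_pos (p : ℝ) : 0 < weakConst p := by
  have : 0 ≤ ∑' i : ℕ, ((2 : ℝ) ^ (1 - p)) ^ i := tsum_nonneg fun i => by positivity
  unfold weakConst
  linarith

/-- A function in weak `L^p`, `p > 1`, is integrable against functions in `L^1 ∩ L^∞`: where
`g ≤ w` the second factor is integrated, and `{g > w}` has measure at most `1`. -/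
theorem lintegral_mul_le_of_avgNorm_le {p : ℝ} (hp : 1 < p) {g K : Space n → ℝ≥0∞}
    (hg : Measurable g) {w : ℝ} (hw : 0 < w) (h : avgNorm p g ≤ ENNReal.ofReal w)
    {κ : ℝ≥0∞} (hK1 : ∫⁻ x, K x ≤ κ) (hK : ∀ x, K x ≤ κ) :
    ∫⁻ x, g x * K x ≤ 2 * ENNReal.ofReal w * κ := by
  have hp0 : 0 < p := by linarith
  have hw0 : ENNReal.ofReal w ≠ 0 := by simpa using hw
  have hS : MeasurableSet {x | ENNReal.ofReal w < g x} := measurableSet_lt measurable_const hg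
  set S := {x | ENNReal.ofReal w < g x} with hSdef
  have hS1 : volume S ≤ 1 := by
    have h1 := ((mul_measure_rpow_le_weakNorm p g hw).trans (weakNorm_le_avgNorm hp hg)).trans h
    have h2 : volume S ^ (1 / p) ≤ 1 := by
      rw [← hSdef] at h1
      nth_rewrite 2 [← mul_one (ENNReal.ofReal w)] at h1
      exact (ENNReal.mul_le_mul_iff_right hw0 ENNReal.ofReal_ne_top).1 h1
    have h3 := ENNReal.rpow_le_rpow h2 hp0.le
    rwa [← ENNReal.rpow_mul, one_div_mul_cancel hp0.ne', ENNReal.rpow_one, ENNReal.one_rpow] at h3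
  have hSg : ∫⁻ x in S, g x ≤ ENNReal.ofReal w := by
    refine le_trans ?_ ((le_avgNorm p g hS).trans h)
    have : 1 ≤ volume S ^ (1 / p - 1) := by
      rw [← ENNReal.inv_le_inv, inv_one, ← ENNReal.rpow_neg]
      exact ENNReal.rpow_le_one hS1 (by
        rw [neg_nonneg, sub_nonpos, div_le_one hp0]; exact hp.le)
    calc ∫⁻ x in S, g x = 1 * ∫⁻ x in S, g x := (one_mul _).symm
      _ ≤ _ := by gcongr
  calc ∫⁻ x, g x * K x = (∫⁻ x in S, g x * K x) + ∫⁻ x in Sᶜ, g x * K x :=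
        (lintegral_add_compl _ hS).symm
    _ ≤ (∫⁻ x in S, g x * κ) + ∫⁻ x in Sᶜ, ENNReal.ofReal w * K x := by
        refine add_le_add (lintegral_mono fun x => mul_le_mul_right (hK x) _)
          (setLIntegral_mono' hS.compl fun x hx => ?_)
        have hx' : g x ≤ ENNReal.ofReal w := not_lt.1 fun h => hx h
        gcongr
    _ ≤ ENNReal.ofReal w * κ + ENNReal.ofReal w * κ := by
        rw [lintegral_mul_const _ hg, lintegral_const_mul' _ _ ENNReal.ofReal_ne_top]
        gcongr
        exact (setLIntegral_le_lintegral _ _).trans hK1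
    _ = _ := by ring

/-! ### The heat multiplier and the Wiener norm -/

/-- The Fourier multiplier of `e^{τΔ}`. -/
def heat (τ : ℝ) (ξ : Space n) : ℂ := (Real.exp (-τ * (4 * Real.pi ^ 2 * ‖ξ‖ ^ 2)) : ℂ)

theorem norm_heat (τ : ℝ) (ξ : Space n) :
    ‖heat τ ξ‖ = Real.exp (-τ * (4 * Real.pi ^ 2 * ‖ξ‖ ^ 2)) := by
  rw [heat, Complex.norm_real, Real.norm_of_nonneg (Real.exp_pos _).le]

theorem norm_heat_le_one {τ : ℝ} (hτ : 0 ≤ τ) (ξ : Space n) : ‖heat τ ξ‖ ≤ 1 := by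
  rw [norm_heat, Real.exp_le_one_iff]
  have : 0 ≤ τ * (4 * Real.pi ^ 2 * ‖ξ‖ ^ 2) := by positivity
  linarith

theorem heat_contDiff (τ : ℝ) : ContDiff ℝ ∞ (heat (n := n) τ) := by
  unfold heat
  refine Complex.ofRealCLM.contDiff.comp (Real.contDiff_exp.comp ?_)
  exact contDiff_const.mul (contDiff_const.mul (contDiff_id.norm_sq ℝ))

theorem heat_smul (τ c : ℝ) (ξ : Space n) : heat τ (c • ξ) = heat (c ^ 2 * τ) ξ := by
  unfold heat
  rw [norm_smul, Real.norm_eq_abs, mul_pow, sq_abs]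
  congr 2
  ring

theorem measurable_heat : Measurable fun q : ℝ × Space n => heat q.1 q.2 := by
  unfold heat
  fun_prop

theorem norm_iteratedFDeriv_norm_sq_le (i : ℕ) (x : Space n) :
    ‖iteratedFDeriv ℝ (i + 1) (fun x : Space n => ‖x‖ ^ 2) x‖ ≤ 2 * (1 + ‖x‖) := by
  rw [← norm_iteratedFDeriv_fderiv, fderiv_norm_sq]
  obtain ⟨I, hI⟩ : ∃ I : Space n →L[ℝ] Space n →L[ℝ] ℝ, I = innerSL ℝ := ⟨_, rfl⟩
  have hI1 : ‖I‖ ≤ 1 := by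
    rw [hI]
    exact norm_innerSL_le ℝ
  obtain ⟨L, hLdef⟩ : ∃ L, L = I + I := ⟨_, rfl⟩
  have hL : (2 • ⇑(innerSL ℝ : Space n →L[ℝ] Space n →L[ℝ] ℝ)) = ⇑L := by
    rw [← hI, hLdef]
    ext x y
    simp [two_mul]
  have hn : ‖L‖ ≤ 2 := by
    rw [hLdef]
    exact (norm_add_le I I).trans (by linarith)
  rw [hL]
  rcases i with _ | _ | i
  · rw [norm_iteratedFDeriv_zero]
    refine (ContinuousLinearMap.le_opNorm _ _).trans ?_
    nlinarith [norm_nonneg x]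
  · rw [← norm_iteratedFDeriv_fderiv, norm_iteratedFDeriv_zero, ContinuousLinearMap.fderiv]
    nlinarith [norm_nonneg x]
  · rw [← norm_iteratedFDeriv_fderiv]
    have : fderiv ℝ L = fun _ => L := by
      ext1 v
      exact ContinuousLinearMap.fderiv _
    rw [this, iteratedFDeriv_succ_const]
    simp
    positivity

/-- Each derivative of the heat multiplier costs a factor `(1 + τ) (1 + |x|)`. -/
theorem norm_iteratedFDeriv_heat_le {τ : ℝ} (hτ : 0 ≤ τ) (i : ℕ) (x : Space n) :
    ‖iteratedFDeriv ℝ i (heat τ) x‖ ≤ i.factorial *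
      Real.exp (-τ * (4 * Real.pi ^ 2 * ‖x‖ ^ 2)) *
        (8 * Real.pi ^ 2 * (1 + τ) * (1 + ‖x‖)) ^ i := by
  have hpi : 1 ≤ Real.pi ^ 2 := by nlinarith [Real.pi_gt_three]
  have hexp : ContDiff ℝ ∞ fun s : ℝ => Real.exp (-1 * s) :=
    (contDiff_const.mul contDiff_id).exp
  have hsq : ContDiff ℝ ∞ fun x : Space n => ‖x‖ ^ 2 := contDiff_id.norm_sq ℝ
  have hsq' : ContDiff ℝ ∞ fun x : Space n => (4 * Real.pi ^ 2 * τ) • ‖x‖ ^ 2 :=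
    contDiff_const.mul hsq
  have h1 : ‖iteratedFDeriv ℝ i (heat τ) x‖ = ‖iteratedFDeriv ℝ i
      ((fun s : ℝ => Real.exp (-1 * s)) ∘ fun x : Space n =>
        (4 * Real.pi ^ 2 * τ) • ‖x‖ ^ 2) x‖ := by
    have : heat (n := n) τ = Complex.ofRealLI ∘ ((fun s : ℝ => Real.exp (-1 * s)) ∘
        fun x : Space n => (4 * Real.pi ^ 2 * τ) • ‖x‖ ^ 2) := by
      ext x
      simp only [heat, Function.comp_apply, smul_eq_mul, Complex.ofRealLI_apply]
      congr 2
      ring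
    rw [this]
    exact LinearIsometry.norm_iteratedFDeriv_comp_left (n := ∞) _ (hexp.comp hsq').contDiffAt
      (by exact_mod_cast le_top)
  rw [h1]
  refine norm_iteratedFDeriv_comp_le (N := ∞) hexp hsq'
    (by exact_mod_cast le_top) x (fun k _ => ?_) (fun k hk _ => ?_)
  · rw [norm_iteratedFDeriv_eq_norm_iteratedDeriv, iteratedDeriv_exp_const_mul]
    simp only [norm_mul, norm_pow, norm_neg, norm_one, one_pow, one_mul, smul_eq_mul,
      Real.norm_eq_abs, Real.abs_exp]
    refine le_of_eq ?_
    congr 1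
    ring
  · obtain ⟨k, rfl⟩ : ∃ j, k = j + 1 := ⟨k - 1, by omega⟩
    rw [iteratedFDeriv_const_smul_apply' (hsq.contDiffAt.of_le (by exact_mod_cast le_top)),
      norm_smul, Real.norm_of_nonneg (by positivity)]
    have h3 := norm_iteratedFDeriv_norm_sq_le k x
    have h4 : 1 ≤ 8 * Real.pi ^ 2 * (1 + τ) * (1 + ‖x‖) := by
      have h5 : 1 ≤ 8 * Real.pi ^ 2 := by linarith
      have h6 : 1 ≤ 8 * Real.pi ^ 2 * (1 + τ) := one_le_mul_of_one_le_of_one_le h5 (by linarith)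
      exact one_le_mul_of_one_le_of_one_le h6 (by linarith [norm_nonneg x])
    calc 4 * Real.pi ^ 2 * τ * ‖iteratedFDeriv ℝ (k + 1) (fun x : Space n => ‖x‖ ^ 2) x‖
        ≤ 4 * Real.pi ^ 2 * τ * (2 * (1 + ‖x‖)) := by gcongr
      _ ≤ 8 * Real.pi ^ 2 * (1 + τ) * (1 + ‖x‖) := by
          have : 0 ≤ 8 * Real.pi ^ 2 * (1 + ‖x‖) := by positivity
          nlinarith
      _ ≤ _ := le_self_pow₀ h4 (by omega)

/-- Exponentials beat powers, with explicit constants. -/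
theorem one_add_pow_mul_exp_neg_le (k : ℕ) {c y : ℝ} (hc : 0 < c) (hy : 0 ≤ y) :
    (1 + y) ^ k * Real.exp (-(c * y)) ≤ k.factorial * Real.exp c / c ^ k := by
  have h := Real.pow_div_factorial_le_exp (c * (1 + y)) (by positivity) k
  rw [div_le_iff₀ (by positivity), mul_pow] at h
  rw [le_div_iff₀ (by positivity)]
  calc (1 + y) ^ k * Real.exp (-(c * y)) * c ^ k
      = c ^ k * (1 + y) ^ k * Real.exp (-(c * y)) := by ring
    _ ≤ Real.exp (c * (1 + y)) * k.factorial * Real.exp (-(c * y)) := by gcongr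
    _ = k.factorial * (Real.exp (c * (1 + y)) * Real.exp (-(c * y))) := by ring
    _ = _ := by rw [← Real.exp_add]; ring_nf

/-- The Gaussian `e^{-4π²|ξ|²}`, the multiplier of `e^Δ`, as a Schwartz function. -/
def gaussian : 𝓢(Space n, ℂ) where
  toFun := heat 1
  smooth' := heat_contDiff 1
  decay' k i := by
    refine ⟨i.factorial * (8 * Real.pi ^ 2 * (1 + 1)) ^ i *
      (2 ^ (k + i) * ((k + i).factorial * Real.exp 1 / 1 ^ (k + i))), fun x => ?_⟩
    have hpi : 1 ≤ Real.pi ^ 2 := by nlinarith [Real.pi_gt_three]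
    have h1 := norm_iteratedFDeriv_heat_le (n := n) zero_le_one i x
    have h2 := one_add_pow_mul_exp_neg_le (k + i) (c := 1) one_pos (sq_nonneg ‖x‖)
    have h3 : (1 + ‖x‖) ≤ 2 * (1 + ‖x‖ ^ 2) := by nlinarith [sq_nonneg (‖x‖ - 1)]
    have h4 : Real.exp (-1 * (4 * Real.pi ^ 2 * ‖x‖ ^ 2)) ≤ Real.exp (-(1 * ‖x‖ ^ 2)) := by
      rw [Real.exp_le_exp]
      nlinarith [sq_nonneg ‖x‖]
    calc ‖x‖ ^ k * ‖iteratedFDeriv ℝ i (heat 1) x‖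
        ≤ (1 + ‖x‖) ^ k * (i.factorial * Real.exp (-(1 * ‖x‖ ^ 2)) *
          (8 * Real.pi ^ 2 * (1 + 1) * (1 + ‖x‖)) ^ i) := by
          refine mul_le_mul (pow_le_pow_left₀ (norm_nonneg _) (by linarith) _) (h1.trans ?_)
            (norm_nonneg _) (by positivity)
          gcongr
      _ = i.factorial * (8 * Real.pi ^ 2 * (1 + 1)) ^ i *
          ((1 + ‖x‖) ^ (k + i) * Real.exp (-(1 * ‖x‖ ^ 2))) := by
          rw [mul_pow _ (1 + ‖x‖), pow_add]
          ring
      _ ≤ i.factorial * (8 * Real.pi ^ 2 * (1 + 1)) ^ i *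
          ((2 * (1 + ‖x‖ ^ 2)) ^ (k + i) * Real.exp (-(1 * ‖x‖ ^ 2))) := by gcongr
      _ = i.factorial * (8 * Real.pi ^ 2 * (1 + 1)) ^ i *
          (2 ^ (k + i) * ((1 + ‖x‖ ^ 2) ^ (k + i) * Real.exp (-(1 * ‖x‖ ^ 2)))) := by
          rw [mul_pow 2 (1 + ‖x‖ ^ 2)]
          ring
      _ ≤ _ := by gcongr

/-- The Wiener norm `‖𝓕 f‖_{L¹}`. -/
def wienerNorm (f : Space n → ℂ) : ℝ≥0∞ := ∫⁻ x, ‖𝓕 f x‖ₑ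

theorem wienerNorm_schwartz_lt_top (f : 𝓢(Space n, ℂ)) : wienerNorm f < ⊤ := by
  have := (𝓕 f).integrable (μ := volume)
  rw [SchwartzMap.fourier_coe] at this
  exact this.hasFiniteIntegral

theorem fourier_comp_smul {c : ℝ} (hc : 0 < c) (f : Space n → ℂ) (x : Space n) :
    𝓕 (fun ξ => f (c • ξ)) x = ((c ^ n)⁻¹ : ℝ) • 𝓕 f (c⁻¹ • x) := by
  rw [Real.fourier_eq, Real.fourier_eq]
  have h := Measure.integral_comp_smul (volume : Measure (Space n))
    (fun v => Real.fourierChar (-inner ℝ v (c⁻¹ • x)) • f v) c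
  rw [abs_of_pos (by positivity), finrank_euclideanSpace_fin] at h
  rw [← h]
  congr 1
  ext v
  rw [inner_smul_left, inner_smul_right]
  simp [hc.ne']

theorem lintegral_comp_smul {c : ℝ} (hc : 0 < c) (f : Space n → ℝ≥0∞) :
    ∫⁻ x, f (c • x) = ENNReal.ofReal ((c ^ n)⁻¹) * ∫⁻ x, f x := by
  have h := Measure.map_addHaar_smul (volume : Measure (Space n)) hc.ne'
  rw [abs_of_pos (by positivity), finrank_euclideanSpace_fin] at h
  have e : ∫⁻ x, f (c • x) = ∫⁻ y, f y ∂(Measure.map (fun x => c • x) volume) :=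
    (lintegral_map_equiv f (Homeomorph.smulOfNeZero c hc.ne').toMeasurableEquiv).symm
  rw [e, h, lintegral_smul_measure, smul_eq_mul]

/-- The Wiener norm is invariant under dilations. -/
theorem wienerNorm_comp_smul {c : ℝ} (hc : 0 < c) (f : Space n → ℂ) :
    wienerNorm (fun ξ => f (c • ξ)) = wienerNorm f := by
  unfold wienerNorm
  have h : ∀ x, ‖𝓕 (fun ξ => f (c • ξ)) x‖ₑ =
      ENNReal.ofReal ((c ^ n)⁻¹) * ‖𝓕 f (c⁻¹ • x)‖ₑ := fun x => by
    rw [fourier_comp_smul hc, enorm_smul, Real.enorm_of_nonneg (by positivity)]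
  simp only [h]
  rw [lintegral_const_mul' _ _ ENNReal.ofReal_ne_top,
    lintegral_comp_smul (inv_pos.2 hc) (fun x => ‖𝓕 f x‖ₑ), ← mul_assoc,
    ← ENNReal.ofReal_mul (by positivity)]
  simp [hc.ne']

theorem wienerNorm_eq_fourierInv (f : Space n → ℂ) : wienerNorm f = ∫⁻ x, ‖𝓕⁻ f x‖ₑ := by
  simp only [Real.fourierInv_eq_fourier_neg]
  exact (lintegral_neg_eq_self (μ := volume) (fun x => ‖𝓕 f x‖ₑ)).symm

theorem fourierInv_mul (f g : 𝓢(Space n, ℂ)) (x : Space n) : 𝓕⁻ (fun ξ => f ξ * g ξ) x =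
    ∫ t, 𝓕⁻ (f : Space n → ℂ) t * 𝓕⁻ (g : Space n → ℂ) (x - t) := by
  have h1 := SchwartzMap.convolution_apply (ContinuousLinearMap.mul ℂ ℂ) (𝓕⁻ f) (𝓕⁻ g) x
  have h2 : SchwartzMap.convolution (ContinuousLinearMap.mul ℂ ℂ) (𝓕⁻ f) (𝓕⁻ g) =
      𝓕⁻ (SchwartzMap.pairing (ContinuousLinearMap.mul ℂ ℂ) f g) := by
    simp [SchwartzMap.convolution]
  have h3 : ⇑(SchwartzMap.pairing (ContinuousLinearMap.mul ℂ ℂ) f g) =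
      fun ξ => f ξ * g ξ := rfl
  rw [h2, SchwartzMap.fourierInv_coe, convolution_def, h3] at h1
  simpa only [ContinuousLinearMap.mul_apply', SchwartzMap.fourierInv_coe] using h1

/-- The Wiener norm is submultiplicative, by Young's inequality. -/
theorem wienerNorm_mul_le (f g : 𝓢(Space n, ℂ)) :
    wienerNorm (fun ξ => f ξ * g ξ) ≤ wienerNorm f * wienerNorm g := by
  rw [wienerNorm_eq_fourierInv, wienerNorm_eq_fourierInv f, wienerNorm_eq_fourierInv g]
  have hm : ∀ h : 𝓢(Space n, ℂ), Measurable fun x => ‖𝓕⁻ (h : Space n → ℂ) x‖ₑ := fun h => by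
    rw [← SchwartzMap.fourierInv_coe]
    exact (𝓕⁻ h).continuous.measurable.enorm
  calc ∫⁻ x, ‖𝓕⁻ (fun ξ => f ξ * g ξ) x‖ₑ
      ≤ ∫⁻ x, ∫⁻ t, ‖𝓕⁻ (f : Space n → ℂ) t‖ₑ * ‖𝓕⁻ (g : Space n → ℂ) (x - t)‖ₑ := by
        refine lintegral_mono fun x => ?_
        rw [fourierInv_mul]
        refine (enorm_integral_le_lintegral_enorm _).trans (le_of_eq ?_)
        simp
    _ = ∫⁻ t, ∫⁻ x, ‖𝓕⁻ (f : Space n → ℂ) t‖ₑ * ‖𝓕⁻ (g : Space n → ℂ) (x - t)‖ₑ := by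
        refine lintegral_lintegral_swap ?_
        have h1 := hm f
        have h2 := (hm g).comp (measurable_fst.sub measurable_snd :
          Measurable fun q : Space n × Space n => q.1 - q.2)
        exact ((h1.comp measurable_snd).mul h2).aemeasurable
    _ = ∫⁻ t, ‖𝓕⁻ (f : Space n → ℂ) t‖ₑ * ∫⁻ x, ‖𝓕⁻ (g : Space n → ℂ) x‖ₑ := by
        refine lintegral_congr fun t => ?_
        rw [lintegral_const_mul' _ _ enorm_ne_top,
          lintegral_sub_right_eq_self (fun x => ‖𝓕⁻ (g : Space n → ℂ) x‖ₑ) t]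
    _ = _ := lintegral_mul_const _ (hm f)

theorem heat_eq_gaussian {r : ℝ} (hr : 0 < r) (ξ : Space n) :
    heat r ξ = gaussian (Real.sqrt r • ξ) := by
  change heat r ξ = heat 1 (Real.sqrt r • ξ)
  rw [heat_smul, Real.sq_sqrt hr.le, mul_one]

/-- Multiplication by a dilated Schwartz function is bounded in the Wiener norm, uniformly in the
dilation. -/
theorem wienerNorm_dilation_mul_le (g ψ : 𝓢(Space n, ℂ)) {c : ℝ} (hc : 0 < c) :
    wienerNorm (fun ξ => g (c • ξ) * ψ ξ) ≤ wienerNorm g * wienerNorm ψ := by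
  set χ : 𝓢(Space n, ℂ) := SchwartzMap.compCLMOfContinuousLinearEquiv ℂ
    (ContinuousLinearEquiv.smulLeft (Units.mk0 c hc.ne')) g with hχ
  have h : ∀ ξ, χ ξ = g (c • ξ) := fun ξ => by
    simp [hχ, ContinuousLinearEquiv.smulLeft, Units.smul_def]
  have h1 := wienerNorm_mul_le χ ψ
  have h2 : wienerNorm χ = wienerNorm g := by
    rw [← wienerNorm_comp_smul hc g]
    exact congrArg wienerNorm (funext h)
  rw [h2] at h1
  simpa only [h] using h1

theorem wienerNorm_heat_mul_le {r : ℝ} (hr : 0 < r) (ψ : 𝓢(Space n, ℂ)) :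
    wienerNorm (fun ξ => heat r ξ * ψ ξ) ≤ wienerNorm (gaussian (n := n)) * wienerNorm ψ := by
  simp only [heat_eq_gaussian hr]
  exact wienerNorm_dilation_mul_le gaussian ψ (Real.sqrt_pos.2 hr)

theorem fourier_const_mul (c : ℂ) (f : Space n → ℂ) (x : Space n) :
    𝓕 (fun y => c * f y) x = c * 𝓕 f x := by
  rw [Real.fourier_eq, Real.fourier_eq, ← integral_const_mul]
  simp only [Circle.smul_def, smul_eq_mul, mul_left_comm]

theorem wienerNorm_const_mul (c : ℂ) (f : Space n → ℂ) :
    wienerNorm (fun ξ => c * f ξ) = ‖c‖ₑ * wienerNorm f := by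
  unfold wienerNorm
  rw [← lintegral_const_mul' _ _ enorm_ne_top]
  refine lintegral_congr fun x => ?_
  rw [← enorm_mul, fourier_const_mul]

/-! ### First-order symbols -/

/-- The Fourier transform depends measurably on a parameter, without integrability assumptions. -/
theorem measurable_fourier_param {f : ℝ × Space n → ℂ} (hf : Measurable f) :
    Measurable fun q : ℝ × Space n => 𝓕 (fun ξ => f (q.1, ξ)) q.2 := by
  simp only [Real.fourier_eq]
  refine (StronglyMeasurable.integral_prod_right
    (f := fun (q : ℝ × Space n) (v : Space n) =>
      Real.fourierChar (-inner ℝ v q.2) • f (q.1, v)) ?_).measurable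
  refine Measurable.stronglyMeasurable ?_
  have h1 : Measurable fun z : (ℝ × Space n) × Space n =>
      (Real.fourierChar (-inner ℝ z.2 z.1.2) : ℂ) := by
    refine Continuous.measurable ?_
    exact continuous_subtype_val.comp (Real.continuous_fourierChar.comp (by fun_prop))
  exact h1.mul (hf.comp ((measurable_fst.comp measurable_fst).prodMk measurable_snd))

theorem enorm_fourier_le (f : Space n → ℂ) (x : Space n) : ‖𝓕 f x‖ₑ ≤ ∫⁻ ξ, ‖f ξ‖ₑ := by
  rw [Real.fourier_eq]
  refine (enorm_integral_le_lintegral_enorm _).trans (le_of_eq ?_)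
  refine lintegral_congr fun v => ?_
  rw [← ofReal_norm, Circle.norm_smul, ofReal_norm]

theorem wienerNorm_eq_norm_toLp (ψ : 𝓢(Space n, ℂ)) :
    wienerNorm ψ = ENNReal.ofReal ‖(𝓕 ψ).toLp 1‖ := by
  rw [SchwartzMap.norm_toLp_one, ofReal_integral_norm_eq_lintegral_enorm (𝓕 ψ).integrable]
  rfl

/-- The part of the structure of the symbols of `∂_l` and `∂_l ∂_{l'} ∂_{l''} (-Δ)⁻¹` which the
estimates rely on: they are smooth away from the origin, homogeneous of degree one, and
composed with `e^{τΔ}`, `τ > 0`, they map test functions to `L¹`, uniformly in `τ` and continuously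
at `0`. -/
structure IsFirstOrder (P : Space n → ℂ) : Prop where
  smooth : ∀ ξ, ξ ≠ 0 → ContDiffAt ℝ ∞ P ξ
  homogeneous : ∀ c : ℝ, 0 < c → ∀ ξ, P (c • ξ) = c * P ξ
  measurable : Measurable P
  bound : ∃ C, ∀ ξ, ‖P ξ‖ ≤ C * ‖ξ‖
  wiener : ∃ κ : 𝓢(Space n, ℂ) → ℝ, Filter.Tendsto κ (nhds 0) (nhds 0) ∧ (∀ φ, 0 ≤ κ φ) ∧
    ∀ φ : 𝓢(Space n, ℂ), ∀ τ : ℝ, 0 < τ →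
      wienerNorm (fun ξ => heat τ ξ * P ξ * (𝓕⁻ φ : 𝓢(Space n, ℂ)) ξ) ≤ ENNReal.ofReal (κ φ)

/-- The symbol of `∂_l`. -/
def partialSymbol (l : Fin n) (ξ : Space n) : ℂ := 2 * Real.pi * Complex.I * (ξ l : ℂ)

theorem partialSymbol_eq_clm (l : Fin n) : ∃ L : Space n →L[ℝ] ℂ, ∀ ξ, partialSymbol l ξ = L ξ :=
  ⟨(2 * Real.pi * Complex.I : ℂ) • (Complex.ofRealCLM.comp (EuclideanSpace.proj (𝕜 := ℝ) l)),
    fun ξ => by simp [partialSymbol]⟩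

theorem partialSymbol_contDiff (l : Fin n) : ContDiff ℝ ∞ (partialSymbol l) := by
  obtain ⟨L, hL⟩ := partialSymbol_eq_clm l
  rw [funext hL]
  exact L.contDiff

theorem partialSymbol_hasTemperateGrowth (l : Fin n) :
    Function.HasTemperateGrowth (partialSymbol l) := by
  obtain ⟨L, hL⟩ := partialSymbol_eq_clm l
  rw [funext hL]
  exact L.hasTemperateGrowth

theorem partialSymbol_smul (l : Fin n) (c : ℝ) (ξ : Space n) :
    partialSymbol l (c • ξ) = c * partialSymbol l ξ := by
  simp [partialSymbol]
  ring

theorem norm_partialSymbol_le (l : Fin n) (ξ : Space n) :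
    ‖partialSymbol l ξ‖ ≤ 2 * Real.pi * ‖ξ‖ := by
  have h : ‖ξ l‖ ≤ ‖ξ‖ := PiLp.norm_apply_le ξ l
  rw [partialSymbol, norm_mul, Complex.norm_real]
  simp only [norm_mul, Complex.norm_ofNat, Complex.norm_real, Complex.norm_I, mul_one,
    Real.norm_of_nonneg Real.pi_pos.le]
  gcongr

theorem tendsto_norm_toLp (T : 𝓢(Space n, ℂ) →L[ℂ] 𝓢(Space n, ℂ)) :
    Filter.Tendsto (fun φ => ‖(T φ).toLp 1‖) (nhds 0) (nhds 0) := by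
  have h : Continuous fun φ => ‖(T φ).toLp 1‖ :=
    (SchwartzMap.continuous_toLp.comp T.continuous).norm
  have h0 := h.tendsto 0
  have h1 : ‖(T 0).toLp 1‖ = 0 := by
    rw [SchwartzMap.norm_toLp_one, map_zero]
    simp
  rwa [h1] at h0

theorem tendsto_norm_fourier_toLp (T : 𝓢(Space n, ℂ) →L[ℂ] 𝓢(Space n, ℂ)) :
    Filter.Tendsto (fun φ => ‖(𝓕 (T φ) : 𝓢(Space n, ℂ)).toLp 1‖) (nhds 0) (nhds 0) :=
  tendsto_norm_toLp (FourierTransform.fourierCLM ℂ 𝓢(Space n, ℂ) ∘L T)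

/-- The operator `φ ↦ p 𝓕⁻ φ` on Schwartz functions. -/
def mulFourierInv (p : Space n → ℂ) : 𝓢(Space n, ℂ) →L[ℂ] 𝓢(Space n, ℂ) :=
  SchwartzMap.smulLeftCLM ℂ p ∘L FourierTransform.fourierInvCLM ℂ 𝓢(Space n, ℂ)

theorem mulFourierInv_apply {p : Space n → ℂ} (hp : p.HasTemperateGrowth) (φ : 𝓢(Space n, ℂ))
    (ξ : Space n) : mulFourierInv p φ ξ = p ξ * (𝓕⁻ φ : 𝓢(Space n, ℂ)) ξ := by
  simp [mulFourierInv, SchwartzMap.smulLeftCLM_apply_apply hp]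

theorem isFirstOrder_partialSymbol (l : Fin n) : IsFirstOrder (partialSymbol l) where
  smooth ξ _ := (partialSymbol_contDiff l).contDiffAt
  homogeneous c _ ξ := partialSymbol_smul l c ξ
  measurable := (partialSymbol_contDiff l).continuous.measurable
  bound := ⟨_, norm_partialSymbol_le l⟩
  wiener := by
    have hG := wienerNorm_schwartz_lt_top (gaussian (n := n))
    set G := (wienerNorm (gaussian (n := n))).toReal with hGdef
    refine ⟨fun φ => G * ‖(𝓕 (mulFourierInv (partialSymbol l) φ) : 𝓢(Space n, ℂ)).toLp 1‖, ?_,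
      fun φ => by positivity, fun φ τ hτ => ?_⟩
    · simpa using (tendsto_norm_fourier_toLp (mulFourierInv (partialSymbol l))).const_mul G
    · have h := wienerNorm_heat_mul_le hτ (mulFourierInv (partialSymbol l) φ)
      rw [wienerNorm_eq_norm_toLp (mulFourierInv (partialSymbol l) φ),
        ← ENNReal.ofReal_toReal hG.ne, ← ENNReal.ofReal_mul ENNReal.toReal_nonneg] at h
      simpa only [mulFourierInv_apply (partialSymbol_hasTemperateGrowth l), ← mul_assoc] using h

/-- The symbol of `∂_l ∂_{l'} ∂_{l''}`. -/
def tripleSymbol (l l' l'' : Fin n) (ξ : Space n) : ℂ :=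
  partialSymbol l ξ * partialSymbol l' ξ * partialSymbol l'' ξ

/-- The symbol of `∂_l ∂_{l'} ∂_{l''} (-Δ)⁻¹`, with the value `0` at the origin given by `0 / 0 = 0`,
which is the value of its continuous extension. -/
def rieszSymbol (l l' l'' : Fin n) (ξ : Space n) : ℂ :=
  tripleSymbol l l' l'' ξ / (4 * Real.pi ^ 2 * ‖ξ‖ ^ 2 : ℝ)

theorem tripleSymbol_contDiff (l l' l'' : Fin n) : ContDiff ℝ ∞ (tripleSymbol l l' l'') :=
  ((partialSymbol_contDiff l).mul (partialSymbol_contDiff l')).mul (partialSymbol_contDiff l'')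

theorem tripleSymbol_hasTemperateGrowth (l l' l'' : Fin n) :
    Function.HasTemperateGrowth (tripleSymbol l l' l'') :=
  ((partialSymbol_hasTemperateGrowth l).mul (partialSymbol_hasTemperateGrowth l')).mul
    (partialSymbol_hasTemperateGrowth l'')

theorem tripleSymbol_smul (l l' l'' : Fin n) (c : ℝ) (ξ : Space n) :
    tripleSymbol l l' l'' (c • ξ) = (c : ℂ) ^ 3 * tripleSymbol l l' l'' ξ := by
  simp only [tripleSymbol, partialSymbol_smul]
  ring

theorem norm_rieszSymbol_le (l l' l'' : Fin n) (ξ : Space n) :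
    ‖rieszSymbol l l' l'' ξ‖ ≤ 2 * Real.pi * ‖ξ‖ := by
  rcases eq_or_ne ξ 0 with rfl | hξ
  · simp [rieszSymbol]
  have hpos : 0 < ‖ξ‖ := norm_pos_iff.2 hξ
  rw [rieszSymbol, norm_div, Complex.norm_real, Real.norm_of_nonneg (by positivity),
    div_le_iff₀ (by positivity), tripleSymbol, norm_mul, norm_mul]
  calc ‖partialSymbol l ξ‖ * ‖partialSymbol l' ξ‖ * ‖partialSymbol l'' ξ‖
      ≤ (2 * Real.pi * ‖ξ‖) * (2 * Real.pi * ‖ξ‖) * (2 * Real.pi * ‖ξ‖) := by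
        gcongr <;> exact norm_partialSymbol_le _ ξ
    _ = _ := by ring

theorem rieszSymbol_measurable (l l' l'' : Fin n) : Measurable (rieszSymbol l l' l'') :=
  (tripleSymbol_contDiff l l' l'').continuous.measurable.div (by fun_prop)

theorem heat_mul_ofReal (r : ℝ) (ξ : Space n) :
    heat r ξ = (Real.exp (-(4 * Real.pi ^ 2 * ‖ξ‖ ^ 2) * r) : ℝ) := by
  rw [heat]
  congr 2
  ring

/-- Inverting the Laplacian by integrating the heat semigroup. -/
theorem heat_mul_rieszSymbol (l l' l'' : Fin n) (τ : ℝ) (ξ : Space n) :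
    heat τ ξ * rieszSymbol l l' l'' ξ =
      ∫ r in Set.Ioi τ, heat r ξ * tripleSymbol l l' l'' ξ := by
  rcases eq_or_ne ξ 0 with rfl | hξ
  · have : tripleSymbol l l' l'' (0 : Space n) = 0 := by simp [tripleSymbol, partialSymbol]
    simp [rieszSymbol, this]
  have hpos : 0 < ‖ξ‖ := norm_pos_iff.2 hξ
  have hb : -(4 * Real.pi ^ 2 * ‖ξ‖ ^ 2) < 0 := by
    have : 0 < 4 * Real.pi ^ 2 * ‖ξ‖ ^ 2 := by positivity
    linarith
  rw [integral_mul_const]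
  simp only [heat_mul_ofReal]
  rw [integral_complex_ofReal, integral_exp_mul_Ioi hb, rieszSymbol]
  push_cast
  have h1 : (Real.pi : ℂ) ≠ 0 := by exact_mod_cast Real.pi_ne_zero
  have h2 : ((‖ξ‖ : ℝ) : ℂ) ≠ 0 := by exact_mod_cast hpos.ne'
  field_simp

theorem integrable_norm_mul_schwartz (ψ : 𝓢(Space n, ℂ)) :
    Integrable fun ξ => ‖ξ‖ * ‖ψ ξ‖ := by
  simpa using ψ.integrable_pow_mul volume 1

theorem fourier_heat_mul_rieszSymbol (l l' l'' : Fin n) {τ : ℝ} (hτ : 0 < τ)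
    (ψ : 𝓢(Space n, ℂ)) (x : Space n) :
    𝓕 (fun ξ => heat τ ξ * rieszSymbol l l' l'' ξ * ψ ξ) x =
      ∫ r in Set.Ioi τ, 𝓕 (fun ξ => heat r ξ * tripleSymbol l l' l'' ξ * ψ ξ) x := by
  simp only [Real.fourier_eq]
  have hm : Measurable fun q : Space n × ℝ =>
      heat q.2 q.1 * tripleSymbol l l' l'' q.1 * ψ q.1 := by
    have h1 := measurable_heat (n := n) |>.comp (measurable_swap (α := Space n) (β := ℝ))
    have h2 := (tripleSymbol_contDiff l l' l'').continuous.measurable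
    have h3 := ψ.continuous.measurable
    exact (h1.mul (h2.comp measurable_fst)).mul (h3.comp measurable_fst)
  have hchar : Measurable fun q : Space n × ℝ => (Real.fourierChar (-inner ℝ q.1 x) : ℂ) := by
    refine Continuous.measurable ?_
    exact continuous_subtype_val.comp (Real.continuous_fourierChar.comp (by fun_prop))
  have hnorm : ∀ ξ : Space n, ∀ r : ℝ,
      ‖Real.fourierChar (-inner ℝ ξ x) • (heat r ξ * tripleSymbol l l' l'' ξ * ψ ξ)‖ =
        Real.exp (-(4 * Real.pi ^ 2 * ‖ξ‖ ^ 2) * r) * ‖tripleSymbol l l' l'' ξ * ψ ξ‖ := by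
    intro ξ r
    rw [Circle.norm_smul, mul_assoc, norm_mul, heat_mul_ofReal, Complex.norm_real,
      Real.norm_of_nonneg (Real.exp_pos _).le]
  have hint : Integrable (fun q : Space n × ℝ =>
      Real.fourierChar (-inner ℝ q.1 x) •
        (heat q.2 q.1 * tripleSymbol l l' l'' q.1 * ψ q.1))
      (volume.prod (volume.restrict (Set.Ioi τ))) := by
    have hm' : AEStronglyMeasurable (fun q : Space n × ℝ =>
        Real.fourierChar (-inner ℝ q.1 x) •
          (heat q.2 q.1 * tripleSymbol l l' l'' q.1 * ψ q.1))
        (volume.prod (volume.restrict (Set.Ioi τ))) :=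
      (hchar.mul hm).aestronglyMeasurable
    rw [integrable_prod_iff hm']
    refine ⟨Filter.Eventually.of_forall fun ξ => ?_, ?_⟩
    · rcases eq_or_ne ξ 0 with rfl | hξ
      · have : tripleSymbol l l' l'' (0 : Space n) = 0 := by simp [tripleSymbol, partialSymbol]
        simp [this]
      have hpos : 0 < ‖ξ‖ := norm_pos_iff.2 hξ
      have hb : -(4 * Real.pi ^ 2 * ‖ξ‖ ^ 2) < 0 := by
        have : 0 < 4 * Real.pi ^ 2 * ‖ξ‖ ^ 2 := by positivity
        linarith
      refine Integrable.mono' ((integrableOn_exp_mul_Ioi hb τ).mul_const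
        ‖tripleSymbol l l' l'' ξ * ψ ξ‖) ?_ (Filter.Eventually.of_forall fun r => (hnorm ξ r).le)
      exact ((hchar.mul hm).comp (measurable_prodMk_left (x := ξ))).aestronglyMeasurable
    · simp only [hnorm]
      have h1 : ∀ ξ : Space n, ∫ r in Set.Ioi τ, Real.exp (-(4 * Real.pi ^ 2 * ‖ξ‖ ^ 2) * r) *
          ‖tripleSymbol l l' l'' ξ * ψ ξ‖ = ‖heat τ ξ * rieszSymbol l l' l'' ξ * ψ ξ‖ := by
        intro ξ
        rw [integral_mul_const, norm_mul, norm_mul, norm_mul, ← mul_assoc]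
        congr 1
        rcases eq_or_ne ξ 0 with rfl | hξ
        · have : tripleSymbol l l' l'' (0 : Space n) = 0 := by simp [tripleSymbol, partialSymbol]
          simp [this, rieszSymbol]
        have hpos : 0 < ‖ξ‖ := norm_pos_iff.2 hξ
        have hb : -(4 * Real.pi ^ 2 * ‖ξ‖ ^ 2) < 0 := by
          have : 0 < 4 * Real.pi ^ 2 * ‖ξ‖ ^ 2 := by positivity
          linarith
        rw [integral_exp_mul_Ioi hb, heat_mul_ofReal, rieszSymbol, norm_div, Complex.norm_real,
          Complex.norm_real, Real.norm_of_nonneg (Real.exp_pos _).le,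
          Real.norm_of_nonneg (by positivity)]
        field_simp
      simp only [h1]
      refine Integrable.mono' ((integrable_norm_mul_schwartz ψ).const_mul (2 * Real.pi)) ?_
        (Filter.Eventually.of_forall fun ξ => ?_)
      · exact ((((measurable_heat.comp (measurable_prodMk_left (x := τ))).mul
          (rieszSymbol_measurable l l' l'')).mul
            ψ.continuous.measurable).norm).aestronglyMeasurable
      · rw [norm_norm, norm_mul, norm_mul, ← mul_assoc]
        refine mul_le_mul_of_nonneg_right ?_ (norm_nonneg _)
        calc ‖heat τ ξ‖ * ‖rieszSymbol l l' l'' ξ‖ ≤ 1 * (2 * Real.pi * ‖ξ‖) := by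
              gcongr
              · exact norm_heat_le_one hτ.le ξ
              · exact norm_rieszSymbol_le l l' l'' ξ
          _ = _ := one_mul _
  rw [← integral_integral_swap hint]
  congr 1
  ext ξ
  simp only [Circle.smul_def, smul_eq_mul]
  rw [integral_const_mul, integral_mul_const, ← heat_mul_rieszSymbol]

theorem heat_mul_tripleSymbol (l l' l'' : Fin n) {r : ℝ} (hr : 0 < r) (ξ : Space n) :
    heat r ξ * tripleSymbol l l' l'' ξ = ((r ^ (-(3 / 2 : ℝ)) : ℝ) : ℂ) *
      SchwartzMap.smulLeftCLM ℂ (tripleSymbol l l' l'') gaussian (Real.sqrt r • ξ) := by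
  rw [SchwartzMap.smulLeftCLM_apply_apply (tripleSymbol_hasTemperateGrowth l l' l''),
    heat_eq_gaussian hr, tripleSymbol_smul, smul_eq_mul]
  have h : ((r ^ (-(3 / 2 : ℝ)) : ℝ) : ℂ) * ((Real.sqrt r : ℝ) : ℂ) ^ 3 = 1 := by
    rw [← Complex.ofReal_pow, ← Complex.ofReal_mul, Real.sqrt_eq_rpow, ← Real.rpow_natCast,
      ← Real.rpow_mul hr.le, ← Real.rpow_add hr]
    norm_num
  linear_combination (-(gaussian (Real.sqrt r • ξ) * tripleSymbol l l' l'' ξ)) * h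

theorem setLIntegral_Ioi_one_rpow :
    ∫⁻ r in Set.Ioi (1 : ℝ), ENNReal.ofReal (r ^ (-(3 / 2 : ℝ))) = ENNReal.ofReal 2 := by
  rw [← ofReal_integral_eq_lintegral_ofReal
    (integrableOn_Ioi_rpow_of_lt (by norm_num) one_pos)
    ((ae_restrict_iff' measurableSet_Ioi).2 (Filter.Eventually.of_forall fun r hr => by
      have : 0 < r := lt_trans one_pos hr
      positivity)), integral_Ioi_rpow_of_lt (by norm_num) one_pos]
  norm_num

/-- The multiplier norm on `L¹` test functions is estimated by writing `(-Δ)⁻¹ = ∫ e^{rΔ} dr`: the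
derivatives fall on the test function for `r ≤ 1` and on the Gaussian for `r ≥ 1`, which gains the
integrable factor `r^{-3/2}`. -/
theorem wienerNorm_heat_mul_rieszSymbol_le (l l' l'' : Fin n) {τ : ℝ} (hτ : 0 < τ)
    (ψ : 𝓢(Space n, ℂ)) :
    wienerNorm (fun ξ => heat τ ξ * rieszSymbol l l' l'' ξ * ψ ξ) ≤
      wienerNorm (gaussian (n := n)) *
        wienerNorm (SchwartzMap.smulLeftCLM ℂ (tripleSymbol l l' l'') ψ) +
      ENNReal.ofReal 2 * (wienerNorm (SchwartzMap.smulLeftCLM ℂ (tripleSymbol l l' l'')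
        (gaussian (n := n))) * wienerNorm ψ) := by
  set p := tripleSymbol l l' l'' with hp
  have hpg : p.HasTemperateGrowth := tripleSymbol_hasTemperateGrowth l l' l''
  have hmeas : Measurable fun q : ℝ × Space n =>
      𝓕 (fun ξ => heat q.1 ξ * p ξ * ψ ξ) q.2 :=
    measurable_fourier_param (f := fun q => heat q.1 q.2 * p q.2 * ψ q.2)
      ((measurable_heat.mul ((tripleSymbol_contDiff l l' l'').continuous.measurable.comp
        measurable_snd)).mul (ψ.continuous.measurable.comp measurable_snd))
  have h1 : ∀ r : ℝ, 0 < r → wienerNorm (fun ξ => heat r ξ * p ξ * ψ ξ) ≤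
      wienerNorm (gaussian (n := n)) * wienerNorm (SchwartzMap.smulLeftCLM ℂ p ψ) := fun r hr => by
    have h := wienerNorm_heat_mul_le hr (SchwartzMap.smulLeftCLM ℂ p ψ)
    simpa only [SchwartzMap.smulLeftCLM_apply_apply hpg, smul_eq_mul, ← mul_assoc] using h
  have h2 : ∀ r : ℝ, 0 < r → wienerNorm (fun ξ => heat r ξ * p ξ * ψ ξ) ≤
      ENNReal.ofReal (r ^ (-(3 / 2 : ℝ))) *
        (wienerNorm (SchwartzMap.smulLeftCLM ℂ p (gaussian (n := n))) * wienerNorm ψ) := by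
    intro r hr
    simp only [hp, heat_mul_tripleSymbol l l' l'' hr, mul_assoc]
    rw [wienerNorm_const_mul, ← ofReal_norm, Complex.norm_real,
      Real.norm_of_nonneg (by positivity)]
    exact mul_le_mul_right (wienerNorm_dilation_mul_le _ ψ (Real.sqrt_pos.2 hr)) _
  calc wienerNorm (fun ξ => heat τ ξ * rieszSymbol l l' l'' ξ * ψ ξ)
      ≤ ∫⁻ x, ∫⁻ r in Set.Ioi τ, ‖𝓕 (fun ξ => heat r ξ * p ξ * ψ ξ) x‖ₑ := by
        refine lintegral_mono fun x => ?_
        rw [fourier_heat_mul_rieszSymbol l l' l'' hτ]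
        exact enorm_integral_le_lintegral_enorm _
    _ = ∫⁻ r in Set.Ioi τ, wienerNorm (fun ξ => heat r ξ * p ξ * ψ ξ) := by
        refine lintegral_lintegral_swap
          (f := fun (x : Space n) (r : ℝ) => ‖𝓕 (fun ξ => heat r ξ * p ξ * ψ ξ) x‖ₑ) ?_
        exact (hmeas.enorm.comp (measurable_swap (α := Space n) (β := ℝ))).aemeasurable
    _ ≤ ∫⁻ r in Set.Ioc 0 1 ∪ Set.Ioi 1, wienerNorm (fun ξ => heat r ξ * p ξ * ψ ξ) := by
        refine lintegral_mono_set fun r hr => ?_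
        rcases le_or_gt r 1 with h | h
        · exact Or.inl ⟨hτ.trans hr, h⟩
        · exact Or.inr h
    _ ≤ (∫⁻ r in Set.Ioc 0 1, wienerNorm (fun ξ => heat r ξ * p ξ * ψ ξ)) +
          ∫⁻ r in Set.Ioi 1, wienerNorm (fun ξ => heat r ξ * p ξ * ψ ξ) :=
        lintegral_union_le _ _ _
    _ ≤ (∫⁻ _ in Set.Ioc (0 : ℝ) 1, wienerNorm (gaussian (n := n)) *
            wienerNorm (SchwartzMap.smulLeftCLM ℂ p ψ)) +
          ∫⁻ r in Set.Ioi (1 : ℝ), ENNReal.ofReal (r ^ (-(3 / 2 : ℝ))) *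
            (wienerNorm (SchwartzMap.smulLeftCLM ℂ p (gaussian (n := n))) * wienerNorm ψ) :=
        add_le_add (setLIntegral_mono' measurableSet_Ioc fun r hr => h1 r hr.1)
          (setLIntegral_mono' measurableSet_Ioi fun r hr => h2 r (lt_trans one_pos hr))
    _ = _ := by
        rw [setLIntegral_const, Real.volume_Ioc, sub_zero, ENNReal.ofReal_one, mul_one,
          lintegral_mul_const _ (by fun_prop), setLIntegral_Ioi_one_rpow]

theorem isFirstOrder_rieszSymbol (l l' l'' : Fin n) : IsFirstOrder (rieszSymbol l l' l'') where
  smooth ξ hξ := by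
    have h0 : ‖ξ‖ ≠ 0 := norm_ne_zero_iff.2 hξ
    refine (tripleSymbol_contDiff l l' l'').contDiffAt.mul (ContDiffAt.inv ?_ ?_)
    · refine (Complex.ofRealCLM.contDiff.comp ?_).contDiffAt
      exact contDiff_const.mul (contDiff_id.norm_sq ℝ)
    · have : 4 * Real.pi ^ 2 * ‖ξ‖ ^ 2 ≠ 0 := by
        have := Real.pi_pos
        positivity
      exact_mod_cast this
  homogeneous c hc ξ := by
    have hc' : (c : ℂ) ≠ 0 := by exact_mod_cast hc.ne'
    rw [rieszSymbol, rieszSymbol, tripleSymbol_smul, norm_smul, Real.norm_of_nonneg hc.le]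
    push_cast
    rcases eq_or_ne ξ 0 with rfl | hξ
    · simp
    have h0 : ((‖ξ‖ : ℝ) : ℂ) ≠ 0 := by exact_mod_cast norm_ne_zero_iff.2 hξ
    have h1 : (Real.pi : ℂ) ≠ 0 := by exact_mod_cast Real.pi_ne_zero
    field_simp
  measurable := rieszSymbol_measurable l l' l''
  bound := ⟨_, norm_rieszSymbol_le l l' l''⟩
  wiener := by
    set p := tripleSymbol l l' l'' with hp
    set G := (wienerNorm (gaussian (n := n))).toReal with hG
    set H := (wienerNorm (SchwartzMap.smulLeftCLM ℂ p (gaussian (n := n)))).toReal with hH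
    refine ⟨fun φ => G * ‖(𝓕 (mulFourierInv p φ) : 𝓢(Space n, ℂ)).toLp 1‖ +
      2 * (H * ‖(𝓕 (FourierTransform.fourierInvCLM ℂ 𝓢(Space n, ℂ) φ) :
        𝓢(Space n, ℂ)).toLp 1‖), ?_, fun φ => by positivity, fun φ τ hτ => ?_⟩
    · simpa using ((tendsto_norm_fourier_toLp (mulFourierInv p)).const_mul G).add
        (((tendsto_norm_fourier_toLp (FourierTransform.fourierInvCLM ℂ 𝓢(Space n, ℂ))).const_mul
          H).const_mul 2)
    · have h := wienerNorm_heat_mul_rieszSymbol_le l l' l'' hτ (𝓕⁻ φ)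
      rw [ENNReal.ofReal_add (by positivity) (by positivity), ENNReal.ofReal_mul (by positivity),
        ENNReal.ofReal_mul (by positivity), ENNReal.ofReal_mul (by positivity), hG, hH,
        ENNReal.ofReal_toReal (wienerNorm_schwartz_lt_top _).ne,
        ENNReal.ofReal_toReal (wienerNorm_schwartz_lt_top _).ne, ← wienerNorm_eq_norm_toLp,
        ← wienerNorm_eq_norm_toLp]
      exact h

/-! ### The action of the multipliers on wavelets -/

/-- The integrable weight `(1 + |x|)^{-(n+1)}`. -/
def weight (x : Space n) : ℝ := ((1 + ‖x‖) ^ (n + 1))⁻¹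

theorem weight_pos (x : Space n) : 0 < weight x := by
  have := norm_nonneg x
  unfold weight
  positivity

/-- On the support of `B`, away from the origin, the heat multiplier and all its derivatives decay
faster than any power of `θ`. -/
theorem integral_norm_iteratedFDeriv_heat_mul_le {B : Space n → ℂ} (hB : ContDiff ℝ ∞ B)
    (hBc : HasCompactSupport B) (hB0 : ∀ ξ, ‖ξ‖ < 1 / 3 → B ξ = 0) (M q : ℕ) :
    ∃ A : ℝ, 0 ≤ A ∧ ∀ θ : ℝ, 0 ≤ θ →
      ∫ ξ, ‖iteratedFDeriv ℝ q (fun ξ => heat θ ξ * B ξ) ξ‖ ≤ A * ((1 + θ) ^ M)⁻¹ := by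
  obtain ⟨R, hR⟩ := hBc.isCompact.isBounded.exists_norm_le
  have hR0 : ∀ ξ ∈ tsupport B, 1 / 3 ≤ ‖ξ‖ := by
    have : tsupport B ⊆ {ξ | 1 / 3 ≤ ‖ξ‖} := by
      refine closure_minimal (fun ξ hξ => ?_) (isClosed_le continuous_const continuous_norm)
      by_contra h
      exact hξ (hB0 ξ (not_le.1 h))
    exact fun ξ hξ => this hξ
  set c : ℝ := 4 * Real.pi ^ 2 * (1 / 3) ^ 2 with hc
  have hc0 : 0 < c := by positivity
  set H : ℕ → ℝ := fun i => i.factorial * (8 * Real.pi ^ 2 * (1 + |R|)) ^ i *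
    ((M + i).factorial * Real.exp c / c ^ (M + i)) with hH
  have hH0 : ∀ i, 0 ≤ H i := fun i => by positivity
  have hheat : ∀ θ : ℝ, 0 ≤ θ → ∀ i, ∀ ξ ∈ tsupport B,
      ‖iteratedFDeriv ℝ i (heat θ) ξ‖ ≤ H i * ((1 + θ) ^ M)⁻¹ := by
    intro θ hθ i ξ hξ
    have h1 := norm_iteratedFDeriv_heat_le hθ i ξ
    have h2 := one_add_pow_mul_exp_neg_le (M + i) hc0 hθ
    have h3 : Real.exp (-θ * (4 * Real.pi ^ 2 * ‖ξ‖ ^ 2)) ≤ Real.exp (-(c * θ)) := by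
      rw [Real.exp_le_exp]
      have h4 : (1 / 3 : ℝ) ^ 2 ≤ ‖ξ‖ ^ 2 := pow_le_pow_left₀ (by norm_num) (hR0 ξ hξ) 2
      have h5 : c ≤ 4 * Real.pi ^ 2 * ‖ξ‖ ^ 2 := by
        rw [hc]
        gcongr
      nlinarith
    have h6 : ‖ξ‖ ≤ |R| := (hR ξ hξ).trans (le_abs_self R)
    have h7 : (0 : ℝ) < (1 + θ) ^ M := by positivity
    rw [← div_eq_mul_inv, le_div_iff₀ h7]
    calc ‖iteratedFDeriv ℝ i (heat θ) ξ‖ * (1 + θ) ^ M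
        ≤ (i.factorial * Real.exp (-(c * θ)) *
          (8 * Real.pi ^ 2 * (1 + θ) * (1 + |R|)) ^ i) * (1 + θ) ^ M := by
          refine mul_le_mul_of_nonneg_right (h1.trans ?_) h7.le
          gcongr
      _ = i.factorial * (8 * Real.pi ^ 2 * (1 + |R|)) ^ i *
          ((1 + θ) ^ (M + i) * Real.exp (-(c * θ))) := by
          rw [mul_right_comm (8 * Real.pi ^ 2), mul_pow _ (1 + θ), pow_add]
          ring
      _ ≤ _ := by
          exact mul_le_mul_of_nonneg_left h2 (by positivity)
  set S : 𝓢(Space n, ℂ) := hBc.toSchwartzMap hB with hS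
  have hSB : ⇑S = B := rfl
  have hint : ∀ i, Integrable fun ξ => ‖iteratedFDeriv ℝ i B ξ‖ := fun i => by
    have := S.integrable_pow_mul_iteratedFDeriv volume 0 i
    simpa [hSB] using this
  refine ⟨∑ i ∈ Finset.range (q + 1), (q.choose i : ℝ) * H i *
    ∫ ξ, ‖iteratedFDeriv ℝ (q - i) B ξ‖, ?_, fun θ hθ => ?_⟩
  · exact Finset.sum_nonneg fun i _ => mul_nonneg (mul_nonneg (by positivity) (hH0 i))
      (integral_nonneg fun ξ => norm_nonneg _)
  · have hpt : ∀ ξ, ‖iteratedFDeriv ℝ q (fun ξ => heat θ ξ * B ξ) ξ‖ ≤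
        ∑ i ∈ Finset.range (q + 1), (q.choose i : ℝ) * (H i * ((1 + θ) ^ M)⁻¹) *
          ‖iteratedFDeriv ℝ (q - i) B ξ‖ := by
      intro ξ
      refine (norm_iteratedFDeriv_mul_le (heat_contDiff θ) hB ξ
        (by exact_mod_cast le_top)).trans (Finset.sum_le_sum fun i _ => ?_)
      by_cases hξ : ξ ∈ tsupport B
      · gcongr
        exact hheat θ hθ i ξ hξ
      · have : iteratedFDeriv ℝ (q - i) B ξ = 0 := by
          by_contra h
          exact hξ (support_iteratedFDeriv_subset (q - i) h)
        simp [this]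
    refine (integral_mono_of_nonneg (Filter.Eventually.of_forall fun ξ => norm_nonneg _) ?_
      (Filter.Eventually.of_forall hpt)).trans (le_of_eq ?_)
    · exact integrable_finsetSum _ fun i _ => (hint _).const_mul _
    · rw [integral_finsetSum _ fun i _ => (hint _).const_mul _, Finset.sum_mul]
      refine Finset.sum_congr rfl fun i _ => ?_
      rw [integral_const_mul]
      ring

/-- Heat flow of a function with frequencies in an annulus: decay in time of any order, and
localisation in space, both coming from derivatives on the Fourier side. -/
theorem norm_fourier_heat_mul_le {B : Space n → ℂ} (hB : ContDiff ℝ ∞ B)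
    (hBc : HasCompactSupport B) (hB0 : ∀ ξ, ‖ξ‖ < 1 / 3 → B ξ = 0) (M : ℕ) :
    ∃ C : ℝ, 0 ≤ C ∧ ∀ θ : ℝ, 0 ≤ θ → ∀ x : Space n,
      ‖𝓕 (fun ξ => heat θ ξ * B ξ) x‖ ≤ C * ((1 + θ) ^ M)⁻¹ * weight x := by
  choose A hA0 hA using fun q => integral_norm_iteratedFDeriv_heat_mul_le hB hBc hB0 M q
  have hA0' : ∀ m, 0 ≤ ∑ q ∈ Finset.range (m + 1), A q :=
    fun m => Finset.sum_nonneg fun q _ => hA0 q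
  have key : ∀ θ : ℝ, 0 ≤ θ → ∀ x : Space n, ∀ m : ℕ,
      ‖x‖ ^ m * ‖𝓕 (fun ξ => heat θ ξ * B ξ) x‖ ≤
        2 ^ m * (∑ q ∈ Finset.range (m + 1), A q) * ((1 + θ) ^ M)⁻¹ := by
    intro θ hθ x m
    have hfs : ContDiff ℝ ∞ fun ξ => heat θ ξ * B ξ := (heat_contDiff θ).mul hB
    have hfc : HasCompactSupport fun ξ => heat θ ξ * B ξ := hBc.mul_left
    set f : 𝓢(Space n, ℂ) := hfc.toSchwartzMap hfs with hf
    have hff : ⇑f = fun ξ => heat θ ξ * B ξ := rfl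
    have h := Real.pow_mul_norm_iteratedFDeriv_fourier_le (K := ⊤) (N := ⊤) (f.smooth ⊤)
      (fun k m _ _ => f.integrable_pow_mul_iteratedFDeriv volume k m) (k := 0) (n := m)
      le_top le_top x
    simp only [norm_iteratedFDeriv_zero, hff] at h
    refine h.trans ?_
    rw [Finset.sum_product]
    simp only [pow_zero, one_mul, Finset.range_one, Finset.sum_singleton, zero_add,
      Nat.cast_zero, mul_zero]
    rw [mul_assoc, Finset.sum_mul]
    gcongr with q
    exact hA q θ hθ
  refine ⟨2 ^ n * (2 ^ 0 * (∑ q ∈ Finset.range (0 + 1), A q) +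
    2 ^ (n + 1) * (∑ q ∈ Finset.range (n + 1 + 1), A q)),
    mul_nonneg (by positivity) (add_nonneg (mul_nonneg (by positivity) (hA0' _))
      (mul_nonneg (by positivity) (hA0' _))), fun θ hθ x => ?_⟩
  have hx : 0 < (1 + ‖x‖) ^ (n + 1) := by
    have := norm_nonneg x
    positivity
  rw [weight, ← div_eq_mul_inv _ ((1 + ‖x‖) ^ (n + 1)), le_div_iff₀ hx]
  have h1 : (1 + ‖x‖) ^ (n + 1) ≤ 2 ^ n * (‖x‖ ^ 0 + ‖x‖ ^ (n + 1)) := by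
    simpa using add_pow_le zero_le_one (norm_nonneg x) (n + 1)
  calc ‖𝓕 (fun ξ => heat θ ξ * B ξ) x‖ * (1 + ‖x‖) ^ (n + 1)
      ≤ ‖𝓕 (fun ξ => heat θ ξ * B ξ) x‖ * (2 ^ n * (‖x‖ ^ 0 + ‖x‖ ^ (n + 1))) := by gcongr
    _ = 2 ^ n * (‖x‖ ^ 0 * ‖𝓕 (fun ξ => heat θ ξ * B ξ) x‖ +
        ‖x‖ ^ (n + 1) * ‖𝓕 (fun ξ => heat θ ξ * B ξ) x‖) := by ring
    _ ≤ 2 ^ n * (2 ^ 0 * (∑ q ∈ Finset.range (0 + 1), A q) * ((1 + θ) ^ M)⁻¹ +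
        2 ^ (n + 1) * (∑ q ∈ Finset.range (n + 1 + 1), A q) * ((1 + θ) ^ M)⁻¹) := by
        exact mul_le_mul_of_nonneg_left (add_le_add (key θ hθ x 0) (key θ hθ x (n + 1)))
          (by positivity)
    _ = _ := by ring

theorem waveletSymbol_eq_zero_of_lt (Φ : MeyerProfile) (ε : Fin n → Fin 2) {ξ : Space n}
    {i : Fin n} (h : 4 / 3 < |ξ i|) : waveletSymbol Φ ε ξ = 0 := by
  have hpi := Real.pi_pos
  refine Finset.prod_eq_zero (Finset.mem_univ i) (Φ.symbol_eq_zero _ ?_)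
  rw [abs_mul, abs_of_pos (by positivity)]
  nlinarith

theorem waveletSymbol_eq_zero_of_forall_lt (Φ : MeyerProfile) {ε : Fin n → Fin 2} (hε : ε ≠ 0)
    {ξ : Space n} (h : ∀ i, |ξ i| < 1 / 3) : waveletSymbol Φ ε ξ = 0 := by
  have hpi := Real.pi_pos
  obtain ⟨i, hi⟩ : ∃ i, ε i ≠ 0 := by
    by_contra hcon
    push Not at hcon
    exact hε (funext hcon)
  refine Finset.prod_eq_zero (Finset.mem_univ i) ?_
  have h1 : |2 * Real.pi * ξ i| ≤ 2 * Real.pi / 3 := by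
    rw [abs_mul, abs_of_pos (by positivity)]
    nlinarith [h i]
  have h2 : |2 * Real.pi * ξ i / 2| ≤ 2 * Real.pi / 3 := by
    rw [abs_div, abs_two]
    linarith [abs_nonneg (2 * Real.pi * ξ i)]
  rw [MeyerProfile.symbol, if_neg hi, MeyerProfile.bump, Φ.eq_one _ h1, Φ.eq_one _ h2]
  simp

theorem fourier_wavelet (Φ : MeyerProfile) (ε : Fin n → Fin 2) (ξ : Space n) :
    𝓕 (wavelet Φ ε : Space n → ℂ) ξ = waveletSymbol Φ ε ξ := by
  rw [← SchwartzMap.fourier_coe, wavelet, FourierTransform.fourier_fourierInv_eq]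
  rfl

theorem fourier_comp_sub (f : Space n → ℂ) (a ξ : Space n) :
    𝓕 (fun x => f (x - a)) ξ = ((Real.fourierChar (-inner ℝ a ξ) : Circle) : ℂ) * 𝓕 f ξ := by
  rw [Real.fourier_eq, Real.fourier_eq, ← integral_const_mul,
    ← integral_add_right_eq_self (fun x => Real.fourierChar (-inner ℝ x ξ) • f (x - a)) a]
  congr 1
  ext x
  simp only [add_sub_cancel_right, Circle.smul_def, smul_eq_mul, inner_add_left, neg_add,
    AddChar.map_add_eq_mul, Circle.coe_mul]
  ring

theorem fourier_char_mul (f : Space n → ℂ) (a x : Space n) :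
    𝓕 (fun ξ => ((Real.fourierChar (inner ℝ a ξ) : Circle) : ℂ) * f ξ) x = 𝓕 f (x - a) := by
  rw [Real.fourier_eq, Real.fourier_eq]
  congr 1
  ext ξ
  simp only [Circle.smul_def, smul_eq_mul]
  rw [← mul_assoc, ← Circle.coe_mul, ← AddChar.map_add_eq_mul, inner_sub_right,
    real_inner_comm a ξ]
  congr 3
  ring

/-- The amplitude `2^{nj/2}` of the wavelets of level `j`. -/
def amp (n : ℕ) (j : ℤ) : ℝ := (2 : ℝ) ^ ((n : ℝ) * j / 2)

theorem amp_pos (n : ℕ) (j : ℤ) : 0 < amp n j := by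
  unfold amp
  positivity

theorem amp_sq (n : ℕ) (j : ℤ) : amp n j * amp n j = ((2 : ℝ) ^ j) ^ n := by
  unfold amp
  rw [← Real.rpow_add two_pos, ← Real.rpow_intCast, ← Real.rpow_natCast, ← Real.rpow_mul two_pos.le]
  ring_nf

theorem fourierInv_waveletAt (Φ : MeyerProfile) (ε : Fin n → Fin 2) (j : ℤ) (k : Fin n → ℤ)
    (ξ : Space n) :
    (𝓕⁻ (waveletAt Φ ε j k) : 𝓢(Space n, ℂ)) ξ = (amp n j : ℂ) * ((((2 : ℝ) ^ j) ^ n)⁻¹ : ℝ) *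
      (((Real.fourierChar (inner ℝ (latticePoint k) (((2 : ℝ) ^ j)⁻¹ • ξ)) : Circle) : ℂ) *
        waveletSymbol Φ ε (-(((2 : ℝ) ^ j)⁻¹ • ξ))) := by
  have hj : (0 : ℝ) < 2 ^ j := by positivity
  rw [SchwartzMap.fourierInv_coe, Real.fourierInv_eq_fourier_neg]
  have h1 : ⇑(waveletAt Φ ε j k) = fun x =>
      (fun y => (amp n j : ℂ) * wavelet Φ ε (y - latticePoint k)) ((2 : ℝ) ^ j • x) :=
    funext fun x => waveletAt_apply Φ ε j k x
  rw [h1, fourier_comp_smul hj (fun y => (amp n j : ℂ) * wavelet Φ ε (y - latticePoint k)),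
    fourier_const_mul, fourier_comp_sub, fourier_wavelet, smul_neg, inner_neg_right, neg_neg,
    Complex.real_smul]
  ring

theorem transposeMultiplier_waveletAt {P : Space n → ℂ} (hP : IsFirstOrder P) (Φ : MeyerProfile)
    (ε : Fin n → Fin 2) (j : ℤ) (k : Fin n → ℤ) (τ : ℝ) (x : Space n) :
    transposeMultiplier (fun ξ => heat τ ξ * P ξ) (waveletAt Φ ε j k) x =
      (amp n j * 2 ^ j : ℝ) *
        𝓕 (fun ξ => heat (((2 : ℝ) ^ j) ^ 2 * τ) ξ * (P ξ * waveletSymbol Φ ε (-ξ)))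
          ((2 : ℝ) ^ j • x - latticePoint k) := by
  have hj : (0 : ℝ) < 2 ^ j := by positivity
  set t : ℝ := 2 ^ j with ht
  have h1 : (fun ξ : Space n => heat τ ξ * P ξ *
      (𝓕⁻ (waveletAt Φ ε j k) : 𝓢(Space n, ℂ)) ξ) = fun ξ => (fun η : Space n =>
        ((amp n j : ℂ) * (((t ^ n)⁻¹ : ℝ) : ℂ) * t) *
          (((Real.fourierChar (inner ℝ (latticePoint k) η) : Circle) : ℂ) *
          (heat (t ^ 2 * τ) η * (P η * waveletSymbol Φ ε (-η))))) (t⁻¹ • ξ) := by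
    ext ξ
    have hξ : ξ = t • (t⁻¹ • ξ) := by rw [smul_smul, mul_inv_cancel₀ hj.ne', one_smul]
    rw [fourierInv_waveletAt]
    simp only [← ht]
    set η := t⁻¹ • ξ with hη
    rw [hξ, heat_smul, hP.homogeneous t hj]
    ring
  rw [transposeMultiplier, h1, fourier_comp_smul (inv_pos.2 hj) (fun η : Space n =>
        ((amp n j : ℂ) * (((t ^ n)⁻¹ : ℝ) : ℂ) * t) *
          (((Real.fourierChar (inner ℝ (latticePoint k) η) : Circle) : ℂ) *
          (heat (t ^ 2 * τ) η * (P η * waveletSymbol Φ ε (-η))))), fourier_const_mul,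
    fourier_char_mul, inv_inv, Complex.real_smul]
  push_cast
  have : (t : ℂ) ^ n ≠ 0 := pow_ne_zero n (by exact_mod_cast hj.ne')
  simp only [inv_pow, inv_inv]
  field_simp

/-- The kernel bound for the multipliers acting on wavelets. -/
theorem norm_transposeMultiplier_waveletAt_le {P : Space n → ℂ} (hP : IsFirstOrder P)
    (Φ : MeyerProfile) (M : ℕ) :
    ∃ C : ℝ, 0 ≤ C ∧ ∀ (ε : Direction n) (j : ℤ) (k : Fin n → ℤ) (τ : ℝ), 0 ≤ τ → ∀ x : Space n,
      ‖transposeMultiplier (fun ξ => heat τ ξ * P ξ) (waveletAt Φ ε j k) x‖ ≤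
        C * amp n j * 2 ^ j * ((1 + ((2 : ℝ) ^ j) ^ 2 * τ) ^ M)⁻¹ *
          weight ((2 : ℝ) ^ j • x - latticePoint k) := by
  have hB : ∀ ε : Direction n, ContDiff ℝ ∞ fun ξ => P ξ * waveletSymbol Φ ε (-ξ) := by
    intro ε
    rw [contDiff_iff_contDiffAt]
    intro ξ
    have hW : ContDiff ℝ ∞ fun ξ => waveletSymbol Φ ε.1 (-ξ) :=
      (waveletSymbol_contDiff Φ ε.1).comp contDiff_neg
    rcases eq_or_ne ξ 0 with rfl | hξ
    · refine (contDiffAt_const (c := (0 : ℂ))).congr_of_eventuallyEq ?_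
      filter_upwards [Metric.ball_mem_nhds (0 : Space n) (show (0 : ℝ) < 1 / 3 by norm_num)]
        with η hη
      rw [mem_ball_zero_iff] at hη
      rw [waveletSymbol_eq_zero_of_forall_lt Φ ε.2, mul_zero]
      intro i
      simpa using (PiLp.norm_apply_le η i).trans_lt hη
    · exact (hP.smooth ξ hξ).mul hW.contDiffAt
  have hBc : ∀ ε : Direction n, HasCompactSupport fun ξ => P ξ * waveletSymbol Φ ε (-ξ) := by
    intro ε
    refine HasCompactSupport.mul_left ?_
    exact (waveletSymbol_hasCompactSupport Φ ε.1).comp_homeomorph (Homeomorph.neg (Space n))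
  have hB0 : ∀ ε : Direction n, ∀ ξ : Space n, ‖ξ‖ < 1 / 3 →
      P ξ * waveletSymbol Φ ε (-ξ) = 0 := by
    intro ε ξ hξ
    rw [waveletSymbol_eq_zero_of_forall_lt Φ ε.2, mul_zero]
    intro i
    simpa using (PiLp.norm_apply_le ξ i).trans_lt hξ
  choose C hC0 hC using fun ε => norm_fourier_heat_mul_le (hB ε) (hBc ε) (hB0 ε) M
  refine ⟨∑ ε, C ε, Finset.sum_nonneg fun ε _ => hC0 ε, fun ε j k τ hτ x => ?_⟩
  rw [transposeMultiplier_waveletAt hP, norm_mul, Complex.norm_real,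
    Real.norm_of_nonneg (mul_nonneg (amp_pos n j).le (by positivity))]
  have h1 := hC ε (((2 : ℝ) ^ j) ^ 2 * τ) (by positivity) ((2 : ℝ) ^ j • x - latticePoint k)
  have h2 : C ε ≤ ∑ ε, C ε := Finset.single_le_sum (fun ε _ => hC0 ε) (Finset.mem_univ ε)
  have h3 := weight_pos ((2 : ℝ) ^ j • x - latticePoint k)
  have h4 := amp_pos n j
  calc amp n j * 2 ^ j * _ ≤ amp n j * 2 ^ j * ((∑ ε, C ε) *
        ((1 + ((2 : ℝ) ^ j) ^ 2 * τ) ^ M)⁻¹ *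
          weight ((2 : ℝ) ^ j • x - latticePoint k)) := by
        refine mul_le_mul_of_nonneg_left (h1.trans ?_) (by positivity)
        gcongr
    _ = _ := by ring

theorem norm_waveletAt_le (Φ : MeyerProfile) :
    ∃ C : ℝ, 0 ≤ C ∧ ∀ (ε : Direction n) (j : ℤ) (k : Fin n → ℤ) (x : Space n),
      ‖waveletAt Φ ε j k x‖ ≤ C * amp n j * weight ((2 : ℝ) ^ j • x - latticePoint k) := by
  have h : ∀ ε : Direction n, ∃ C : ℝ, 0 ≤ C ∧ ∀ y : Space n,
      ‖wavelet Φ ε y‖ ≤ C * weight y := by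
    intro ε
    obtain ⟨C0, hC0⟩ := (wavelet Φ ε.1).decay 0 0
    obtain ⟨C1, hC1⟩ := (wavelet Φ ε.1).decay (n + 1) 0
    simp only [norm_iteratedFDeriv_zero] at hC0 hC1
    refine ⟨2 ^ n * (C0 + C1), mul_nonneg (by positivity) (add_nonneg hC0.1.le hC1.1.le),
      fun y => ?_⟩
    have hy : 0 < (1 + ‖y‖) ^ (n + 1) := by
      have := norm_nonneg y
      positivity
    rw [weight, ← div_eq_mul_inv, le_div_iff₀ hy]
    have h1 : (1 + ‖y‖) ^ (n + 1) ≤ 2 ^ n * (‖y‖ ^ 0 + ‖y‖ ^ (n + 1)) := by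
      simpa using add_pow_le zero_le_one (norm_nonneg y) (n + 1)
    calc ‖wavelet Φ ε y‖ * (1 + ‖y‖) ^ (n + 1)
        ≤ ‖wavelet Φ ε y‖ * (2 ^ n * (‖y‖ ^ 0 + ‖y‖ ^ (n + 1))) := by gcongr
      _ = 2 ^ n * (‖y‖ ^ 0 * ‖wavelet Φ ε y‖ + ‖y‖ ^ (n + 1) * ‖wavelet Φ ε y‖) := by ring
      _ ≤ _ := by
        gcongr
        · exact hC0.2 y
        · exact hC1.2 y
  choose C hC0 hC using h
  refine ⟨∑ ε, C ε, Finset.sum_nonneg fun ε _ => hC0 ε, fun ε j k x => ?_⟩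
  rw [waveletAt_apply, norm_mul, Complex.norm_real, Real.norm_of_nonneg (by positivity)]
  have h2 : C ε ≤ ∑ ε, C ε := Finset.single_le_sum (fun ε _ => hC0 ε) (Finset.mem_univ ε)
  have h3 := weight_pos ((2 : ℝ) ^ j • x - latticePoint k)
  have h4 := amp_pos n j
  calc (2 : ℝ) ^ ((n : ℝ) * j / 2) * ‖wavelet Φ ε ((2 : ℝ) ^ j • x - latticePoint k)‖
      ≤ amp n j * ((∑ ε, C ε) * weight ((2 : ℝ) ^ j • x - latticePoint k)) := by
        refine mul_le_mul_of_nonneg_left ((hC ε _).trans ?_) h4.le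
        gcongr
    _ = _ := by ring

/-! ### Frequency supports -/

theorem fourierInv_waveletAt_eq_zero_of_lt (Φ : MeyerProfile) (ε : Fin n → Fin 2) (j : ℤ)
    (k : Fin n → ℤ) {ξ : Space n} {i : Fin n} (h : 4 / 3 * 2 ^ j < |ξ i|) :
    (𝓕⁻ (waveletAt Φ ε j k) : 𝓢(Space n, ℂ)) ξ = 0 := by
  have hj : (0 : ℝ) < 2 ^ j := by positivity
  rw [fourierInv_waveletAt, waveletSymbol_eq_zero_of_lt Φ ε (i := i)]
  · simp
  · simp only [PiLp.neg_apply, PiLp.smul_apply, smul_eq_mul, abs_neg, abs_mul,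
      abs_of_pos (inv_pos.2 hj)]
    rw [← div_eq_inv_mul, lt_div_iff₀ hj]
    exact h

theorem fourierInv_waveletAt_eq_zero_of_forall_lt (Φ : MeyerProfile) {ε : Fin n → Fin 2}
    (hε : ε ≠ 0) (j : ℤ) (k : Fin n → ℤ) {ξ : Space n} (h : ∀ i, |ξ i| < 1 / 3 * 2 ^ j) :
    (𝓕⁻ (waveletAt Φ ε j k) : 𝓢(Space n, ℂ)) ξ = 0 := by
  have hj : (0 : ℝ) < 2 ^ j := by positivity
  rw [fourierInv_waveletAt, waveletSymbol_eq_zero_of_forall_lt Φ hε]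
  · simp
  · intro i
    simp only [PiLp.neg_apply, PiLp.smul_apply, smul_eq_mul, abs_neg, abs_mul,
      abs_of_pos (inv_pos.2 hj)]
    rw [← div_eq_inv_mul, div_lt_iff₀ hj]
    exact h i

/-- Two wavelets of level `j'` multiply to a function with frequencies `|ξ_i| ≤ (8/3) 2^{j'}`. -/
theorem fourier_waveletAt_mul_waveletAt_eq_zero (Φ : MeyerProfile) (ε ε' : Fin n → Fin 2) (j : ℤ)
    (k k' : Fin n → ℤ) {ξ : Space n} {i : Fin n} (h : 8 / 3 * 2 ^ j < |ξ i|) :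
    𝓕 (fun x => waveletAt Φ ε j k x * waveletAt Φ ε' j k' x) ξ = 0 := by
  have h1 := fourierInv_mul (waveletAt Φ ε j k) (waveletAt Φ ε' j k') (-ξ)
  rw [Real.fourierInv_eq_fourier_neg, neg_neg] at h1
  rw [h1]
  refine integral_eq_zero_of_ae (Filter.Eventually.of_forall fun t => ?_)
  change 𝓕⁻ (waveletAt Φ ε j k : Space n → ℂ) t *
    𝓕⁻ (waveletAt Φ ε' j k' : Space n → ℂ) (-ξ - t) = 0
  by_cases ht : 4 / 3 * 2 ^ j < |t i|
  · have := fourierInv_waveletAt_eq_zero_of_lt Φ ε j k ht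
    rw [SchwartzMap.fourierInv_coe] at this
    rw [this, zero_mul]
  · have h2 : 4 / 3 * 2 ^ j < |(-ξ - t) i| := by
      rw [PiLp.sub_apply, PiLp.neg_apply]
      have h3 : |ξ i| ≤ |-ξ i - t i| + |t i| := by
        have := abs_add_le (-ξ i - t i) (t i)
        rwa [sub_add_cancel, abs_neg] at this
      push Not at ht
      linarith
    have := fourierInv_waveletAt_eq_zero_of_lt Φ ε' j k' h2
    rw [SchwartzMap.fourierInv_coe] at this
    rw [this, mul_zero]

theorem integral_waveletAt_mul_fourier_eq_zero (Φ : MeyerProfile) (ε ε' : Fin n → Fin 2) (j : ℤ)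
    (k k' : Fin n → ℤ) {h : Space n → ℂ} (hi : Integrable h)
    (hs : ∀ ξ, (∀ i, |ξ i| ≤ 8 / 3 * 2 ^ j) → h ξ = 0) :
    ∫ x, waveletAt Φ ε j k x * waveletAt Φ ε' j k' x * 𝓕 h x = 0 := by
  set g : 𝓢(Space n, ℂ) := SchwartzMap.pairing (ContinuousLinearMap.mul ℂ ℂ)
    (waveletAt Φ ε j k) (waveletAt Φ ε' j k') with hg
  have hgc : ⇑g = fun x => waveletAt Φ ε j k x * waveletAt Φ ε' j k' x := rfl
  have h1 := VectorFourier.integral_fourierIntegral_smul_eq_flip (L := innerₗ (Space n))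
    (μ := volume) (ν := volume) (f := h) (g := g) Real.continuous_fourierChar
    continuous_inner hi g.integrable
  simp only [flip_innerₗ] at h1
  change ∫ x, 𝓕 h x • g x = ∫ ξ, h ξ • 𝓕 (g : Space n → ℂ) ξ at h1
  have h2 : ∀ ξ, h ξ • 𝓕 (g : Space n → ℂ) ξ = 0 := by
    intro ξ
    by_cases hξ : ∀ i, |ξ i| ≤ 8 / 3 * 2 ^ j
    · rw [hs ξ hξ, zero_smul]
    · push Not at hξ
      obtain ⟨i, hi⟩ := hξ
      rw [hgc, fourier_waveletAt_mul_waveletAt_eq_zero Φ ε ε' j k k' hi, smul_zero]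
  simp only [h2, integral_zero] at h1
  rw [← h1]
  congr 1
  ext x
  rw [hgc, smul_eq_mul, mul_comm]

/-! ### Lattice sums -/

theorem measurable_weight : Measurable (weight (n := n)) := by
  unfold weight
  fun_prop

theorem lintegral_weight_lt_top : ∫⁻ x : Space n, ENNReal.ofReal (weight x) < ⊤ := by
  have h := integrable_one_add_norm (E := Space n) (μ := volume) (r := n + 1) (by simp)
  have h2 : ∀ x : Space n, (1 + ‖x‖) ^ (-((n : ℝ) + 1)) = weight x := fun x => by
    have : 0 ≤ 1 + ‖x‖ := by positivity
    rw [weight, Real.rpow_neg this]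
    exact_mod_cast rfl
  simp only [h2] at h
  exact h.lintegral_lt_top

theorem weight_le (x y : Space n) : weight x ≤ (1 + ‖x - y‖) ^ (n + 1) * weight y := by
  have hx : 0 < (1 + ‖x‖) ^ (n + 1) := by positivity
  have hy : 0 < (1 + ‖y‖) ^ (n + 1) := by positivity
  rw [weight, weight, ← div_eq_mul_inv, le_div_iff₀ hy, inv_mul_le_iff₀ hx, ← mul_pow]
  refine pow_le_pow_left₀ (by positivity) ?_ _
  have h := norm_sub_norm_le y x
  rw [norm_sub_rev] at h
  nlinarith [norm_nonneg x, norm_nonneg (x - y)]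

/-- The lattice point `⌊y⌋` indexing the half-open unit cube which contains `y`. -/
def floorPoint (y : Space n) : Fin n → ℤ := fun i => ⌊y i⌋

theorem measurable_floorPoint : Measurable (floorPoint (n := n)) := by
  refine measurable_pi_iff.2 fun i => ?_
  exact Int.measurable_floor.comp (by fun_prop)

theorem volume_floorPoint (k : Fin n → ℤ) :
    volume ((floorPoint (n := n)) ⁻¹' {k}) = 1 := by
  have h : (floorPoint (n := n)) ⁻¹' {k} = (MeasurableEquiv.toLp 2 (Fin n → ℝ)).symm ⁻¹'
      (Set.univ.pi fun i => Set.Ico (k i : ℝ) (k i + 1)) := by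
    ext y
    simp [floorPoint, funext_iff, Int.floor_eq_iff]
  rw [h, (EuclideanSpace.volume_preserving_symm_measurableEquiv_toLp (Fin n)).measure_preimage
    (MeasurableSet.univ_pi fun i => measurableSet_Ico).nullMeasurableSet, Real.volume_pi_Ico]
  simp

theorem lintegral_comp_floorPoint (g : (Fin n → ℤ) → ℝ≥0∞) :
    ∫⁻ y, g (floorPoint y) = ∑' k, g k := by
  have hg : Measurable g := measurable_of_countable g
  rw [← lintegral_map hg measurable_floorPoint, lintegral_countable']
  refine tsum_congr fun k => ?_
  rw [Measure.map_apply measurable_floorPoint (measurableSet_singleton k), volume_floorPoint,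
    mul_one]

theorem norm_le_of_abs_le_one {v : Space n} (h : ∀ i, |v i| ≤ 1) : ‖v‖ ≤ n := by
  refine (abs_le_of_sq_le_sq' ?_ (Nat.cast_nonneg n)).2
  rw [EuclideanSpace.norm_sq_eq]
  calc ∑ i, ‖v i‖ ^ 2 ≤ ∑ _i : Fin n, (1 : ℝ) := Finset.sum_le_sum fun i _ => by
        have := h i
        rw [Real.norm_eq_abs]
        nlinarith [abs_nonneg (v i)]
    _ = n := by simp
    _ ≤ (n : ℝ) ^ 2 := by exact_mod_cast Nat.le_self_pow two_ne_zero n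

theorem norm_sub_floorPoint_le (y : Space n) : ‖y - latticePoint (floorPoint y)‖ ≤ n := by
  refine norm_le_of_abs_le_one fun i => ?_
  have h : (y - latticePoint (floorPoint y)) i = Int.fract (y i) := by
    simp [latticePoint, floorPoint]
  rw [h, abs_of_nonneg (Int.fract_nonneg _)]
  exact (Int.fract_lt_one _).le

/-- The loss in replacing the argument of `weight` by a point of the same unit cube. -/
def cubeConst (n : ℕ) : ℝ := (1 + (n : ℝ)) ^ (n + 1)

theorem cubeConst_pos (n : ℕ) : 0 < cubeConst n := by
  unfold cubeConst
  positivity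

theorem weight_le_of_norm_sub_le {x y : Space n} (h : ‖x - y‖ ≤ n) :
    weight x ≤ cubeConst n * weight y := by
  refine (weight_le x y).trans (mul_le_mul_of_nonneg_right ?_ (weight_pos y).le)
  unfold cubeConst
  gcongr

/-- A bound for the lattice sums of `weight`. -/
def latticeConst (n : ℕ) : ℝ :=
  cubeConst n * (∫⁻ x : Space n, ENNReal.ofReal (weight x)).toReal

theorem tsum_weight_le (w : Space n) :
    ∑' k, ENNReal.ofReal (weight (w - latticePoint k)) ≤ ENNReal.ofReal (latticeConst n) := by
  rw [← lintegral_comp_floorPoint fun k => ENNReal.ofReal (weight (w - latticePoint k))]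
  calc ∫⁻ y, ENNReal.ofReal (weight (w - latticePoint (floorPoint y)))
      ≤ ∫⁻ y, ENNReal.ofReal (cubeConst n) * ENNReal.ofReal (weight (w - y)) := by
        refine lintegral_mono fun y => ?_
        rw [← ENNReal.ofReal_mul (cubeConst_pos n).le]
        refine ENNReal.ofReal_le_ofReal (weight_le_of_norm_sub_le ?_)
        rw [sub_sub_sub_cancel_left]
        exact norm_sub_floorPoint_le y
    _ = ENNReal.ofReal (cubeConst n) * ∫⁻ y, ENNReal.ofReal (weight (w - y)) :=
        lintegral_const_mul' _ _ ENNReal.ofReal_ne_top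
    _ = _ := by
        rw [lintegral_sub_left_eq_self (fun y => ENNReal.ofReal (weight y)) w, latticeConst,
          ENNReal.ofReal_mul (cubeConst_pos n).le,
          ENNReal.ofReal_toReal lintegral_weight_lt_top.ne]

/-- The step function with value `b k` on the dyadic cube `2^{-j} (k + [0,1)ⁿ)`. -/
def stepFun (j : ℤ) (b : (Fin n → ℤ) → ℝ≥0∞) (x : Space n) : ℝ≥0∞ :=
  b (floorPoint ((2 : ℝ) ^ j • x))

theorem measurable_stepFun (j : ℤ) (b : (Fin n → ℤ) → ℝ≥0∞) : Measurable (stepFun j b) :=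
  (measurable_of_countable b).comp (measurable_floorPoint.comp (measurable_const_smul _))

theorem floorPoint_sub_latticePoint (y : Space n) (z : Fin n → ℤ) :
    floorPoint (y - latticePoint z) = floorPoint y - z := by
  ext i
  simp [floorPoint, latticePoint]

/-- A weighted sum over the cubes is an average of translates of a step function. -/
theorem tsum_mul_weight_le (j : ℤ) (b : (Fin n → ℤ) → ℝ≥0∞) (x : Space n) :
    ∑' k, b k * ENNReal.ofReal (weight ((2 : ℝ) ^ j • x - latticePoint k)) ≤
      ∑' z, ENNReal.ofReal (cubeConst n * weight (0 - latticePoint z)) *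
        stepFun j b (x - ((2 : ℝ) ^ j)⁻¹ • latticePoint z) := by
  have hj : (0 : ℝ) < 2 ^ j := by positivity
  rw [← (Equiv.subLeft (floorPoint ((2 : ℝ) ^ j • x))).tsum_eq
    fun k => b k * ENNReal.ofReal (weight ((2 : ℝ) ^ j • x - latticePoint k))]
  refine ENNReal.tsum_le_tsum fun z => ?_
  have h1 : stepFun j b (x - ((2 : ℝ) ^ j)⁻¹ • latticePoint z) =
      b (floorPoint ((2 : ℝ) ^ j • x) - z) := by
    rw [stepFun, smul_sub, smul_smul, mul_inv_cancel₀ hj.ne', one_smul,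
      floorPoint_sub_latticePoint]
  rw [h1, mul_comm, Equiv.subLeft_apply]
  refine mul_le_mul_left (ENNReal.ofReal_le_ofReal ?_) _
  have h2 : weight (0 - latticePoint z) = weight (latticePoint z) := by
    rw [weight, weight, zero_sub, norm_neg]
  rw [h2]
  refine weight_le_of_norm_sub_le ?_
  have h3 : (2 : ℝ) ^ j • x - latticePoint (floorPoint ((2 : ℝ) ^ j • x) - z) - latticePoint z =
      (2 : ℝ) ^ j • x - latticePoint (floorPoint ((2 : ℝ) ^ j • x)) := by
    ext i
    simp only [latticePoint, PiLp.sub_apply, Pi.sub_apply, Int.cast_sub]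
    ring
  rw [h3]
  exact norm_sub_floorPoint_le _

theorem avgNorm_tsum_mul_weight_le {p : ℝ} (j : ℤ) (b : (Fin n → ℤ) → ℝ≥0∞) :
    avgNorm p (fun x : Space n => ∑' k, b k *
      ENNReal.ofReal (weight ((2 : ℝ) ^ j • x - latticePoint k))) ≤
        ENNReal.ofReal (cubeConst n * latticeConst n) * avgNorm p (stepFun j b) := by
  have hm : ∀ z : Fin n → ℤ, Measurable fun x : Space n =>
      stepFun j b (x - ((2 : ℝ) ^ j)⁻¹ • latticePoint z) := fun z =>
    (measurable_stepFun j b).comp (measurable_id.sub_const _)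
  calc _ ≤ avgNorm p (fun x : Space n => ∑' z, ENNReal.ofReal (cubeConst n *
          weight (0 - latticePoint z)) * stepFun j b (x - ((2 : ℝ) ^ j)⁻¹ • latticePoint z)) :=
        avgNorm_mono fun x => tsum_mul_weight_le j b x
    _ ≤ ∑' z, ENNReal.ofReal (cubeConst n * weight (0 - latticePoint z)) *
          avgNorm p (stepFun j b) := by
        refine (avgNorm_tsum_le fun z => (hm z).const_mul _).trans
          (ENNReal.tsum_le_tsum fun z => ?_)
        exact (avgNorm_const_mul_le _ (hm z)).trans
          (mul_le_mul_right (avgNorm_comp_sub_le _ _) _)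
    _ ≤ _ := by
        rw [ENNReal.tsum_mul_right]
        simp only [ENNReal.ofReal_mul (cubeConst_pos n).le]
        rw [ENNReal.tsum_mul_left]
        gcongr
        exact tsum_weight_le 0

theorem volume_stepFun_cube (j : ℤ) (k : Fin n → ℤ) :
    volume {x : Space n | floorPoint ((2 : ℝ) ^ j • x) = k} =
      ENNReal.ofReal ((((2 : ℝ) ^ j) ^ n)⁻¹) := by
  have hj : (0 : ℝ) < 2 ^ j := by positivity
  have h := Measure.addHaar_preimage_smul (volume : Measure (Space n)) hj.ne'
    (floorPoint ⁻¹' {k})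
  rw [volume_floorPoint, mul_one, abs_of_pos (by positivity), finrank_euclideanSpace_fin] at h
  exact h

/-- A step function of level `j` in weak `L^p` is bounded, since its level sets contain cubes of
volume `2^{-jn}`. -/
theorem le_of_weakNorm_stepFun_le {p : ℝ} (hp : 0 < p) (j : ℤ) (b : (Fin n → ℤ) → ℝ≥0∞) {w : ℝ}
    (hw : 0 ≤ w) (h : weakNorm p (stepFun j b) ≤ ENNReal.ofReal w) (k : Fin n → ℤ) :
    b k ≤ ENNReal.ofReal ((2 : ℝ) ^ ((j : ℝ) * (n / p)) * w) := by
  have hj : (0 : ℝ) < 2 ^ j := by positivity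
  by_contra hcon
  push Not at hcon
  obtain ⟨r, hr1, hr2⟩ := ENNReal.lt_iff_exists_nnreal_btwn.1 hcon
  have hr0 : 0 < (r : ℝ) := by
    have : (0 : ℝ≥0∞) < r := lt_of_le_of_lt zero_le hr1
    exact_mod_cast this
  have h1 := (mul_measure_rpow_le_weakNorm p (stepFun j b) hr0).trans h
  have h2 : ENNReal.ofReal ((((2 : ℝ) ^ j) ^ n)⁻¹) ≤
      volume {x | ENNReal.ofReal r < stepFun j b x} := by
    rw [← volume_stepFun_cube j k]
    refine measure_mono fun x hx => ?_
    simp only [Set.mem_ofPred_eq] at hx ⊢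
    rw [stepFun, hx, ENNReal.ofReal_coe_nnreal]
    exact hr2
  have h3 : ENNReal.ofReal (r * ((((2 : ℝ) ^ j) ^ n)⁻¹) ^ (1 / p)) ≤ ENNReal.ofReal w := by
    refine le_trans ?_ h1
    rw [ENNReal.ofReal_mul hr0.le, ← ENNReal.ofReal_rpow_of_pos (by positivity)]
    gcongr
  rw [ENNReal.ofReal_le_ofReal_iff hw] at h3
  have h4 : ((((2 : ℝ) ^ j) ^ n)⁻¹) ^ (1 / p) = ((2 : ℝ) ^ ((j : ℝ) * (n / p)))⁻¹ := by
    rw [← Real.rpow_intCast, ← Real.rpow_natCast, ← Real.rpow_mul two_pos.le,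
      ← Real.rpow_neg two_pos.le, ← Real.rpow_mul two_pos.le, ← Real.rpow_neg two_pos.le]
    congr 1
    ring
  rw [h4, ← div_eq_mul_inv, div_le_iff₀ (by positivity), mul_comm] at h3
  rw [← ENNReal.ofReal_coe_nnreal] at hr1
  exact absurd (ENNReal.ofReal_le_ofReal h3) (not_le.2 hr1)

/-! ### Multipliers acting on test functions -/

/-- The transposed multipliers map test functions to `L¹ ∩ L^∞`, uniformly in `τ > 0` and with a bound
which is continuous at `0` in the test function. -/
theorem transposeMultiplier_norm_le {P : Space n → ℂ} (hP : IsFirstOrder P) :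
    ∃ κ : 𝓢(Space n, ℂ) → ℝ, Filter.Tendsto κ (nhds 0) (nhds 0) ∧ (∀ φ, 0 ≤ κ φ) ∧
      ∀ φ : 𝓢(Space n, ℂ), ∀ τ : ℝ, 0 < τ →
        ∫⁻ x, ‖transposeMultiplier (fun ξ => heat τ ξ * P ξ) φ x‖ₑ ≤ ENNReal.ofReal (κ φ) ∧
        ∀ x, ‖transposeMultiplier (fun ξ => heat τ ξ * P ξ) φ x‖ₑ ≤ ENNReal.ofReal (κ φ) := by
  obtain ⟨κ, hκ, hκ0, hκb⟩ := hP.wiener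
  obtain ⟨C, hC⟩ := hP.bound
  set g : Space n → ℂ := fun ξ => ((1 + ‖ξ‖ ^ 2 : ℝ) : ℂ) with hg
  have hgt : g.HasTemperateGrowth := by
    refine Function.HasTemperateGrowth.comp Complex.ofRealCLM.hasTemperateGrowth ?_
    exact (Function.HasTemperateGrowth.const 1).add (Function.hasTemperateGrowth_norm_sq (Space n))
  refine ⟨fun φ => κ φ + |C| * ‖(mulFourierInv g φ).toLp 1‖, ?_, fun φ =>
    add_nonneg (hκ0 φ) (by positivity), fun φ τ hτ => ⟨?_, fun x => ?_⟩⟩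
  · simpa using hκ.add ((tendsto_norm_toLp (mulFourierInv g)).const_mul |C|)
  · exact (hκb φ τ hτ).trans (ENNReal.ofReal_le_ofReal (le_add_of_nonneg_right (by positivity)))
  · refine (enorm_fourier_le _ x).trans (le_trans ?_
      (ENNReal.ofReal_le_ofReal (le_add_of_nonneg_left (hκ0 φ))))
    rw [ENNReal.ofReal_mul (abs_nonneg C), SchwartzMap.norm_toLp_one,
      ofReal_integral_norm_eq_lintegral_enorm (SchwartzMap.integrable _),
      ← lintegral_const_mul' _ _ ENNReal.ofReal_ne_top]
    refine lintegral_mono fun ξ => ?_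
    rw [mulFourierInv_apply hgt, enorm_mul, enorm_mul, enorm_mul (g ξ), ← mul_assoc]
    refine mul_le_mul_left ?_ _
    rw [← enorm_mul, ← ofReal_norm, ← ofReal_norm, ← ENNReal.ofReal_mul (abs_nonneg C)]
    refine ENNReal.ofReal_le_ofReal ?_
    rw [norm_mul, hg, Complex.norm_real, Real.norm_of_nonneg (by positivity)]
    calc ‖heat τ ξ‖ * ‖P ξ‖ ≤ 1 * (|C| * (1 + ‖ξ‖ ^ 2)) := by
          refine mul_le_mul (norm_heat_le_one hτ.le ξ) ((hC ξ).trans ?_) (norm_nonneg _) zero_le_one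
          refine mul_le_mul (le_abs_self C) ?_ (norm_nonneg _) (abs_nonneg C)
          nlinarith [sq_nonneg (‖ξ‖ - 1)]
      _ = _ := one_mul _

theorem integrable_heat_mul {P : Space n → ℂ} (hP : IsFirstOrder P) {τ : ℝ} (hτ : 0 ≤ τ)
    (ψ : 𝓢(Space n, ℂ)) : Integrable fun ξ => heat τ ξ * P ξ * ψ ξ := by
  obtain ⟨C, hC⟩ := hP.bound
  refine Integrable.mono' ((integrable_norm_mul_schwartz ψ).const_mul C) ?_
    (Filter.Eventually.of_forall fun ξ => ?_)
  · exact (((heat_contDiff τ).continuous.measurable.mul hP.measurable).mul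
      ψ.continuous.measurable).aestronglyMeasurable
  · rw [norm_mul, norm_mul, ← mul_assoc]
    refine mul_le_mul_of_nonneg_right ?_ (norm_nonneg _)
    calc ‖heat τ ξ‖ * ‖P ξ‖ ≤ 1 * ‖P ξ‖ := by gcongr; exact norm_heat_le_one hτ ξ
      _ ≤ _ := by rw [one_mul]; exact hC ξ

theorem fourierInv_schwartz_add (φ χ : 𝓢(Space n, ℂ)) (ξ : Space n) :
    (𝓕⁻ (φ + χ) : 𝓢(Space n, ℂ)) ξ = (𝓕⁻ φ : 𝓢(Space n, ℂ)) ξ + (𝓕⁻ χ : 𝓢(Space n, ℂ)) ξ := by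
  rw [FourierTransform.fourierInv_add]
  rfl

theorem fourierInv_schwartz_smul (c : ℂ) (φ : 𝓢(Space n, ℂ)) (ξ : Space n) :
    (𝓕⁻ (c • φ) : 𝓢(Space n, ℂ)) ξ = c * (𝓕⁻ φ : 𝓢(Space n, ℂ)) ξ := by
  rw [FourierTransform.fourierInv_smul]
  rfl

theorem transposeMultiplier_add {P : Space n → ℂ} (hP : IsFirstOrder P) {τ : ℝ} (hτ : 0 ≤ τ)
    (φ χ : 𝓢(Space n, ℂ)) (x : Space n) :
    transposeMultiplier (fun ξ => heat τ ξ * P ξ) (φ + χ) x =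
      transposeMultiplier (fun ξ => heat τ ξ * P ξ) φ x +
        transposeMultiplier (fun ξ => heat τ ξ * P ξ) χ x := by
  unfold transposeMultiplier
  have h1 := (Real.fourierIntegral_convergent_iff x).2 (integrable_heat_mul hP hτ (𝓕⁻ φ))
  have h2 := (Real.fourierIntegral_convergent_iff x).2 (integrable_heat_mul hP hτ (𝓕⁻ χ))
  rw [Real.fourier_eq, Real.fourier_eq, Real.fourier_eq, ← integral_add h1 h2]
  congr 1
  ext ξ
  rw [fourierInv_schwartz_add, mul_add, smul_add]

theorem transposeMultiplier_smul (σ : Space n → ℂ) (c : ℂ) (φ : 𝓢(Space n, ℂ)) (x : Space n) :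
    transposeMultiplier σ (c • φ) x = c * transposeMultiplier σ φ x := by
  have h : (fun ξ => σ ξ * (𝓕⁻ (c • φ) : 𝓢(Space n, ℂ)) ξ) =
      fun ξ => c * (σ ξ * (𝓕⁻ φ : 𝓢(Space n, ℂ)) ξ) := funext fun ξ => by
    rw [fourierInv_schwartz_smul]
    ring
  rw [transposeMultiplier, h, fourier_const_mul]
  rfl

/-- Multipliers turn wavelets of level `j` into functions which do not interact with the product of
two wavelets of a level `j' < j - 3`. -/
theorem integral_waveletAt_mul_transposeMultiplier_eq_zero {P : Space n → ℂ}
    (hP : IsFirstOrder P) (Φ : MeyerProfile) {τ : ℝ} (hτ : 0 ≤ τ) (ε : Direction n) {j j' : ℤ}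
    (hj : j' < j - 3) (k : Fin n → ℤ) (ε₁ ε₂ : Fin n → Fin 2) (k₁ k₂ : Fin n → ℤ) :
    ∫ x, waveletAt Φ ε₁ j' k₁ x * waveletAt Φ ε₂ j' k₂ x *
      transposeMultiplier (fun ξ => heat τ ξ * P ξ) (waveletAt Φ ε j k) x = 0 := by
  have h0 := integral_waveletAt_mul_fourier_eq_zero Φ ε₁ ε₂ j' k₁ k₂
    (integrable_heat_mul hP hτ (𝓕⁻ (waveletAt Φ ε j k)))
  refine h0 fun ξ hξ => ?_
  rw [fourierInv_waveletAt_eq_zero_of_forall_lt Φ ε.2 j k, mul_zero]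
  intro i
  refine (hξ i).trans_lt ?_
  have h1 : (2 : ℝ) ^ j' * 16 ≤ 2 ^ j := by
    have : (2 : ℝ) ^ j' * 2 ^ (4 : ℤ) ≤ 2 ^ j := by
      rw [← zpow_add₀ two_ne_zero]
      exact zpow_le_zpow_right₀ one_le_two (by omega)
    norm_num at this ⊢
    exact this
  have h2 : (0 : ℝ) < 2 ^ j' := by positivity
  linarith

/-! ### Majorants of the wavelet projections on dyadic time rings -/

/-- The dyadic time ring `2^{-2 j_t} ≤ t < 2^{2 - 2 j_t}`. -/
abbrev timeRing (jt : ℤ) : Set ℝ := Set.Ico ((2 : ℝ) ^ (-2 * jt)) ((2 : ℝ) ^ (2 - 2 * jt))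

/-- The largest modulus of a wavelet coefficient over a time ring. -/
def supCoeff (Φ : MeyerProfile) (u : ℝ → 𝓢'(Space n, ℂ)) (j jt : ℤ) (ε : Direction n)
    (k : Fin n → ℤ) : ℝ≥0∞ :=
  ⨆ t ∈ timeRing jt, ‖coeff Φ (u t) ε j k‖ₑ

/-- A function dominating `|Q_j u(t)|` for all `t` in a time ring. -/
def majorant (Φ : MeyerProfile) (u : ℝ → 𝓢'(Space n, ℂ)) (j jt : ℤ) (x : Space n) : ℝ≥0∞ :=
  ∑ ε : Direction n, ∑' k : Fin n → ℤ, supCoeff Φ u j jt ε k * ‖waveletAt Φ ε j k x‖ₑ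

theorem measurable_majorant (Φ : MeyerProfile) (u : ℝ → 𝓢'(Space n, ℂ)) (j jt : ℤ) :
    Measurable (majorant Φ u j jt) := by
  have h (ε : Direction n) (k : Fin n → ℤ) :
      Measurable fun x => supCoeff Φ u j jt ε k * ‖waveletAt Φ ε j k x‖ₑ := by
    have h0 : Measurable fun x => ‖waveletAt Φ (ε : Fin n → Fin 2) j k x‖ₑ :=
      (SchwartzMap.continuous _).enorm.measurable
    exact h0.const_mul _
  exact Finset.measurable_fun_sum _ fun ε _ => Measurable.tsum fun k => h ε k

theorem stepFun_supCoeff_le_ringFun (Φ : MeyerProfile) (u : ℝ → 𝓢'(Space n, ℂ)) (j jt : ℤ)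
    (ε : Direction n) (x : Space n) :
    stepFun j (fun k => ENNReal.ofReal (amp n j) * supCoeff Φ u j jt ε k) x ≤
      ringFun Φ u j jt x := by
  simp only [stepFun, supCoeff, ENNReal.mul_iSup]
  refine iSup₂_mono fun t _ => ?_
  unfold levelFun
  refine mul_le_mul_right ?_ _
  set k := floorPoint ((2 : ℝ) ^ j • x) with hk
  have h1 : cubeIndicator ((2 : ℝ) ^ j • x - latticePoint k) = 1 := by
    refine Set.indicator_of_mem (show ∀ i, _ from fun i => ?_) _
    have h : ((2 : ℝ) ^ j • x - latticePoint k) i = Int.fract (((2 : ℝ) ^ j • x) i) := by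
      simp [latticePoint, hk, floorPoint]
    rw [h]
    exact ⟨Int.fract_nonneg _, (Int.fract_lt_one _).le⟩
  calc ‖coeff Φ (u t) ε j k‖ₑ = ‖coeff Φ (u t) ε j k‖ₑ *
        cubeIndicator ((2 : ℝ) ^ j • x - latticePoint k) := by rw [h1, mul_one]
    _ ≤ ∑' k : Fin n → ℤ, ‖coeff Φ (u t) ε j k‖ₑ *
        cubeIndicator ((2 : ℝ) ^ j • x - latticePoint k) := ENNReal.le_tsum (f := fun k =>
          ‖coeff Φ (u t) ε j k‖ₑ * cubeIndicator ((2 : ℝ) ^ j • x - latticePoint k)) k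
    _ ≤ _ := Finset.single_le_sum (f := fun ε : Direction n => ∑' k : Fin n → ℤ,
        ‖coeff Φ (u t) ε j k‖ₑ * cubeIndicator ((2 : ℝ) ^ j • x - latticePoint k))
        (fun _ _ => zero_le) (Finset.mem_univ ε)

/-- The majorants satisfy the weak-`L^p` bound of `ringFun`, and also the uniform bound which a
step function of level `j` inherits from it. -/
theorem majorant_bound (Φ : MeyerProfile) {p : ℝ} (hp : 1 < p) :
    ∃ C : ℝ, 0 < C ∧ ∀ (u : ℝ → 𝓢'(Space n, ℂ)) (j jt : ℤ) (w : ℝ), 0 < w →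
      weakNorm p (ringFun Φ u j jt) ≤ ENNReal.ofReal w →
        avgNorm p (majorant Φ u j jt) ≤ ENNReal.ofReal (C * w) ∧
        ∀ x, majorant Φ u j jt x ≤ ENNReal.ofReal (C * ((2 : ℝ) ^ ((j : ℝ) * (n / p)) * w)) := by
  have hp0 : 0 < p := by linarith
  obtain ⟨C, hC0, hC⟩ := norm_waveletAt_le (n := n) Φ
  set N : ℝ := ((Fintype.card (Direction n) : ℕ) : ℝ) with hN
  have hlc : 0 ≤ latticeConst n := mul_nonneg (cubeConst_pos n).le ENNReal.toReal_nonneg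
  have hcc := cubeConst_pos n
  have hwc := weakConst_pos p
  have hN0 : 0 ≤ N := Nat.cast_nonneg _
  -- both estimates start from the pointwise bound by lattice sums
  have hpt : ∀ (u : ℝ → 𝓢'(Space n, ℂ)) (j jt : ℤ) (x : Space n), majorant Φ u j jt x ≤
      ∑ ε : Direction n, ENNReal.ofReal C * ∑' k, (ENNReal.ofReal (amp n j) *
        supCoeff Φ u j jt ε k) * ENNReal.ofReal (weight ((2 : ℝ) ^ j • x - latticePoint k)) := by
    intro u j jt x
    refine Finset.sum_le_sum fun ε _ => ?_
    rw [← ENNReal.tsum_mul_left]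
    refine ENNReal.tsum_le_tsum fun k => ?_
    have h1 : ‖waveletAt Φ ε j k x‖ₑ ≤ ENNReal.ofReal C * ENNReal.ofReal (amp n j) *
        ENNReal.ofReal (weight ((2 : ℝ) ^ j • x - latticePoint k)) := by
      rw [← ENNReal.ofReal_mul hC0, ← ENNReal.ofReal_mul (mul_nonneg hC0 (amp_pos n j).le),
        ← ofReal_norm]
      exact ENNReal.ofReal_le_ofReal (hC ε j k x)
    calc supCoeff Φ u j jt ε k * ‖waveletAt Φ ε j k x‖ₑ
        ≤ supCoeff Φ u j jt ε k * (ENNReal.ofReal C * ENNReal.ofReal (amp n j) *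
          ENNReal.ofReal (weight ((2 : ℝ) ^ j • x - latticePoint k))) := by gcongr
      _ = _ := by ring
  set C₁ : ℝ := N * (C * (cubeConst n * latticeConst n * weakConst p)) with hC₁
  set C₂ : ℝ := N * (C * latticeConst n) with hC₂
  have hC₁0 : 0 ≤ C₁ := by positivity
  have hC₂0 : 0 ≤ C₂ := by positivity
  refine ⟨1 + C₁ + C₂, by positivity, fun u j jt w hw h => ⟨?_, fun x => ?_⟩⟩
  · have hmeas : ∀ ε : Direction n, Measurable fun x : Space n => ∑' k,
        (ENNReal.ofReal (amp n j) * supCoeff Φ u j jt ε k) *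
          ENNReal.ofReal (weight ((2 : ℝ) ^ j • x - latticePoint k)) := fun ε =>
      Measurable.tsum fun k => ((measurable_weight.comp (by fun_prop)).ennreal_ofReal).const_mul _
    calc avgNorm p (majorant Φ u j jt)
        ≤ ∑ ε : Direction n, ENNReal.ofReal C * avgNorm p (fun x => ∑' k,
          (ENNReal.ofReal (amp n j) * supCoeff Φ u j jt ε k) *
            ENNReal.ofReal (weight ((2 : ℝ) ^ j • x - latticePoint k))) := by
          refine (avgNorm_mono (hpt u j jt)).trans ((avgNorm_sum_le fun ε =>
            (hmeas ε).const_mul _).trans (Finset.sum_le_sum fun ε _ => ?_))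
          exact avgNorm_const_mul_le _ (hmeas ε)
      _ ≤ ∑ _ε : Direction n, ENNReal.ofReal C * (ENNReal.ofReal (cubeConst n * latticeConst n) *
            ENNReal.ofReal (weakConst p * w)) := by
          refine Finset.sum_le_sum fun ε _ => mul_le_mul_right
            ((avgNorm_tsum_mul_weight_le j _).trans (mul_le_mul_right ?_ _)) _
          refine avgNorm_le_of_weakNorm_le hp (measurable_stepFun j _) hw (le_trans ?_ h)
          exact weakNorm_mono hp0 (stepFun_supCoeff_le_ringFun Φ u j jt ε)
      _ = ENNReal.ofReal (C₁ * w) := by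
          rw [Finset.sum_const, Finset.card_univ, nsmul_eq_mul, ← ENNReal.ofReal_natCast,
            ← ENNReal.ofReal_mul (by positivity), ← ENNReal.ofReal_mul hC0,
            ← ENNReal.ofReal_mul (by positivity), hC₁, hN]
          congr 1
          ring
      _ ≤ _ := by
          refine ENNReal.ofReal_le_ofReal ?_
          gcongr
          linarith
  · have hb : ∀ (ε : Direction n) k, ENNReal.ofReal (amp n j) * supCoeff Φ u j jt ε k ≤
        ENNReal.ofReal ((2 : ℝ) ^ ((j : ℝ) * (n / p)) * w) := fun ε =>
      le_of_weakNorm_stepFun_le hp0 j (fun k => ENNReal.ofReal (amp n j) * supCoeff Φ u j jt ε k)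
        hw.le ((weakNorm_mono hp0 (stepFun_supCoeff_le_ringFun Φ u j jt ε)).trans h)
    calc majorant Φ u j jt x
        ≤ ∑ _ε : Direction n, ENNReal.ofReal C *
          (ENNReal.ofReal ((2 : ℝ) ^ ((j : ℝ) * (n / p)) * w) *
            ENNReal.ofReal (latticeConst n)) := by
          refine (hpt u j jt x).trans (Finset.sum_le_sum fun ε _ => mul_le_mul_right ?_ _)
          calc _ ≤ ∑' k, ENNReal.ofReal ((2 : ℝ) ^ ((j : ℝ) * (n / p)) * w) *
                ENNReal.ofReal (weight ((2 : ℝ) ^ j • x - latticePoint k)) :=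
                ENNReal.tsum_le_tsum fun k => mul_le_mul_left (hb ε k) _
            _ ≤ _ := by
                rw [ENNReal.tsum_mul_left]
                exact mul_le_mul_right (tsum_weight_le _) _
      _ = ENNReal.ofReal (C₂ * ((2 : ℝ) ^ ((j : ℝ) * (n / p)) * w)) := by
          rw [Finset.sum_const, Finset.card_univ, nsmul_eq_mul, ← ENNReal.ofReal_natCast,
            ← ENNReal.ofReal_mul (by positivity), ← ENNReal.ofReal_mul hC0,
            ← ENNReal.ofReal_mul (by positivity), hC₂, hN]
          congr 1
          ring
      _ ≤ _ := by
          refine ENNReal.ofReal_le_ofReal ?_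
          gcongr
          linarith

theorem tsum_enorm_coeff_le_majorant (Φ : MeyerProfile) (u : ℝ → 𝓢'(Space n, ℂ)) (j : ℤ) {jt : ℤ}
    {t : ℝ} (ht : t ∈ timeRing jt) (x : Space n) :
    ∑ ε : Direction n, ∑' k : Fin n → ℤ, ‖coeff Φ (u t) ε j k * waveletAt Φ ε j k x‖ₑ ≤
      majorant Φ u j jt x := by
  refine Finset.sum_le_sum fun ε _ => ENNReal.tsum_le_tsum fun k => ?_
  rw [enorm_mul]
  exact mul_le_mul_left (le_iSup₂ (f := fun t _ => ‖coeff Φ (u t) ε j k‖ₑ) t ht) _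

theorem summable_of_tsum_enorm_ne_top {ι : Type*} {f : ι → ℂ} (h : ∑' i, ‖f i‖ₑ ≠ ⊤) :
    Summable f := by
  refine Summable.of_nnnorm ?_
  exact ENNReal.tsum_coe_ne_top_iff_summable.1 h

theorem enorm_tsum_le (ι : Type*) (f : ι → ℂ) : ‖∑' i, f i‖ₑ ≤ ∑' i, ‖f i‖ₑ := by
  by_cases h : ∑' i, ‖f i‖ₑ = ⊤
  · rw [h]
    exact le_top
  · have hs : Summable fun i => ‖f i‖₊ := ENNReal.tsum_coe_ne_top_iff_summable.1 h
    have h1 : ∑' i, ‖f i‖ₑ = ((∑' i, ‖f i‖₊ : NNReal) : ℝ≥0∞) := (ENNReal.coe_tsum hs).symm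
    rw [h1]
    exact ENNReal.coe_le_coe.2 (nnnorm_tsum_le hs)

theorem enorm_Qproj_le_majorant (Φ : MeyerProfile) (u : ℝ → 𝓢'(Space n, ℂ)) (j : ℤ) {jt : ℤ}
    {t : ℝ} (ht : t ∈ timeRing jt) (x : Space n) :
    ‖Qproj Φ j (u t) x‖ₑ ≤ majorant Φ u j jt x := by
  refine le_trans ?_ (tsum_enorm_coeff_le_majorant Φ u j ht x)
  exact (enorm_sum_le _ _).trans (Finset.sum_le_sum fun ε _ => enorm_tsum_le _ _)

/-! ### Bounds carried by the flow norm -/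

/-- The regularity index in force at the distance `d = j - j_t`: `m` for `d ≥ 0`, `m'` for
`d < 0`. -/
def flowOrder (m' m : ℝ) (d : ℤ) : ℝ := if 0 ≤ d then m else m'

theorem ringNorm_le_iff (Φ : MeyerProfile) (p m : ℝ) (f : ℝ → 𝓢'(Space n, ℂ)) (j jt : ℤ) (A : ℝ) :
    ringNorm Φ p m f j jt ≤ ENNReal.ofReal A ↔
      weakNorm p (ringFun Φ f j jt) ≤
        ENNReal.ofReal (A * 2 ^ (-(2 * ((j : ℝ) - jt) * m) - (j : ℝ) * ((n : ℝ) / p - 1))) := by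
  set x : ℝ := 2 * ((j : ℝ) - jt) * m
  set y : ℝ := (j : ℝ) * ((n : ℝ) / p - 1)
  have h2 : (0 : ℝ) < 2 := two_pos
  have hpos : (0 : ℝ) < 2 ^ (x + y) := Real.rpow_pos_of_pos h2 _
  have h1 : ringNorm Φ p m f j jt =
      ENNReal.ofReal (2 ^ (x + y)) * weakNorm p (ringFun Φ f j jt) := by
    rw [ringNorm, ← ENNReal.ofReal_mul (Real.rpow_nonneg h2.le _), ← Real.rpow_add h2]
  have h3 : A * 2 ^ (-x - y) = A / 2 ^ (x + y) := by
    rw [show -x - y = -(x + y) by ring, Real.rpow_neg h2.le, div_eq_mul_inv]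
  rw [h1, h3, ENNReal.ofReal_div_of_pos hpos, mul_comm,
    ENNReal.le_div_iff_mul_le (Or.inl (ENNReal.ofReal_pos.2 hpos).ne')
      (Or.inl ENNReal.ofReal_ne_top)]

/-- The flow norm enters the estimates only through this uniform bound, whatever the value of `q`. -/
theorem exists_ringNorm_le {Φ : MeyerProfile} {p : ℝ} {q : ℝ≥0∞} (hq : 1 ≤ q) {m' m : ℝ}
    {f : ℝ → 𝓢'(Space n, ℂ)} (h : flowNorm Φ p q m' m f < ⊤) :
    ∃ A : ℝ, 0 < A ∧ ∀ j jt : ℤ,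
      ringNorm Φ p (flowOrder m' m (j - jt)) f j jt ≤ ENNReal.ofReal A := by
  suffices ∃ N : ℝ≥0∞, N ≠ ⊤ ∧ ∀ j jt : ℤ, ringNorm Φ p (flowOrder m' m (j - jt)) f j jt ≤ N by
    obtain ⟨N, hN, hb⟩ := this
    refine ⟨N.toReal + 1, by positivity, fun j jt => (hb j jt).trans ?_⟩
    rw [← ENNReal.ofReal_toReal hN]
    refine ENNReal.ofReal_le_ofReal ?_
    rw [ENNReal.toReal_ofReal ENNReal.toReal_nonneg]
    linarith
  unfold flowNorm at h
  split_ifs at h with hqt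
  · refine ⟨_, h.ne, fun j jt => ?_⟩
    unfold flowOrder
    split_ifs with hd
    · refine le_trans ?_ le_self_add
      exact le_iSup_of_le jt (le_iSup (fun j : Set.Ici jt => ringNorm Φ p m f j jt)
        ⟨j, by simpa using hd⟩)
    · refine le_trans ?_ le_add_self
      exact le_iSup_of_le jt (le_iSup (fun j : Set.Iio jt => ringNorm Φ p m' f j jt)
        ⟨j, by simpa using hd⟩)
  · have hq0 : 0 < q.toReal := ENNReal.toReal_pos (zero_lt_one.trans_le hq).ne' hqt
    refine ⟨_, ENNReal.rpow_ne_top_of_nonneg (inv_pos.2 hq0).le h.ne, fun j jt => ?_⟩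
    rw [ENNReal.le_rpow_inv_iff hq0]
    refine le_trans ?_ (le_iSup _ jt)
    unfold flowOrder
    split_ifs with hd
    · refine le_trans ?_ le_self_add
      exact ENNReal.le_tsum (f := fun j : Set.Ici jt => ringNorm Φ p m f j jt ^ q.toReal)
        ⟨j, by simpa using hd⟩
    · refine le_trans ?_ le_add_self
      exact ENNReal.le_tsum (f := fun j : Set.Iio jt => ringNorm Φ p m' f j jt ^ q.toReal)
        ⟨j, by simpa using hd⟩

/-! ### Geometric sums -/

theorem tsum_two_rpow_neg_nat_lt_top {c : ℝ} (hc : 0 < c) :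
    ∑' r : ℕ, ENNReal.ofReal ((2 : ℝ) ^ (-c * r)) < ⊤ := by
  have h : ∀ r : ℕ, (2 : ℝ) ^ (-c * r) = ((2 : ℝ) ^ (-c)) ^ r := fun r => by
    rw [Real.rpow_mul zero_le_two, Real.rpow_natCast]
  have hs : Summable fun r : ℕ => (2 : ℝ) ^ (-c * r) := by
    simp_rw [h]
    exact summable_geometric_of_lt_one (by positivity)
      (Real.rpow_lt_one_of_one_lt_of_neg one_lt_two (by linarith))
  exact (ENNReal.ofReal_tsum_of_nonneg (fun _ => by positivity) hs) ▸ ENNReal.ofReal_lt_top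

theorem tsum_two_rpow_neg_abs_lt_top {c : ℝ} (hc : 0 < c) :
    ∑' e : ℤ, ENNReal.ofReal ((2 : ℝ) ^ (-c * |(e : ℝ)|)) < ⊤ := by
  have h : ∑' e : ℤ, ENNReal.ofReal ((2 : ℝ) ^ (-c * |(e : ℝ)|)) ≤
      ∑' r : ℕ, ENNReal.ofReal ((2 : ℝ) ^ (-c * r)) +
        ∑' r : ℕ, ENNReal.ofReal ((2 : ℝ) ^ (-c * r)) := by
    rw [← ENNReal.tsum_add]
    rw [tsum_of_nat_of_neg_add_one ENNReal.summable ENNReal.summable, ← ENNReal.tsum_add]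
    refine ENNReal.tsum_le_tsum fun r => add_le_add (by simp) (ENNReal.ofReal_le_ofReal ?_)
    refine Real.rpow_le_rpow_of_exponent_le one_le_two ?_
    have : |((-((r : ℤ) + 1) : ℤ) : ℝ)| = r + 1 := by
      push_cast
      rw [abs_neg, abs_of_nonneg (by positivity)]
    rw [this]
    nlinarith
  exact h.trans_lt (ENNReal.add_lt_top.2
    ⟨tsum_two_rpow_neg_nat_lt_top hc, tsum_two_rpow_neg_nat_lt_top hc⟩)

/-! ### The size of the coupled terms -/

/-- The factor `4^d 2^{-4 d μ}`, with `μ` the regularity index at distance `d`, describing the size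
of `Q_j u Q_j v` on the time ring `j_t = j - d`, relative to `4^{j_t}`. -/
def couplingWeight (m' m : ℝ) (d : ℤ) : ℝ := 2 ^ (2 * (d : ℝ) * (1 - 2 * flowOrder m' m d))

theorem couplingWeight_pos (m' m : ℝ) (d : ℤ) : 0 < couplingWeight m' m d :=
  Real.rpow_pos_of_pos two_pos _

/-- The bound of `couplingWeight` which decays as `d → -∞`, valid for all `d`. -/
theorem couplingWeight_le_growth {m' m b : ℝ} (hm : 1 ≤ m) (hb : 0 ≤ b) (hb' : b ≤ 1 - 2 * m')
    (d : ℤ) : couplingWeight m' m d ≤ 2 ^ (2 * b * d) := by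
  refine Real.rpow_le_rpow_of_exponent_le one_le_two ?_
  unfold flowOrder
  split_ifs with h
  · have h' : (0 : ℝ) ≤ d := by exact_mod_cast h
    nlinarith
  · have h' : (d : ℝ) ≤ 0 := by exact_mod_cast (not_le.1 h).le
    nlinarith

/-- The bound of `couplingWeight` which decays as `d → ∞`, valid for all `d`. -/
theorem couplingWeight_le_decay {m' m : ℝ} (hm : 1 ≤ m) (hm' : m' ≤ 1 / 2) (d : ℤ) :
    couplingWeight m' m d ≤ 2 ^ (-(2 * (2 * m - 1) * d)) := by
  refine Real.rpow_le_rpow_of_exponent_le one_le_two ?_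
  unfold flowOrder
  split_ifs with h
  · exact le_of_eq (by ring)
  · have h' : (d : ℝ) ≤ 0 := by exact_mod_cast (not_le.1 h).le
    nlinarith

/-- A function dominating `|Q_j u(t) Q_j v(t)|` for all `t` in a time ring. -/
def productMajorant (Φ : MeyerProfile) (u v : ℝ → 𝓢'(Space n, ℂ)) (j jt : ℤ) (x : Space n) :
    ℝ≥0∞ :=
  majorant Φ u j jt x * majorant Φ v j jt x

theorem measurable_productMajorant (Φ : MeyerProfile) (u v : ℝ → 𝓢'(Space n, ℂ)) (j jt : ℤ) :
    Measurable (productMajorant Φ u v j jt) :=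
  (measurable_majorant Φ u j jt).mul (measurable_majorant Φ v j jt)

/-- The information on a pair of flows on which the estimates of their coupling rest. Finiteness of
the two separate majorants is part of it, as in `ℝ≥0∞` it cannot be read off their product, which
vanishes when one factor is `0` and the other `∞`. -/
structure CouplingBound (Φ : MeyerProfile) (p m' m K : ℝ) (u v : ℝ → 𝓢'(Space n, ℂ)) : Prop where
  left : ∀ j jt x, majorant Φ u j jt x ≠ ⊤
  right : ∀ j jt x, majorant Φ v j jt x ≠ ⊤
  pos : 0 < K
  sup : ∀ (j jt : ℤ) x, productMajorant Φ u v j jt x ≤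
    ENNReal.ofReal (K * 2 ^ (2 * (jt : ℝ)) * couplingWeight m' m (j - jt))
  avg : ∀ j jt : ℤ, avgNorm p (productMajorant Φ u v j jt) ≤
    ENNReal.ofReal (K * 2 ^ (2 * (jt : ℝ)) * couplingWeight m' m (j - jt) *
      2 ^ (-((j : ℝ) * (n / p))))

theorem exists_couplingBound {Φ : MeyerProfile} {p : ℝ} (hp : 1 < p) {q : ℝ≥0∞} (hq : 1 ≤ q)
    {m' m : ℝ} {u v : ℝ → 𝓢'(Space n, ℂ)} (hu : flowNorm Φ p q m' m u < ⊤)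
    (hv : flowNorm Φ p q m' m v < ⊤) : ∃ K, CouplingBound Φ p m' m K u v := by
  obtain ⟨A, hA, hAb⟩ := exists_ringNorm_le hq hu
  obtain ⟨B, hB, hBb⟩ := exists_ringNorm_le hq hv
  obtain ⟨C, hC, hCb⟩ := majorant_bound (n := n) Φ hp
  simp_rw [ringNorm_le_iff] at hAb hBb
  have h2 : (0 : ℝ) < 2 := two_pos
  have hpos : ∀ x : ℝ, (0 : ℝ) < 2 ^ x := fun x => Real.rpow_pos_of_pos h2 x
  have hU := fun j jt => hCb u j jt _ (mul_pos hA (hpos _)) (hAb j jt)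
  have hV := fun j jt => hCb v j jt _ (mul_pos hB (hpos _)) (hBb j jt)
  refine ⟨(C * A) * (C * B), fun j jt x => ne_top_of_le_ne_top ENNReal.ofReal_ne_top
    ((hU j jt).2 x), fun j jt x => ne_top_of_le_ne_top ENNReal.ofReal_ne_top ((hV j jt).2 x),
    by positivity, fun j jt x => ?_, fun j jt => ?_⟩
  · refine (mul_le_mul' ((hU j jt).2 x) ((hV j jt).2 x)).trans (le_of_eq ?_)
    have := hpos
    rw [← ENNReal.ofReal_mul (by positivity)]
    congr 1
    set d := flowOrder m' m (j - jt) with hd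
    rw [couplingWeight, ← hd]
    rw [show ∀ a b c e : ℝ, C * (a * (A * b)) * (C * (c * (B * e))) =
      C * A * (C * B) * (a * b * (c * e)) by intros; ring, mul_assoc (C * A * (C * B))]
    rw [← Real.rpow_add h2, ← Real.rpow_add h2, ← Real.rpow_add h2]
    congr 2
    push_cast
    ring
  · refine (avgNorm_mul_le ((hU j jt).2) (measurable_majorant Φ v j jt)).trans ?_
    refine (mul_le_mul_right (hV j jt).1 _).trans (le_of_eq ?_)
    have := hpos
    rw [← ENNReal.ofReal_mul (by positivity)]
    congr 1
    set d := flowOrder m' m (j - jt) with hd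
    rw [couplingWeight, ← hd]
    rw [show ∀ a b c : ℝ, C * (a * (A * b)) * (C * (B * c)) =
      C * A * (C * B) * (a * b * c) by intros; ring]
    simp only [mul_assoc (C * A * (C * B))]
    rw [← Real.rpow_add h2, ← Real.rpow_add h2, ← Real.rpow_add h2, ← Real.rpow_add h2]
    congr 2
    push_cast
    ring

/-! ### Dyadic time rings -/

theorem exists_mem_timeRing {t : ℝ} (ht : 0 < t) : ∃ jt : ℤ, t ∈ timeRing jt := by
  obtain ⟨k, h1, h2⟩ := exists_mem_Ico_zpow ht (y := (4 : ℝ)) (by norm_num)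
  have h : ∀ i : ℤ, (4 : ℝ) ^ i = 2 ^ (2 * i) := fun i => by
    rw [zpow_mul]; norm_num
  rw [h] at h1 h2
  refine ⟨-k, ?_, ?_⟩
  · convert h1 using 2; ring
  · convert h2 using 2; ring

theorem pos_of_mem_timeRing {t : ℝ} {jt : ℤ} (h : t ∈ timeRing jt) : 0 < t :=
  (zpow_pos two_pos _).trans_le h.1

theorem Ioo_subset_iUnion_timeRing {t : ℝ} {jt : ℤ} (ht : t ∈ timeRing jt) :
    Set.Ioo 0 t ⊆ ⋃ r : ℕ, timeRing (jt + r) := by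
  intro s hs
  obtain ⟨js, hjs⟩ := exists_mem_timeRing hs.1
  have h1 : (2 : ℝ) ^ (-2 * js) < 2 ^ (2 - 2 * jt) := hjs.1.trans_lt (hs.2.trans ht.2)
  rw [zpow_lt_zpow_iff_right₀ one_lt_two] at h1
  refine Set.mem_iUnion.2 ⟨(js - jt).toNat, ?_⟩
  rwa [Int.toNat_of_nonneg (by omega), add_sub_cancel]

theorem volume_timeRing (jt : ℤ) :
    volume (timeRing jt) = ENNReal.ofReal (3 * 2 ^ (-(2 * (jt : ℝ)))) := by
  rw [Real.volume_Ico]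
  congr 1
  have h : (2 : ℝ) ^ (-(2 * (jt : ℝ))) = 2 ^ (-2 * jt) := by
    rw [← Real.rpow_intCast]
    push_cast
    congr 1
    ring
  rw [h, show (2 : ℤ) - 2 * jt = 2 + (-2 * jt) by ring, zpow_add₀ two_ne_zero]
  norm_num
  ring

/-! ### Space-time integrability of the coupling -/

theorem enorm_couplingProduct_le (Φ : MeyerProfile) (u v : ℝ → 𝓢'(Space n, ℂ)) {js : ℤ} {s : ℝ}
    (hs : s ∈ timeRing js) (x : Space n) :
    ‖couplingProduct Φ (u s) (v s) x‖ₑ ≤ ∑' j : ℤ, productMajorant Φ u v j js x := by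
  refine (enorm_tsum_le _ _).trans (ENNReal.tsum_le_tsum fun j => ?_)
  rw [enorm_mul]
  exact mul_le_mul' (enorm_Qproj_le_majorant Φ u j hs x) (enorm_Qproj_le_majorant Φ v j hs x)

theorem measurable_transposeMultiplier_param {P : Space n → ℂ} (hP : Measurable P)
    (φ : 𝓢(Space n, ℂ)) : Measurable fun z : ℝ × Space n =>
      transposeMultiplier (fun ξ => heat z.1 ξ * P ξ) φ z.2 :=
  measurable_fourier_param (f := fun z : ℝ × Space n =>
    heat z.1 z.2 * P z.2 * (𝓕⁻ φ : 𝓢(Space n, ℂ)) z.2)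
    ((measurable_heat.mul (hP.comp measurable_snd)).mul
      ((SchwartzMap.continuous _).measurable.comp measurable_snd))

theorem measurable_transposeMultiplier {P : Space n → ℂ} (hP : Measurable P) (τ : ℝ)
    (φ : 𝓢(Space n, ℂ)) : Measurable (transposeMultiplier (fun ξ => heat τ ξ * P ξ) φ) := by
  have h := (measurable_transposeMultiplier_param hP φ).comp (measurable_prodMk_left (x := τ))
  exact h

theorem lintegral_couplingProduct_mul_le (Φ : MeyerProfile) (u v : ℝ → 𝓢'(Space n, ℂ)) {js : ℤ}
    {s : ℝ} (hs : s ∈ timeRing js) {g : Space n → ℂ} (hg : Measurable g) :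
    ∫⁻ x, ‖couplingProduct Φ (u s) (v s) x * g x‖ₑ ≤
      ∑' j : ℤ, ∫⁻ x, productMajorant Φ u v j js x * ‖g x‖ₑ := by
  have hm (j : ℤ) : AEMeasurable (fun x => productMajorant Φ u v j js x * ‖g x‖ₑ) volume :=
    ((measurable_productMajorant Φ u v j js).mul hg.enorm).aemeasurable
  rw [← lintegral_tsum hm]
  refine lintegral_mono fun x => ?_
  rw [enorm_mul, ENNReal.tsum_mul_right]
  exact mul_le_mul_left (enorm_couplingProduct_le Φ u v hs x) _

/-- The sum over the levels `j` which controls pairings with a fixed bounded integrable function: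
high levels are controlled by the average norm, low levels by the uniform norm. -/
def levelSum (b a : ℝ) : ℝ≥0∞ :=
  ∑' j : ℤ, ENNReal.ofReal ((2 : ℝ) ^ (2 * b * j) * min 1 ((2 : ℝ) ^ (-(j * a))))

theorem levelSum_lt_top {b a : ℝ} (hb : 0 < b) (hba : 2 * b < a) : levelSum b a < ⊤ := by
  have hc : 0 < min (2 * b) (a - 2 * b) := lt_min (by linarith) (by linarith)
  refine (ENNReal.tsum_le_tsum fun j => ENNReal.ofReal_le_ofReal ?_).trans_lt
    (tsum_two_rpow_neg_abs_lt_top hc)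
  have hl := min_le_left (2 * b) (a - 2 * b)
  have hr := min_le_right (2 * b) (a - 2 * b)
  set c := min (2 * b) (a - 2 * b)
  rcases le_total 0 (j : ℝ) with hj | hj
  · calc (2 : ℝ) ^ (2 * b * j) * min 1 ((2 : ℝ) ^ (-(j * a)))
        ≤ (2 : ℝ) ^ (2 * b * j) * (2 : ℝ) ^ (-(j * a)) := by
          gcongr
          exact min_le_right _ _
      _ = (2 : ℝ) ^ (2 * b * j - j * a) := by rw [← Real.rpow_add two_pos]; congr 1
      _ ≤ _ := Real.rpow_le_rpow_of_exponent_le one_le_two (by rw [abs_of_nonneg hj]; nlinarith)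
  · calc (2 : ℝ) ^ (2 * b * j) * min 1 ((2 : ℝ) ^ (-(j * a)))
        ≤ (2 : ℝ) ^ (2 * b * j) * 1 := by
          gcongr
          exact min_le_left _ _
      _ = (2 : ℝ) ^ (2 * b * j) := mul_one _
      _ ≤ _ := Real.rpow_le_rpow_of_exponent_le one_le_two (by rw [abs_of_nonpos hj]; nlinarith)

/-- Summation over the levels `j`, on a fixed time ring, of pairings with a function in `L¹ ∩ L^∞`. -/
theorem tsum_lintegral_productMajorant_mul_le {Φ : MeyerProfile} {p m' m K b : ℝ}
    {u v : ℝ → 𝓢'(Space n, ℂ)} (hB : CouplingBound Φ p m' m K u v) (hp : 1 < p) (hm : 1 ≤ m)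
    (hb : 0 ≤ b) (hb' : b ≤ 1 - 2 * m') (js : ℤ) {g : Space n → ℝ≥0∞}
    {κ : ℝ≥0∞} (hg1 : ∫⁻ x, g x ≤ κ) (hg2 : ∀ x, g x ≤ κ) :
    ∑' j : ℤ, ∫⁻ x, productMajorant Φ u v j js x * g x ≤
      2 * ENNReal.ofReal (K * 2 ^ (2 * (1 - b) * (js : ℝ))) * levelSum b (n / p) * κ := by
  have hK := hB.pos
  rw [levelSum, ← ENNReal.tsum_mul_left, ← ENNReal.tsum_mul_right]
  refine ENNReal.tsum_le_tsum fun j => ?_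
  have hω := couplingWeight_pos m' m (j - js)
  set W : ℝ := K * 2 ^ (2 * (js : ℝ)) * couplingWeight m' m (j - js) with hW
  have hW0 : 0 < W := by positivity
  have h1 : ∫⁻ x, productMajorant Φ u v j js x * g x ≤ 2 * ENNReal.ofReal W * κ := by
    calc ∫⁻ x, productMajorant Φ u v j js x * g x ≤ ∫⁻ x, ENNReal.ofReal W * g x :=
          lintegral_mono fun x => mul_le_mul_left (hB.sup j js x) _
      _ = ENNReal.ofReal W * ∫⁻ x, g x := lintegral_const_mul' _ _ ENNReal.ofReal_ne_top
      _ ≤ ENNReal.ofReal W * κ := by gcongr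
      _ ≤ 2 * ENNReal.ofReal W * κ := by
          gcongr
          exact le_mul_of_one_le_left' one_le_two
  have h2 := lintegral_mul_le_of_avgNorm_le hp (measurable_productMajorant Φ u v j js)
    (by positivity) (hB.avg j js) hg1 hg2
  have h3 : ∫⁻ x, productMajorant Φ u v j js x * g x ≤
      2 * ENNReal.ofReal (W * min 1 ((2 : ℝ) ^ (-((j : ℝ) * (n / p))))) * κ := by
    rcases le_total 1 ((2 : ℝ) ^ (-((j : ℝ) * (n / p)))) with h | h
    · rwa [min_eq_left h, mul_one]
    · rwa [min_eq_right h]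
  refine h3.trans (mul_le_mul_left ?_ κ)
  rw [mul_assoc (2 : ℝ≥0∞), ← ENNReal.ofReal_mul (by positivity)]
  refine mul_le_mul_right (ENNReal.ofReal_le_ofReal ?_) _
  rw [← mul_assoc]
  refine mul_le_mul_of_nonneg_right ?_ (by positivity)
  rw [hW, mul_assoc, mul_assoc]
  refine mul_le_mul_of_nonneg_left ?_ hK.le
  refine (mul_le_mul_of_nonneg_left (couplingWeight_le_growth hm hb hb' _)
    (by positivity)).trans (le_of_eq ?_)
  rw [← Real.rpow_add two_pos, ← Real.rpow_add two_pos]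
  congr 1
  push_cast
  ring

theorem setLIntegral_le_tsum_timeRing {t : ℝ} {jt : ℤ} (ht : t ∈ timeRing jt) (f : ℝ → ℝ≥0∞) :
    ∫⁻ s in Set.Ioo 0 t, f s ≤ ∑' r : ℕ, ∫⁻ s in timeRing (jt + r) ∩ Set.Iio t, f s := by
  refine le_trans (lintegral_mono_set ?_) (lintegral_iUnion_le _ _)
  rw [← Set.iUnion_inter]
  exact fun s hs => ⟨Ioo_subset_iUnion_timeRing ht hs, hs.2⟩

/-- Integration in time: the length `3 · 4^{-j_s}` of the ring `j_s` leaves a geometric series. -/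
theorem setLIntegral_Ioo_le_of_timeRing_bound {t : ℝ} {jt : ℤ} (ht : t ∈ timeRing jt)
    {f : ℝ → ℝ≥0∞} {b : ℝ} {c : ℝ≥0∞}
    (hf : ∀ js : ℤ, ∀ s ∈ timeRing js, s < t →
      f s ≤ ENNReal.ofReal ((2 : ℝ) ^ (2 * (1 - b) * (js : ℝ))) * c) :
    ∫⁻ s in Set.Ioo 0 t, f s ≤ 3 * ENNReal.ofReal ((2 : ℝ) ^ (-(2 * b * (jt : ℝ)))) *
      (∑' r : ℕ, ENNReal.ofReal ((2 : ℝ) ^ (-(2 * b) * (r : ℝ)))) * c := by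
  refine (setLIntegral_le_tsum_timeRing ht f).trans ?_
  rw [← ENNReal.tsum_mul_left, ← ENNReal.tsum_mul_right]
  refine ENNReal.tsum_le_tsum fun r => ?_
  calc ∫⁻ s in timeRing (jt + r) ∩ Set.Iio t, f s
      ≤ ∫⁻ s in timeRing (jt + r) ∩ Set.Iio t,
          ENNReal.ofReal ((2 : ℝ) ^ (2 * (1 - b) * ((jt + r : ℤ) : ℝ))) * c :=
        setLIntegral_mono' (measurableSet_Ico.inter measurableSet_Iio)
          fun s hs => hf _ s hs.1 hs.2
    _ ≤ ENNReal.ofReal ((2 : ℝ) ^ (2 * (1 - b) * ((jt + r : ℤ) : ℝ))) * c *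
          volume (timeRing (jt + r)) := by
        rw [setLIntegral_const]
        gcongr
        exact Set.inter_subset_left
    _ = _ := by
        have h3 : (3 : ℝ≥0∞) = ENNReal.ofReal 3 := by simp
        rw [volume_timeRing, mul_right_comm, h3, ← ENNReal.ofReal_mul (by positivity),
          ← ENNReal.ofReal_mul (by positivity), ← ENNReal.ofReal_mul (by positivity)]
        congr 2
        rw [mul_left_comm, mul_assoc 3, ← Real.rpow_add two_pos, ← Real.rpow_add two_pos]
        congr 2
        push_cast
        ring

/-! ### Measurability of the coupling -/

theorem aemeasurable_Qproj (Φ : MeyerProfile) {u : ℝ → 𝓢'(Space n, ℂ)}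
    (hu : ∀ φ : 𝓢(Space n, ℂ), AEMeasurable (fun t => u t φ) (volume.restrict (Set.Ioi 0)))
    (j : ℤ) : AEMeasurable (fun z : ℝ × Space n => Qproj Φ j (u z.1) z.2)
      ((volume.restrict (Set.Ioi 0)).prod volume) := by
  have h (ε : Direction n) (k : Fin n → ℤ) : AEMeasurable
      (fun z : ℝ × Space n => coeff Φ (u z.1) ε j k * waveletAt Φ ε j k z.2)
      ((volume.restrict (Set.Ioi 0)).prod volume) := by
    have h1 : AEMeasurable (fun z : ℝ × Space n => coeff Φ (u z.1) ε j k)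
        ((volume.restrict (Set.Ioi 0)).prod volume) := (hu _).comp_fst
    have h2 : Measurable fun x => waveletAt Φ (ε : Fin n → Fin 2) j k x :=
      (SchwartzMap.continuous _).measurable
    exact h1.mul (h2.comp measurable_snd).aemeasurable
  exact Finset.aemeasurable_fun_sum _ fun ε _ => AEMeasurable.tsum (h ε)

theorem aemeasurable_couplingProduct (Φ : MeyerProfile) {u v : ℝ → 𝓢'(Space n, ℂ)}
    (hu : ∀ φ : 𝓢(Space n, ℂ), AEMeasurable (fun t => u t φ) (volume.restrict (Set.Ioi 0)))
    (hv : ∀ φ : 𝓢(Space n, ℂ), AEMeasurable (fun t => v t φ) (volume.restrict (Set.Ioi 0))) :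
    AEMeasurable (fun z : ℝ × Space n => couplingProduct Φ (u z.1) (v z.1) z.2)
      ((volume.restrict (Set.Ioi 0)).prod volume) :=
  AEMeasurable.tsum fun j => (aemeasurable_Qproj Φ hu j).mul (aemeasurable_Qproj Φ hv j)

theorem aestronglyMeasurable_pairing (Φ : MeyerProfile) {u v : ℝ → 𝓢'(Space n, ℂ)}
    (hu : ∀ φ : 𝓢(Space n, ℂ), AEMeasurable (fun t => u t φ) (volume.restrict (Set.Ioi 0)))
    (hv : ∀ φ : 𝓢(Space n, ℂ), AEMeasurable (fun t => v t φ) (volume.restrict (Set.Ioi 0)))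
    {P : Space n → ℂ} (hP : Measurable P) (φ : 𝓢(Space n, ℂ)) :
    AEStronglyMeasurable (fun z : ℝ × ℝ => multiplierPairing (fun ξ => heat (z.1 - z.2) ξ * P ξ)
      (couplingProduct Φ (u z.2) (v z.2)) φ)
      ((volume.restrict (Set.Ioi 0)).prod (volume.restrict (Set.Ioi 0))) := by
  unfold multiplierPairing
  refine AEStronglyMeasurable.integral_prod_right' (f := fun y : (ℝ × ℝ) × Space n =>
    couplingProduct Φ (u y.1.2) (v y.1.2) y.2 *
      transposeMultiplier (fun ξ => heat (y.1.1 - y.1.2) ξ * P ξ) φ y.2) ?_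
  refine AEStronglyMeasurable.mul (AEMeasurable.aestronglyMeasurable ?_)
    (Measurable.aestronglyMeasurable ?_)
  · have h1 : Measure.QuasiMeasurePreserving (fun y : (ℝ × ℝ) × Space n => (y.1.2, y.2))
        (((volume.restrict (Set.Ioi (0 : ℝ))).prod (volume.restrict (Set.Ioi (0 : ℝ)))).prod volume)
        ((volume.restrict (Set.Ioi (0 : ℝ))).prod volume) :=
      Measure.quasiMeasurePreserving_snd.comp
        (measurePreserving_prodAssoc (volume.restrict (Set.Ioi (0 : ℝ)))
          (volume.restrict (Set.Ioi (0 : ℝ))) (volume : Measure (Space n))).quasiMeasurePreserving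
    have h0 := (aemeasurable_couplingProduct Φ hu hv).comp_quasiMeasurePreserving h1
    exact h0
  · have h2 : Measurable fun y : (ℝ × ℝ) × Space n => (y.1.1 - y.1.2, y.2) := by fun_prop
    have h3 := (measurable_transposeMultiplier_param hP φ).comp h2
    exact h3

theorem aemeasurable_pairing (Φ : MeyerProfile) {u v : ℝ → 𝓢'(Space n, ℂ)}
    (hu : ∀ φ : 𝓢(Space n, ℂ), AEMeasurable (fun t => u t φ) (volume.restrict (Set.Ioi 0)))
    (hv : ∀ φ : 𝓢(Space n, ℂ), AEMeasurable (fun t => v t φ) (volume.restrict (Set.Ioi 0)))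
    {P : Space n → ℂ} (hP : Measurable P) (φ : 𝓢(Space n, ℂ)) (t : ℝ) :
    AEStronglyMeasurable (fun s : ℝ => multiplierPairing (fun ξ => heat (t - s) ξ * P ξ)
      (couplingProduct Φ (u s) (v s)) φ) (volume.restrict (Set.Ioi 0)) := by
  unfold multiplierPairing
  refine AEStronglyMeasurable.integral_prod_right' (f := fun y : ℝ × Space n =>
    couplingProduct Φ (u y.1) (v y.1) y.2 *
      transposeMultiplier (fun ξ => heat (t - y.1) ξ * P ξ) φ y.2) ?_
  refine AEStronglyMeasurable.mul (aemeasurable_couplingProduct Φ hu hv).aestronglyMeasurable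
    (Measurable.aestronglyMeasurable ?_)
  have h2 : Measurable fun y : ℝ × Space n => (t - y.1, y.2) := by fun_prop
  have h3 := (measurable_transposeMultiplier_param hP φ).comp h2
  exact h3

/-! ### The coupling flow as a family of tempered distributions -/

/-- The rate `b` of geometric decay: each bound on it is used in one range of levels and rings. -/
theorem exists_exponent {m' a : ℝ} (hm' : m' < 1 / 2) (ha : 0 < a) :
    ∃ b : ℝ, 0 < b ∧ b ≤ 1 / 2 ∧ b ≤ 1 - 2 * m' ∧ 2 * b < a := by
  refine ⟨min (1 / 2) (min (1 - 2 * m') (a / 4)),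
    lt_min (by norm_num) (lt_min (by linarith) (by linarith)), min_le_left _ _,
    (min_le_right _ _).trans (min_le_left _ _), ?_⟩
  have := (min_le_right (1 / 2) (min (1 - 2 * m') (a / 4))).trans (min_le_right _ _)
  linarith

theorem tsum_couplingWeight_lt_top {m' m b : ℝ} (hm : 1 ≤ m) (hb : 0 < b) (hb2 : b ≤ 1 / 2)
    (hb' : b ≤ 1 - 2 * m') (js : ℤ) :
    ∑' j : ℤ, ENNReal.ofReal (couplingWeight m' m (j - js)) < ⊤ := by
  have h := (Equiv.subRight js).tsum_eq fun e : ℤ => ENNReal.ofReal (couplingWeight m' m e)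
  simp only [Equiv.subRight_apply] at h
  rw [h]
  refine (ENNReal.tsum_le_tsum fun e => ENNReal.ofReal_le_ofReal ?_).trans_lt
    (tsum_two_rpow_neg_abs_lt_top (c := 2 * b) (by linarith))
  rcases le_total 0 (e : ℝ) with he | he
  · refine (couplingWeight_le_decay hm (by linarith) e).trans
      (Real.rpow_le_rpow_of_exponent_le one_le_two ?_)
    rw [abs_of_nonneg he]
    nlinarith
  · refine (couplingWeight_le_growth hm hb.le hb' e).trans
      (Real.rpow_le_rpow_of_exponent_le one_le_two ?_)
    rw [abs_of_nonpos he]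
    nlinarith

theorem CouplingBound.tsum_productMajorant_lt_top {Φ : MeyerProfile} {p m' m K b : ℝ}
    {u v : ℝ → 𝓢'(Space n, ℂ)} (hB : CouplingBound Φ p m' m K u v) (hm : 1 ≤ m)
    (hb : 0 < b) (hb2 : b ≤ 1 / 2) (hb' : b ≤ 1 - 2 * m') (js : ℤ) (x : Space n) :
    ∑' j : ℤ, productMajorant Φ u v j js x < ⊤ := by
  refine (ENNReal.tsum_le_tsum fun j => hB.sup j js x).trans_lt ?_
  have hK := hB.pos
  simp_rw [ENNReal.ofReal_mul (show 0 ≤ K * 2 ^ (2 * (js : ℝ)) by positivity)]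
  rw [ENNReal.tsum_mul_left]
  exact ENNReal.mul_lt_top ENNReal.ofReal_lt_top (tsum_couplingWeight_lt_top hm hb hb2 hb' js)

theorem summable_of_majorant_ne_top {Φ : MeyerProfile} {u : ℝ → 𝓢'(Space n, ℂ)} {j js : ℤ}
    {x : Space n} (h : majorant Φ u j js x ≠ ⊤) {s : ℝ} (hs : s ∈ timeRing js) (ε : Direction n) :
    Summable fun k : Fin n → ℤ => coeff Φ (u s) ε j k * waveletAt Φ ε j k x := by
  refine summable_of_tsum_enorm_ne_top (ne_top_of_le_ne_top h (le_trans ?_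
    (tsum_enorm_coeff_le_majorant Φ u j hs x)))
  exact Finset.single_le_sum (f := fun ε : Direction n => ∑' k : Fin n → ℤ,
    ‖coeff Φ (u s) ε j k * waveletAt Φ ε j k x‖ₑ) (fun _ _ => zero_le) (Finset.mem_univ ε)

theorem measurable_Qproj (Φ : MeyerProfile) (j : ℤ) (f : 𝓢'(Space n, ℂ)) :
    Measurable (Qproj Φ j f) := by
  have h (ε : Direction n) (k : Fin n → ℤ) :
      Measurable fun x => coeff Φ f ε j k * waveletAt Φ ε j k x := by
    have h0 : Measurable fun x => waveletAt Φ (ε : Fin n → Fin 2) j k x :=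
      (SchwartzMap.continuous _).measurable
    exact h0.const_mul _
  exact Finset.measurable_fun_sum _ fun ε _ => Measurable.tsum fun k => h ε k

theorem measurable_couplingProduct (Φ : MeyerProfile) (f g : 𝓢'(Space n, ℂ)) :
    Measurable (couplingProduct Φ f g) :=
  Measurable.tsum fun j => (measurable_Qproj Φ j f).mul (measurable_Qproj Φ j g)

/-- The integrand `⟨e^{(t-s)Δ} P(D) (∑_j Q_j u(s) Q_j v(s)), φ⟩` of the coupling flow. -/
def duhamelIntegrand (Φ : MeyerProfile) (P : Space n → ℂ) (u v : ℝ → 𝓢'(Space n, ℂ))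
    (φ : 𝓢(Space n, ℂ)) (t s : ℝ) : ℂ :=
  multiplierPairing (fun ξ => heat (t - s) ξ * P ξ) (couplingProduct Φ (u s) (v s)) φ

/-- Space-time absolute convergence of the pairings, with a bound which is continuous in the test
function. -/
theorem exists_lintegral_duhamelIntegrand_le {Φ : MeyerProfile} {p m' m K b : ℝ}
    {u v : ℝ → 𝓢'(Space n, ℂ)} (hB : CouplingBound Φ p m' m K u v) (hp : 1 < p) (hm : 1 ≤ m)
    (hb : 0 < b) (hb' : b ≤ 1 - 2 * m') (hba : 2 * b < n / p)
    {P : Space n → ℂ} (hP : IsFirstOrder P) :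
    ∃ κ : 𝓢(Space n, ℂ) → ℝ, Filter.Tendsto κ (nhds 0) (nhds 0) ∧ (∀ φ, 0 ≤ κ φ) ∧
      (∀ φ s t, 0 < s → s < t → ∫⁻ x, ‖couplingProduct Φ (u s) (v s) x *
        transposeMultiplier (fun ξ => heat (t - s) ξ * P ξ) φ x‖ₑ < ⊤) ∧
      ∀ t, 0 < t → ∃ C : ℝ, 0 ≤ C ∧ ∀ φ,
        ∫⁻ s in Set.Ioo 0 t, ‖duhamelIntegrand Φ P u v φ t s‖ₑ ≤ ENNReal.ofReal (C * κ φ) := by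
  obtain ⟨κ, hκ, hκ0, hκb⟩ := transposeMultiplier_norm_le hP
  have hS := levelSum_lt_top hb hba
  have hmain : ∀ φ, ∀ js : ℤ, ∀ s ∈ timeRing js, ∀ t, s < t →
      ∫⁻ x, ‖couplingProduct Φ (u s) (v s) x *
        transposeMultiplier (fun ξ => heat (t - s) ξ * P ξ) φ x‖ₑ ≤
      ENNReal.ofReal ((2 : ℝ) ^ (2 * (1 - b) * (js : ℝ))) *
        (2 * ENNReal.ofReal K * levelSum b (n / p) * ENNReal.ofReal (κ φ)) := by
    intro φ js s hs t hst
    refine (lintegral_couplingProduct_mul_le Φ u v hs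
      (measurable_transposeMultiplier hP.measurable (t - s) φ)).trans ?_
    have hτ := hκb φ (t - s) (by linarith)
    refine (tsum_lintegral_productMajorant_mul_le hB hp hm hb.le hb' js hτ.1 hτ.2).trans
      (le_of_eq ?_)
    rw [ENNReal.ofReal_mul hB.pos.le]
    ring
  refine ⟨κ, hκ, hκ0, fun φ s t hs hst => ?_, fun t ht => ?_⟩
  · obtain ⟨js, hjs⟩ := exists_mem_timeRing hs
    refine (hmain φ js s hjs t hst).trans_lt ?_
    exact ENNReal.mul_lt_top ENNReal.ofReal_lt_top (ENNReal.mul_lt_top (ENNReal.mul_lt_top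
      (ENNReal.mul_lt_top ENNReal.ofNat_lt_top ENNReal.ofReal_lt_top) hS) ENNReal.ofReal_lt_top)
  · obtain ⟨jt, hjt⟩ := exists_mem_timeRing ht
    set c : ℝ≥0∞ := 3 * ENNReal.ofReal ((2 : ℝ) ^ (-(2 * b * (jt : ℝ)))) *
      (∑' r : ℕ, ENNReal.ofReal ((2 : ℝ) ^ (-(2 * b) * (r : ℝ)))) *
        (2 * ENNReal.ofReal K * levelSum b (n / p)) with hc
    have hct : c ≠ ⊤ := (ENNReal.mul_lt_top (ENNReal.mul_lt_top
      (ENNReal.mul_lt_top ENNReal.ofNat_lt_top ENNReal.ofReal_lt_top)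
      (tsum_two_rpow_neg_nat_lt_top (by linarith))) (ENNReal.mul_lt_top
      (ENNReal.mul_lt_top ENNReal.ofNat_lt_top ENNReal.ofReal_lt_top) hS)).ne
    refine ⟨c.toReal, ENNReal.toReal_nonneg, fun φ => ?_⟩
    rw [ENNReal.ofReal_mul ENNReal.toReal_nonneg, ENNReal.ofReal_toReal hct, hc, mul_assoc]
    exact setLIntegral_Ioo_le_of_timeRing_bound hjt fun js s hs hst =>
      (enorm_integral_le_lintegral_enorm _).trans (hmain φ js s hs t hst)

/-- Duhamel's integral defines tempered distributions: continuity in the test function comes from the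
factor `κ` of `exists_lintegral_duhamelIntegrand_le`. -/
theorem exists_isCouplingFlow {Φ : MeyerProfile} {p m' m K b : ℝ}
    {u v : ℝ → 𝓢'(Space n, ℂ)} (hB : CouplingBound Φ p m' m K u v) (hp : 1 < p) (hm : 1 ≤ m)
    (hb : 0 < b) (hb2 : b ≤ 1 / 2) (hb' : b ≤ 1 - 2 * m') (hba : 2 * b < n / p)
    (hu : ∀ φ : 𝓢(Space n, ℂ), AEMeasurable (fun t => u t φ) (volume.restrict (Set.Ioi 0)))
    (hv : ∀ φ : 𝓢(Space n, ℂ), AEMeasurable (fun t => v t φ) (volume.restrict (Set.Ioi 0)))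
    {P : Space n → ℂ} (hP : IsFirstOrder P) :
    ∃ F : ℝ → 𝓢'(Space n, ℂ), IsCouplingFlow Φ (fun τ ξ => heat τ ξ * P ξ) u v F ∧
      ∀ φ : 𝓢(Space n, ℂ), AEMeasurable (fun t => F t φ) (volume.restrict (Set.Ioi 0)) := by
  obtain ⟨κ, hκ, hκ0, hspace, htime⟩ :=
    exists_lintegral_duhamelIntegrand_le hB hp hm hb hb' hba hP
  have hspace' : ∀ φ s t, 0 < s → s < t → Integrable fun x => couplingProduct Φ (u s) (v s) x *
      transposeMultiplier (fun ξ => heat (t - s) ξ * P ξ) φ x := fun φ s t hs hst =>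
    ⟨((measurable_couplingProduct Φ _ _).mul
      (measurable_transposeMultiplier hP.measurable _ _)).aestronglyMeasurable, hspace φ s t hs hst⟩
  have htime' : ∀ t, 0 < t → ∀ φ, IntegrableOn (duhamelIntegrand Φ P u v φ t) (Set.Ioo 0 t) := by
    intro t ht φ
    obtain ⟨C, -, hC⟩ := htime t ht
    refine ⟨(aemeasurable_pairing Φ hu hv hP.measurable φ t).mono_measure
      (Measure.restrict_mono Set.Ioo_subset_Ioi_self le_rfl), (hC φ).trans_lt ENNReal.ofReal_lt_top⟩
  have hadd : ∀ t, 0 < t → ∀ φ χ, ∫ s in Set.Ioo 0 t, duhamelIntegrand Φ P u v (φ + χ) t s =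
      (∫ s in Set.Ioo 0 t, duhamelIntegrand Φ P u v φ t s) +
        ∫ s in Set.Ioo 0 t, duhamelIntegrand Φ P u v χ t s := by
    intro t ht φ χ
    rw [← integral_add (htime' t ht φ) (htime' t ht χ)]
    refine setIntegral_congr_fun measurableSet_Ioo fun s hs => ?_
    simp only [duhamelIntegrand, multiplierPairing]
    rw [← integral_add (hspace' φ s t hs.1 hs.2) (hspace' χ s t hs.1 hs.2)]
    refine integral_congr_ae (Filter.Eventually.of_forall fun x => ?_)
    simp only [transposeMultiplier_add hP (sub_nonneg.2 hs.2.le), mul_add]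
  have hsmul : ∀ t, 0 < t → ∀ (c : ℂ) φ, ∫ s in Set.Ioo 0 t, duhamelIntegrand Φ P u v (c • φ) t s =
      c * ∫ s in Set.Ioo 0 t, duhamelIntegrand Φ P u v φ t s := by
    intro t ht c φ
    rw [← integral_const_mul]
    refine setIntegral_congr_fun measurableSet_Ioo fun s hs => ?_
    simp only [duhamelIntegrand, multiplierPairing]
    rw [← integral_const_mul]
    refine integral_congr_ae (Filter.Eventually.of_forall fun x => ?_)
    simp only [transposeMultiplier_smul, mul_left_comm]
  let L : ∀ t : ℝ, 0 < t → (𝓢(Space n, ℂ) →ₗ[ℂ] ℂ) := fun t ht =>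
    { toFun := fun φ => ∫ s in Set.Ioo 0 t, duhamelIntegrand Φ P u v φ t s
      map_add' := hadd t ht
      map_smul' := fun c φ => hsmul t ht c φ }
  have hL : ∀ t (ht : 0 < t), Continuous (L t ht) := by
    intro t ht
    refine continuous_of_continuousAt_zero (L t ht) ?_
    obtain ⟨C, hC0, hC⟩ := htime t ht
    rw [ContinuousAt, map_zero]
    refine squeeze_zero_norm (a := fun φ => C * κ φ) (fun φ => ?_) (by simpa using hκ.const_mul C)
    have h := (enorm_integral_le_lintegral_enorm _).trans (hC φ)
    rw [← ofReal_norm, ENNReal.ofReal_le_ofReal_iff (mul_nonneg hC0 (hκ0 φ))] at h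
    exact h
  classical
  -- the values at times `t ≤ 0` play no role
  let F : ℝ → 𝓢'(Space n, ℂ) := fun t => if ht : 0 < t then
    ContinuousLinearMap.toPointwiseConvergenceCLM _ _ _ _ ⟨L t ht, hL t ht⟩ else 0
  have hF : ∀ t, 0 < t → ∀ φ, F t φ = ∫ s in Set.Ioo 0 t, duhamelIntegrand Φ P u v φ t s := by
    intro t ht φ
    simp only [F, dif_pos ht]
    rfl
  refine ⟨F, ⟨fun s hs ε j x => ?_, fun s hs ε j x => ?_, fun s hs x => ?_,
    fun s t hs hst φ => hspace' φ s t hs hst, fun t ht φ => ?_, fun t ht φ => ?_⟩, fun φ => ?_⟩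
  · obtain ⟨js, hjs⟩ := exists_mem_timeRing hs
    exact summable_of_majorant_ne_top (hB.left j js x) hjs ε
  · obtain ⟨js, hjs⟩ := exists_mem_timeRing hs
    exact summable_of_majorant_ne_top (hB.right j js x) hjs ε
  · obtain ⟨js, hjs⟩ := exists_mem_timeRing hs
    refine summable_of_tsum_enorm_ne_top (ne_top_of_le_ne_top
      (hB.tsum_productMajorant_lt_top hm hb hb2 hb' js x).ne (ENNReal.tsum_le_tsum fun j => ?_))
    rw [enorm_mul]
    exact mul_le_mul' (enorm_Qproj_le_majorant Φ u j hjs x) (enorm_Qproj_le_majorant Φ v j hjs x)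
  · rw [intervalIntegrable_iff_integrableOn_Ioo_of_le ht.le]
    exact htime' t ht φ
  · rw [hF t ht, intervalIntegral.integral_of_le ht.le, integral_Ioc_eq_integral_Ioo]
    rfl
  · have h1 := aestronglyMeasurable_pairing Φ hu hv hP.measurable φ
    have h2 : MeasurableSet {z : ℝ × ℝ | z.2 < z.1} := measurableSet_lt measurable_snd measurable_fst
    have h3 := (h1.indicator h2).integral_prod_right'
    refine h3.aemeasurable.congr ?_
    refine (ae_restrict_iff' measurableSet_Ioi).2 (Filter.Eventually.of_forall fun t ht => ?_)
    refine Eq.trans ?_ (hF t ht φ).symm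
    have h4 : Set.Ioo 0 t = Set.Ioi 0 ∩ Set.Iio t := rfl
    rw [h4, ← setIntegral_indicator measurableSet_Iio]
    rfl

/-! ### Wavelet coefficients of the coupling flow -/

theorem tsum_enorm_term_le_majorant (Φ : MeyerProfile) (u : ℝ → 𝓢'(Space n, ℂ)) (j : ℤ) {js : ℤ}
    {s : ℝ} (hs : s ∈ timeRing js) (x : Space n) :
    ∑' i : Direction n × (Fin n → ℤ), ‖coeff Φ (u s) i.1 j i.2 * waveletAt Φ i.1 j i.2 x‖ₑ ≤
      majorant Φ u j js x := by
  rw [ENNReal.tsum_prod', tsum_fintype]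
  exact tsum_enorm_coeff_le_majorant Φ u j hs x

theorem Qproj_eq_tsum_prod {Φ : MeyerProfile} {u : ℝ → 𝓢'(Space n, ℂ)} {j js : ℤ}
    {x : Space n} (h : majorant Φ u j js x ≠ ⊤) {s : ℝ} (hs : s ∈ timeRing js) :
    Qproj Φ j (u s) x = ∑' i : Direction n × (Fin n → ℤ),
      coeff Φ (u s) i.1 j i.2 * waveletAt Φ i.1 j i.2 x := by
  have hsum := summable_of_tsum_enorm_ne_top
    (ne_top_of_le_ne_top h (tsum_enorm_term_le_majorant Φ u j hs x))
  rw [hsum.tsum_prod, tsum_fintype]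
  rfl

/-- By the frequency supports, the level `j'` of the coupling product does not contribute to wavelet
coefficients at levels `j > j' + 3`. -/
theorem integral_Qproj_mul_eq_zero {Φ : MeyerProfile} {u v : ℝ → 𝓢'(Space n, ℂ)}
    {P : Space n → ℂ} (hP : IsFirstOrder P) {js : ℤ} {s : ℝ} (hs : s ∈ timeRing js) {j j' : ℤ}
    (hu : ∀ x, majorant Φ u j' js x ≠ ⊤) (hv : ∀ x, majorant Φ v j' js x ≠ ⊤)
    (hj : j' < j - 3) {τ : ℝ} (hτ : 0 ≤ τ) (ε : Direction n) (k : Fin n → ℤ)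
    (hfin : ∫⁻ x, productMajorant Φ u v j' js x *
      ‖transposeMultiplier (fun ξ => heat τ ξ * P ξ) (waveletAt Φ ε j k) x‖ₑ ≠ ⊤) :
    ∫ x, Qproj Φ j' (u s) x * Qproj Φ j' (v s) x *
      transposeMultiplier (fun ξ => heat τ ξ * P ξ) (waveletAt Φ ε j k) x = 0 := by
  set T := transposeMultiplier (fun ξ => heat τ ξ * P ξ) (waveletAt Φ ε j k) with hT
  have hTm : Measurable T := measurable_transposeMultiplier hP.measurable τ _
  set a : Direction n × (Fin n → ℤ) → Space n → ℂ := fun i x =>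
    coeff Φ (u s) i.1 j' i.2 * waveletAt Φ i.1 j' i.2 x with ha
  set b : Direction n × (Fin n → ℤ) → Space n → ℂ := fun i x =>
    coeff Φ (v s) i.1 j' i.2 * waveletAt Φ i.1 j' i.2 x with hb
  have hw : ∀ (ε : Direction n) k, Measurable fun x => waveletAt Φ (ε : Fin n → Fin 2) j' k x :=
    fun ε k => (SchwartzMap.continuous _).measurable
  have ham : ∀ i, Measurable (a i) := fun i => (hw i.1 i.2).const_mul _
  have hbm : ∀ i, Measurable (b i) := fun i => (hw i.1 i.2).const_mul _
  have hau : ∀ x, ∑' i, ‖a i x‖ₑ ≤ majorant Φ u j' js x := tsum_enorm_term_le_majorant Φ u j' hs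
  have hbv : ∀ x, ∑' i, ‖b i x‖ₑ ≤ majorant Φ v j' js x := tsum_enorm_term_le_majorant Φ v j' hs
  have hexp : ∀ x, Qproj Φ j' (u s) x * Qproj Φ j' (v s) x * T x =
      ∑' z : (Direction n × (Fin n → ℤ)) × (Direction n × (Fin n → ℤ)),
        a z.1 x * b z.2 x * T x := by
    intro x
    rw [Qproj_eq_tsum_prod (hu x) hs, Qproj_eq_tsum_prod (hv x) hs, tsum_mul_right]
    congr 1
    refine tsum_mul_tsum_of_summable_norm ?_ ?_
    · exact (summable_of_tsum_enorm_ne_top (ne_top_of_le_ne_top (hu x) (hau x))).norm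
    · exact (summable_of_tsum_enorm_ne_top (ne_top_of_le_ne_top (hv x) (hbv x))).norm
  simp_rw [hexp]
  have hmz : ∀ z : (Direction n × (Fin n → ℤ)) × (Direction n × (Fin n → ℤ)),
      Measurable fun x => a z.1 x * b z.2 x * T x := fun z => ((ham z.1).mul (hbm z.2)).mul hTm
  rw [integral_tsum fun z => (hmz z).aestronglyMeasurable]
  · refine (tsum_congr fun z => ?_).trans tsum_zero
    have h0 := integral_waveletAt_mul_transposeMultiplier_eq_zero hP Φ hτ ε hj k
      z.1.1 z.2.1 z.1.2 z.2.2
    have h1 : ∀ x, a z.1 x * b z.2 x * T x =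
        (coeff Φ (u s) z.1.1 j' z.1.2 * coeff Φ (v s) z.2.1 j' z.2.2) *
          (waveletAt Φ z.1.1 j' z.1.2 x * waveletAt Φ z.2.1 j' z.2.2 x * T x) := fun x => by
      simp only [ha, hb]
      ring
    simp_rw [h1]
    rw [integral_const_mul, h0, mul_zero]
  · rw [← lintegral_tsum fun z => (hmz z).enorm.aemeasurable]
    refine ne_top_of_le_ne_top hfin (lintegral_mono fun x => ?_)
    simp only [enorm_mul]
    rw [ENNReal.tsum_mul_right]
    refine mul_le_mul_left ?_ _
    rw [ENNReal.tsum_prod']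
    simp only [ENNReal.tsum_mul_left, ENNReal.tsum_mul_right]
    exact mul_le_mul' (hau x) (hbv x)

/-- Only the levels `j' ≥ j - 3` of the coupling product contribute to a wavelet coefficient of level
`j`. -/
theorem enorm_duhamelIntegrand_waveletAt_le {Φ : MeyerProfile} {p m' m K b : ℝ}
    {u v : ℝ → 𝓢'(Space n, ℂ)} (hB : CouplingBound Φ p m' m K u v) (hp : 1 < p) (hm : 1 ≤ m)
    (hb : 0 < b) (hb' : b ≤ 1 - 2 * m') (hba : 2 * b < n / p)
    {P : Space n → ℂ} (hP : IsFirstOrder P) {js : ℤ} {s t : ℝ} (hs : s ∈ timeRing js)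
    (hst : s < t) (ε : Direction n) (j : ℤ) (k : Fin n → ℤ) :
    ‖duhamelIntegrand Φ P u v (waveletAt Φ ε j k) t s‖ₑ ≤
      ∑' i : ℕ, ∫⁻ x, productMajorant Φ u v (j - 3 + i) js x *
        ‖transposeMultiplier (fun ξ => heat (t - s) ξ * P ξ) (waveletAt Φ ε j k) x‖ₑ := by
  set T := transposeMultiplier (fun ξ => heat (t - s) ξ * P ξ) (waveletAt Φ ε j k) with hT
  have hTm : Measurable T := measurable_transposeMultiplier hP.measurable _ _
  obtain ⟨κ, -, -, hκ⟩ := transposeMultiplier_norm_le hP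
  have hκ' := hκ (waveletAt Φ ε j k) (t - s) (by linarith)
  have hfin : ∑' j' : ℤ, ∫⁻ x, productMajorant Φ u v j' js x * ‖T x‖ₑ ≠ ⊤ := by
    refine ne_top_of_le_ne_top ?_
      (tsum_lintegral_productMajorant_mul_le hB hp hm hb.le hb' js hκ'.1 hκ'.2)
    exact (ENNReal.mul_lt_top (ENNReal.mul_lt_top (ENNReal.mul_lt_top ENNReal.ofNat_lt_top
      ENNReal.ofReal_lt_top) (levelSum_lt_top hb hba)) ENNReal.ofReal_lt_top).ne
  have hle : ∀ j' : ℤ, ∫⁻ x, ‖Qproj Φ j' (u s) x * Qproj Φ j' (v s) x * T x‖ₑ ≤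
      ∫⁻ x, productMajorant Φ u v j' js x * ‖T x‖ₑ := fun j' => lintegral_mono fun x => by
    rw [enorm_mul, enorm_mul]
    exact mul_le_mul_left (mul_le_mul' (enorm_Qproj_le_majorant Φ u j' hs x)
      (enorm_Qproj_le_majorant Φ v j' hs x)) _
  have hQm : ∀ j', Measurable fun x => Qproj Φ j' (u s) x * Qproj Φ j' (v s) x * T x := fun j' =>
    ((measurable_Qproj Φ j' _).mul (measurable_Qproj Φ j' _)).mul hTm
  have hsum : duhamelIntegrand Φ P u v (waveletAt Φ ε j k) t s =
      ∑' j' : ℤ, ∫ x, Qproj Φ j' (u s) x * Qproj Φ j' (v s) x * T x := by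
    rw [← integral_tsum fun j' => (hQm j').aestronglyMeasurable]
    · simp only [duhamelIntegrand, multiplierPairing, couplingProduct, tsum_mul_right, ← hT]
    · exact ne_top_of_le_ne_top hfin (ENNReal.tsum_le_tsum hle)
  have hinj : Function.Injective fun i : ℕ => j - 3 + (i : ℤ) := fun i i' h => by
    simpa using h
  have hsupp : Function.support (fun j' : ℤ =>
      ∫ x, Qproj Φ j' (u s) x * Qproj Φ j' (v s) x * T x) ⊆ Set.range fun i : ℕ => j - 3 + (i : ℤ) := by
    intro j' hj'
    by_contra hcon
    refine hj' (integral_Qproj_mul_eq_zero hP hs (hB.left j' js) (hB.right j' js) ?_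
      (sub_nonneg.2 hst.le) ε k (ENNReal.ne_top_of_tsum_ne_top hfin j'))
    by_contra hlt
    exact hcon ⟨(j' - (j - 3)).toNat, by
      simp only
      rw [Int.toNat_of_nonneg (by omega)]
      ring⟩
  rw [hsum, ← hinj.tsum_eq hsupp]
  exact (enorm_tsum_le _ _).trans (ENNReal.tsum_le_tsum fun i =>
    (enorm_integral_le_lintegral_enorm _).trans (hle _))

/-! ### Time integrals of the heat decay factor -/

/-- The factor by which the heat flow at frequency `2^j` damps the contribution of the ring
`j_t + r` to times in the ring `j_t`, `d = j - j_t`. For `r ≤ 1` the ring is not separated from `t`,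
which leaves only the gain from integrating the decay in time. -/
def heatGain (M : ℕ) (d : ℤ) (r : ℕ) : ℝ :=
  if r ≤ 1 then min 1 (2 ^ (-(2 * (d : ℝ)))) else min 1 (2 ^ (-(2 * M * (d : ℝ))))

theorem heatGain_pos (M : ℕ) (d : ℤ) (r : ℕ) : 0 < heatGain M d r := by
  unfold heatGain
  split_ifs <;> exact lt_min one_pos (Real.rpow_pos_of_pos two_pos _)

theorem lintegral_Ioo_one_add_sq_inv_le {c t : ℝ} (hc : 0 < c) (ht : 0 < t) :
    ∫⁻ s in Set.Ioo 0 t, ENNReal.ofReal (((1 + c * (t - s)) ^ 2)⁻¹) ≤ ENNReal.ofReal c⁻¹ := by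
  have hpos : ∀ s ∈ Set.Icc 0 t, 0 < 1 + c * (t - s) := fun s hs => by
    have := mul_nonneg hc.le (sub_nonneg.2 hs.2)
    linarith
  have hd : ∀ s ∈ Set.uIcc 0 t, HasDerivAt (fun s => c⁻¹ * (1 + c * (t - s))⁻¹)
      (((1 + c * (t - s)) ^ 2)⁻¹) s := by
    intro s hs
    rw [Set.uIcc_of_le ht.le] at hs
    have h1 : HasDerivAt (fun s => 1 + c * (t - s)) (-c) s := by
      have := (((hasDerivAt_id s).const_sub t).const_mul c).const_add 1
      simpa using this
    have h2 := (h1.inv (hpos s hs).ne').const_mul c⁻¹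
    refine h2.congr_deriv ?_
    rw [neg_neg, ← mul_div_assoc, inv_mul_cancel₀ hc.ne', one_div]
  have hcont : ContinuousOn (fun s => ((1 + c * (t - s)) ^ 2)⁻¹) (Set.Icc 0 t) := by
    refine ContinuousOn.inv₀ (by fun_prop) fun s hs => (pow_pos (hpos s hs) 2).ne'
  have hint : IntervalIntegrable (fun s => ((1 + c * (t - s)) ^ 2)⁻¹) volume 0 t := by
    refine ContinuousOn.intervalIntegrable ?_
    rwa [Set.uIcc_of_le ht.le]
  have hftc := intervalIntegral.integral_eq_sub_of_hasDerivAt hd hint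
  rw [← ofReal_integral_eq_lintegral_ofReal]
  · rw [← integral_Ioc_eq_integral_Ioo, ← intervalIntegral.integral_of_le ht.le, hftc]
    refine ENNReal.ofReal_le_ofReal ?_
    have h0 : 0 < 1 + c * (t - 0) := hpos 0 ⟨le_rfl, ht.le⟩
    have : 0 ≤ c⁻¹ * (1 + c * (t - 0))⁻¹ := by positivity
    simp only [sub_self, mul_zero, add_zero, inv_one, mul_one]
    linarith
  · exact (intervalIntegrable_iff_integrableOn_Ioo_of_le ht.le).1 hint
  · exact Filter.Eventually.of_forall fun s => by positivity

/-- A constant for the time integrals of the heat decay factor. -/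
def heatConst (M : ℕ) : ℝ := 4 * (4 / 3) ^ M

theorem heatConst_pos (M : ℕ) : 0 < heatConst M := by
  unfold heatConst
  positivity

/-- For `r ≥ 2` all times `s` of the ring `j_t + r` satisfy `t - s ≥ (3/4) 4^{-j_t}`; for `r ≤ 1` the
integral of `(1 + 4^j (t - s))^{-2}` over all `s < t` is at most `4^{-j}`. -/
theorem lintegral_heat_factor_le {M : ℕ} (hM : 2 ≤ M) (j jt : ℤ) (r : ℕ) {t : ℝ}
    (ht : t ∈ timeRing jt) :
    ∫⁻ s in timeRing (jt + r) ∩ Set.Iio t,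
      ENNReal.ofReal (((1 + ((2 : ℝ) ^ j) ^ 2 * (t - s)) ^ M)⁻¹) ≤
      ENNReal.ofReal (heatConst M * 2 ^ (-(2 * ((jt + r : ℤ) : ℝ))) * heatGain M (j - jt) r) := by
  have hH : 1 ≤ (4 / 3 : ℝ) ^ M := one_le_pow₀ (by norm_num)
  have hms : MeasurableSet (timeRing (jt + r) ∩ Set.Iio t) := measurableSet_Ico.inter measurableSet_Iio
  have hc : (0 : ℝ) < ((2 : ℝ) ^ j) ^ 2 := by positivity
  have hV : (0 : ℝ) < 2 ^ (-(2 * ((jt + r : ℤ) : ℝ))) := Real.rpow_pos_of_pos two_pos _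
  set V : ℝ := 2 ^ (-(2 * ((jt + r : ℤ) : ℝ))) with hVdef
  have ht0 := pos_of_mem_timeRing ht
  -- a bound of the integrand on the ring gives a bound of the integral
  have hbd : ∀ B : ℝ, 0 ≤ B → (∀ s ∈ timeRing (jt + r) ∩ Set.Iio t,
      ((1 + ((2 : ℝ) ^ j) ^ 2 * (t - s)) ^ M)⁻¹ ≤ B) →
      ∫⁻ s in timeRing (jt + r) ∩ Set.Iio t,
        ENNReal.ofReal (((1 + ((2 : ℝ) ^ j) ^ 2 * (t - s)) ^ M)⁻¹) ≤
      ENNReal.ofReal (3 * V * B) := by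
    intro B hB h
    calc _ ≤ ∫⁻ s in timeRing (jt + r) ∩ Set.Iio t, ENNReal.ofReal B :=
          setLIntegral_mono' hms fun s hs => ENNReal.ofReal_le_ofReal (h s hs)
      _ ≤ ENNReal.ofReal B * volume (timeRing (jt + r)) := by
          rw [setLIntegral_const]
          gcongr
          exact Set.inter_subset_left
      _ = _ := by
          rw [volume_timeRing, ← ENNReal.ofReal_mul hB]
          congr 1
          ring
  have hone : ∀ s ∈ timeRing (jt + r) ∩ Set.Iio t,
      ((1 + ((2 : ℝ) ^ j) ^ 2 * (t - s)) ^ M)⁻¹ ≤ 1 := by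
    intro s hs
    have h1 : 0 ≤ ((2 : ℝ) ^ j) ^ 2 * (t - s) := mul_nonneg hc.le (sub_nonneg.2 (le_of_lt hs.2))
    exact inv_le_one_of_one_le₀ (one_le_pow₀ (by linarith))
  have htriv := (hbd 1 zero_le_one hone).trans (ENNReal.ofReal_le_ofReal
    (show 3 * V * 1 ≤ heatConst M * V * 1 by
      unfold heatConst
      nlinarith))
  have hj2 : ((2 : ℝ) ^ j) ^ 2 = 2 ^ (2 * (j : ℝ)) := by
    rw [← Real.rpow_intCast, ← Real.rpow_natCast, ← Real.rpow_mul two_pos.le]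
    congr 1
    push_cast
    ring
  unfold heatGain
  split_ifs with hr
  · rcases le_total 1 ((2 : ℝ) ^ (-(2 * ((j - jt : ℤ) : ℝ)))) with h | h
    · rw [min_eq_left h]
      exact htriv
    · rw [min_eq_right h]
      calc _ ≤ ∫⁻ s in Set.Ioo 0 t, ENNReal.ofReal (((1 + ((2 : ℝ) ^ j) ^ 2 * (t - s)) ^ M)⁻¹) :=
            lintegral_mono_set fun s hs => ⟨pos_of_mem_timeRing hs.1, hs.2⟩
        _ ≤ ∫⁻ s in Set.Ioo 0 t, ENNReal.ofReal (((1 + ((2 : ℝ) ^ j) ^ 2 * (t - s)) ^ 2)⁻¹) := by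
            refine setLIntegral_mono' measurableSet_Ioo fun s hs => ENNReal.ofReal_le_ofReal ?_
            have h1 : 0 ≤ ((2 : ℝ) ^ j) ^ 2 * (t - s) :=
              mul_nonneg hc.le (sub_nonneg.2 hs.2.le)
            exact inv_anti₀ (by positivity) (pow_le_pow_right₀ (by linarith) hM)
        _ ≤ ENNReal.ofReal (((2 : ℝ) ^ j) ^ 2)⁻¹ := lintegral_Ioo_one_add_sq_inv_le hc ht0
        _ ≤ _ := by
            refine ENNReal.ofReal_le_ofReal ?_
            have e1 : (((2 : ℝ) ^ j) ^ 2)⁻¹ = V * 2 ^ (-(2 * ((j - jt : ℤ) : ℝ))) * 2 ^ (2 * (r : ℝ)) := by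
              rw [hj2, ← Real.rpow_neg two_pos.le, hVdef, ← Real.rpow_add two_pos,
                ← Real.rpow_add two_pos]
              congr 1
              push_cast
              ring
            have e2 : (2 : ℝ) ^ (2 * (r : ℝ)) ≤ 4 := by
              have hr' : (r : ℝ) ≤ 1 := by exact_mod_cast hr
              calc (2 : ℝ) ^ (2 * (r : ℝ)) ≤ 2 ^ (2 : ℝ) :=
                    Real.rpow_le_rpow_of_exponent_le one_le_two (by linarith)
                _ = 4 := by norm_num
            rw [e1]
            have hD : (0 : ℝ) < 2 ^ (-(2 * ((j - jt : ℤ) : ℝ))) := Real.rpow_pos_of_pos two_pos _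
            calc _ ≤ V * 2 ^ (-(2 * ((j - jt : ℤ) : ℝ))) * 4 := by gcongr
              _ ≤ V * 2 ^ (-(2 * ((j - jt : ℤ) : ℝ))) * heatConst M := by
                  gcongr
                  unfold heatConst
                  linarith
              _ = _ := by ring
  · rcases le_total 1 ((2 : ℝ) ^ (-(2 * M * ((j - jt : ℤ) : ℝ)))) with h | h
    · rw [min_eq_left h]
      exact htriv
    · rw [min_eq_right h]
      have hD : (0 : ℝ) < 2 ^ (-(2 * M * ((j - jt : ℤ) : ℝ))) := Real.rpow_pos_of_pos two_pos _
      refine (hbd ((4 / 3) ^ M * 2 ^ (-(2 * M * ((j - jt : ℤ) : ℝ)))) (by positivity) ?_).trans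
        (ENNReal.ofReal_le_ofReal ?_)
      · intro s hs
        have hs2 : s < (2 : ℝ) ^ (-(2 : ℤ)) * 2 ^ (-2 * jt) := by
          refine hs.1.2.trans_le ?_
          rw [← zpow_add₀ two_ne_zero]
          exact zpow_le_zpow_right₀ one_le_two (by omega)
        have hts : 3 / 4 * (2 : ℝ) ^ (-2 * jt) ≤ t - s := by
          have h1 := ht.1
          norm_num at hs2 h1 ⊢
          linarith
        have hx : 3 / 4 * (2 : ℝ) ^ (2 * ((j - jt : ℤ) : ℝ)) ≤ 1 + ((2 : ℝ) ^ j) ^ 2 * (t - s) := by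
          have e1 : (2 : ℝ) ^ (2 * ((j - jt : ℤ) : ℝ)) = ((2 : ℝ) ^ j) ^ 2 * 2 ^ (-2 * jt) := by
            rw [hj2, ← Real.rpow_intCast 2 (-2 * jt), ← Real.rpow_add two_pos]
            congr 1
            push_cast
            ring
          rw [e1]
          nlinarith
        have hD' : (0 : ℝ) < 2 ^ (2 * ((j - jt : ℤ) : ℝ)) := Real.rpow_pos_of_pos two_pos _
        calc ((1 + ((2 : ℝ) ^ j) ^ 2 * (t - s)) ^ M)⁻¹
            ≤ ((3 / 4 * (2 : ℝ) ^ (2 * ((j - jt : ℤ) : ℝ))) ^ M)⁻¹ :=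
              inv_anti₀ (by positivity) (pow_le_pow_left₀ (by positivity) hx M)
          _ = (4 / 3) ^ M * 2 ^ (-(2 * M * ((j - jt : ℤ) : ℝ))) := by
              rw [mul_pow, mul_inv, ← inv_pow, ← Real.rpow_natCast (2 ^ _) M,
                ← Real.rpow_mul two_pos.le, ← Real.rpow_neg two_pos.le]
              norm_num
              ring_nf
      · unfold heatConst
        have : 0 < (4 / 3 : ℝ) ^ M * V * 2 ^ (-(2 * M * ((j - jt : ℤ) : ℝ))) := by positivity
        nlinarith

/-! ### The flow norm of the coupling flow -/

theorem norm_le_of_cubeIndicator_ne_zero {x : Space n} (h : cubeIndicator x ≠ 0) : ‖x‖ ≤ n := by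
  have hx : x ∈ {y : Space n | ∀ i, 0 ≤ y i ∧ y i ≤ 1} := Set.mem_of_indicator_ne_zero h
  have hx' : ∀ i, 0 ≤ x i ∧ x i ≤ 1 := hx
  exact norm_le_of_abs_le_one fun i => abs_le.2 ⟨by linarith [(hx' i).1], (hx' i).2⟩

theorem cubeIndicator_le_one (x : Space n) : cubeIndicator x ≤ 1 :=
  Set.indicator_apply_le' (fun _ => le_rfl) fun _ => zero_le

theorem tsum_cubeIndicator_le (w : Space n) :
    ∑' k : Fin n → ℤ, cubeIndicator (w - latticePoint k) ≤
      ENNReal.ofReal (cubeConst n * latticeConst n) := by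
  rw [ENNReal.ofReal_mul (cubeConst_pos n).le]
  refine le_trans ?_ (mul_le_mul_right (tsum_weight_le w) _)
  rw [← ENNReal.tsum_mul_left]
  refine ENNReal.tsum_le_tsum fun k => ?_
  by_cases h : cubeIndicator (w - latticePoint k) = 0
  · rw [h]
    exact zero_le
  · refine (cubeIndicator_le_one _).trans ?_
    rw [← ENNReal.ofReal_mul (cubeConst_pos n).le, ← ENNReal.ofReal_one]
    refine ENNReal.ofReal_le_ofReal ?_
    have h1 : ‖(0 : Space n) - (w - latticePoint k)‖ ≤ n := by
      rw [zero_sub, norm_neg]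
      exact norm_le_of_cubeIndicator_ne_zero h
    have h2 := weight_le_of_norm_sub_le h1
    simpa [weight] using h2

/-- The convolution bound for the contributions of all the earlier time rings to the ring `jt`. -/
def flowEnvelope (Φ : MeyerProfile) (u v : ℝ → 𝓢'(Space n, ℂ)) (M : ℕ) (j jt : ℤ) (y : Space n) :
    ℝ≥0∞ :=
  ∑' r : ℕ, ENNReal.ofReal
      (heatConst M * 2 ^ (-(2 * ((jt + r : ℤ) : ℝ))) * heatGain M (j - jt) r) *
    ∑' i : ℕ, ∫⁻ x, productMajorant Φ u v (j - 3 + i) (jt + r) x *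
      ENNReal.ofReal (weight ((2 : ℝ) ^ j • (y - x)))

theorem measurable_conv {D : Space n → ℝ≥0∞} (hD : Measurable D) (j : ℤ) :
    Measurable fun y : Space n => ∫⁻ x, D x * ENNReal.ofReal (weight ((2 : ℝ) ^ j • (y - x))) := by
  refine Measurable.lintegral_prod_right' (f := fun z : Space n × Space n =>
    D z.2 * ENNReal.ofReal (weight ((2 : ℝ) ^ j • (z.1 - z.2)))) ?_
  exact (hD.comp measurable_snd).mul (measurable_weight.comp (by fun_prop)).ennreal_ofReal

theorem measurable_flowEnvelope (Φ : MeyerProfile) (u v : ℝ → 𝓢'(Space n, ℂ)) (M : ℕ) (j jt : ℤ) :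
    Measurable (flowEnvelope Φ u v M j jt) :=
  Measurable.tsum fun _ => (Measurable.tsum fun _ =>
    measurable_conv (measurable_productMajorant Φ u v _ _) j).const_mul _

/-- The bound of a wavelet coefficient of the coupling flow obtained by inserting the kernel
estimate into Duhamel's formula. -/
theorem exists_enorm_coeff_le {Φ : MeyerProfile} {p m' m K b : ℝ}
    {u v F : ℝ → 𝓢'(Space n, ℂ)} (hB : CouplingBound Φ p m' m K u v) (hp : 1 < p) (hm : 1 ≤ m)
    (hb : 0 < b) (hb' : b ≤ 1 - 2 * m') (hba : 2 * b < n / p)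
    {P : Space n → ℂ} (hP : IsFirstOrder P)
    (hF : IsCouplingFlow Φ (fun τ ξ => heat τ ξ * P ξ) u v F) {M : ℕ} (hM : 2 ≤ M) :
    ∃ C : ℝ, 0 ≤ C ∧ ∀ (ε : Direction n) (j jt : ℤ) (k : Fin n → ℤ), ∀ t ∈ timeRing jt,
      ‖coeff Φ (F t) ε j k‖ₑ ≤ ENNReal.ofReal (C * amp n j * 2 ^ j) *
        ∑' r : ℕ, ENNReal.ofReal
            (heatConst M * 2 ^ (-(2 * ((jt + r : ℤ) : ℝ))) * heatGain M (j - jt) r) *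
          ∑' i : ℕ, ∫⁻ x, productMajorant Φ u v (j - 3 + i) (jt + r) x *
            ENNReal.ofReal (weight ((2 : ℝ) ^ j • x - latticePoint k)) := by
  obtain ⟨C, hC0, hC⟩ := norm_transposeMultiplier_waveletAt_le hP Φ M
  refine ⟨C, hC0, fun ε j jt k t ht => ?_⟩
  have ht0 := pos_of_mem_timeRing ht
  have hamp := amp_pos n j
  have hcoeff : coeff Φ (F t) ε j k =
      ∫ s in Set.Ioo 0 t, duhamelIntegrand Φ P u v (waveletAt Φ ε j k) t s := by
    rw [coeff, hF.pairing_eq t ht0, intervalIntegral.integral_of_le ht0.le,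
      integral_Ioc_eq_integral_Ioo]
    rfl
  rw [hcoeff, ← ENNReal.tsum_mul_left]
  refine (enorm_integral_le_lintegral_enorm _).trans
    ((setLIntegral_le_tsum_timeRing ht _).trans (ENNReal.tsum_le_tsum fun r => ?_))
  set S : ℝ≥0∞ := ∑' i : ℕ, ∫⁻ x, productMajorant Φ u v (j - 3 + i) (jt + r) x *
    ENNReal.ofReal (weight ((2 : ℝ) ^ j • x - latticePoint k)) with hS
  have hpt : ∀ s ∈ timeRing (jt + r) ∩ Set.Iio t,
      ‖duhamelIntegrand Φ P u v (waveletAt Φ ε j k) t s‖ₑ ≤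
        ENNReal.ofReal (C * amp n j * 2 ^ j) *
          ENNReal.ofReal (((1 + ((2 : ℝ) ^ j) ^ 2 * (t - s)) ^ M)⁻¹) * S := by
    intro s hs
    have hst : 0 ≤ t - s := sub_nonneg.2 (le_of_lt hs.2)
    refine (enorm_duhamelIntegrand_waveletAt_le hB hp hm hb hb' hba hP hs.1 hs.2 ε j k).trans ?_
    rw [hS, ← ENNReal.tsum_mul_left]
    refine ENNReal.tsum_le_tsum fun i => ?_
    rw [← lintegral_const_mul' _ _ (ENNReal.mul_ne_top ENNReal.ofReal_ne_top ENNReal.ofReal_ne_top)]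
    refine lintegral_mono fun x => ?_
    rw [mul_left_comm]
    refine mul_le_mul_right ?_ _
    have h1 : 0 ≤ C * amp n j * 2 ^ j := by positivity
    have h2 : 0 ≤ ((1 + ((2 : ℝ) ^ j) ^ 2 * (t - s)) ^ M)⁻¹ := by positivity
    rw [← ENNReal.ofReal_mul h1, ← ENNReal.ofReal_mul (mul_nonneg h1 h2), ← ofReal_norm]
    exact ENNReal.ofReal_le_ofReal (hC ε j k (t - s) hst x)
  calc _ ≤ ∫⁻ s in timeRing (jt + r) ∩ Set.Iio t, ENNReal.ofReal (C * amp n j * 2 ^ j) *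
          ENNReal.ofReal (((1 + ((2 : ℝ) ^ j) ^ 2 * (t - s)) ^ M)⁻¹) * S :=
        setLIntegral_mono' (measurableSet_Ico.inter measurableSet_Iio) hpt
    _ = ENNReal.ofReal (C * amp n j * 2 ^ j) * (∫⁻ s in timeRing (jt + r) ∩ Set.Iio t,
          ENNReal.ofReal (((1 + ((2 : ℝ) ^ j) ^ 2 * (t - s)) ^ M)⁻¹)) * S := by
        have hmeas : Measurable fun s : ℝ =>
            ENNReal.ofReal (((1 + ((2 : ℝ) ^ j) ^ 2 * (t - s)) ^ M)⁻¹) := by fun_prop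
        rw [lintegral_mul_const _ (hmeas.const_mul _), lintegral_const_mul _ hmeas]
    _ ≤ _ := by
        rw [mul_assoc]
        refine mul_le_mul_right (mul_le_mul_left ?_ S) _
        exact lintegral_heat_factor_le hM j jt r ht

/-- For `y` in the cube of index `(j, k)` the weight centred at `k` is comparable to the one centred at
`2^j y`, which removes the sum over `k`. -/
theorem exists_ringFun_le {Φ : MeyerProfile} {p m' m K b : ℝ}
    {u v F : ℝ → 𝓢'(Space n, ℂ)} (hB : CouplingBound Φ p m' m K u v) (hp : 1 < p) (hm : 1 ≤ m)
    (hb : 0 < b) (hb' : b ≤ 1 - 2 * m') (hba : 2 * b < n / p)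
    {P : Space n → ℂ} (hP : IsFirstOrder P)
    (hF : IsCouplingFlow Φ (fun τ ξ => heat τ ξ * P ξ) u v F) {M : ℕ} (hM : 2 ≤ M) :
    ∃ C : ℝ, 0 ≤ C ∧ ∀ (j jt : ℤ) (y : Space n),
      ringFun Φ F j jt y ≤ ENNReal.ofReal (C * ((2 : ℝ) ^ j) ^ n * 2 ^ j) *
        flowEnvelope Φ u v M j jt y := by
  obtain ⟨C, hC0, hC⟩ := exists_enorm_coeff_le hB hp hm hb hb' hba hP hF hM
  have hlc : 0 ≤ latticeConst n := mul_nonneg (cubeConst_pos n).le ENNReal.toReal_nonneg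
  have hcc := cubeConst_pos n
  set N : ℝ := ((Fintype.card (Direction n) : ℕ) : ℝ) with hN
  have hN0 : 0 ≤ N := Nat.cast_nonneg _
  refine ⟨N * (cubeConst n * latticeConst n) * (C * cubeConst n), by positivity,
    fun j jt y => iSup₂_le fun t ht => ?_⟩
  have hamp := amp_pos n j
  set E := flowEnvelope Φ u v M j jt y with hE
  have hterm : ∀ (ε : Direction n) (k : Fin n → ℤ),
      ‖coeff Φ (F t) ε j k‖ₑ * cubeIndicator ((2 : ℝ) ^ j • y - latticePoint k) ≤
        ENNReal.ofReal (C * amp n j * 2 ^ j) * ENNReal.ofReal (cubeConst n) * E *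
          cubeIndicator ((2 : ℝ) ^ j • y - latticePoint k) := by
    intro ε k
    by_cases h : cubeIndicator ((2 : ℝ) ^ j • y - latticePoint k) = 0
    · rw [h, mul_zero]
      exact zero_le
    · refine mul_le_mul_left ((hC ε j jt k t ht).trans ?_) _
      rw [mul_assoc (ENNReal.ofReal (C * amp n j * 2 ^ j))]
      refine mul_le_mul_right ?_ _
      rw [hE, flowEnvelope, ← ENNReal.tsum_mul_left]
      refine ENNReal.tsum_le_tsum fun r => ?_
      rw [mul_left_comm]
      refine mul_le_mul_right ?_ _
      rw [← ENNReal.tsum_mul_left]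
      refine ENNReal.tsum_le_tsum fun i => ?_
      rw [← lintegral_const_mul' _ _ ENNReal.ofReal_ne_top]
      refine lintegral_mono fun x => ?_
      rw [mul_left_comm, ← ENNReal.ofReal_mul hcc.le]
      refine mul_le_mul' le_rfl (ENNReal.ofReal_le_ofReal ?_)
      have h1 : weight ((2 : ℝ) ^ j • (y - x)) = weight ((2 : ℝ) ^ j • (x - y)) := by
        rw [weight, weight, ← neg_sub, smul_neg, norm_neg]
      rw [h1]
      refine weight_le_of_norm_sub_le ?_
      have h2 : (2 : ℝ) ^ j • x - latticePoint k - (2 : ℝ) ^ j • (x - y) =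
          (2 : ℝ) ^ j • y - latticePoint k := by
        rw [smul_sub]
        abel
      rw [h2]
      exact norm_le_of_cubeIndicator_ne_zero h
  calc levelFun Φ F j t y
      ≤ ENNReal.ofReal (amp n j) * ∑ _ε : Direction n,
          (ENNReal.ofReal (C * amp n j * 2 ^ j) * ENNReal.ofReal (cubeConst n) * E *
            ENNReal.ofReal (cubeConst n * latticeConst n)) := by
        refine mul_le_mul_right (Finset.sum_le_sum fun ε _ => ?_) _
        refine (ENNReal.tsum_le_tsum (hterm ε)).trans ?_
        rw [ENNReal.tsum_mul_left]
        exact mul_le_mul_right (tsum_cubeIndicator_le _) _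
    _ = ENNReal.ofReal (N * (cubeConst n * latticeConst n) * (C * cubeConst n) *
          (amp n j * amp n j) * 2 ^ j) * E := by
        rw [Finset.sum_const, Finset.card_univ, nsmul_eq_mul, ← ENNReal.ofReal_natCast, ← hN]
        rw [show N * (cubeConst n * latticeConst n) * (C * cubeConst n) *
          (amp n j * amp n j) * 2 ^ j = amp n j * (N * ((C * amp n j * 2 ^ j) * cubeConst n *
            (cubeConst n * latticeConst n))) by ring]
        have hX : 0 ≤ C * amp n j * 2 ^ j := by positivity
        generalize C * amp n j * 2 ^ j = X at hX ⊢
        generalize cubeConst n * latticeConst n = L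
        rw [ENNReal.ofReal_mul hamp.le, ENNReal.ofReal_mul hN0,
          ENNReal.ofReal_mul (mul_nonneg hX hcc.le), ENNReal.ofReal_mul hX]
        ring
    _ = _ := by rw [amp_sq]

/-- The sum which remains of the norm of the coupling flow once all the scaling has been taken out,
as a function of `d = j - j_t`. -/
def residualSum (m' m a : ℝ) (M : ℕ) (d : ℤ) : ℝ≥0∞ :=
  ∑' r : ℕ, ENNReal.ofReal (heatGain M d r) *
    ∑' i : ℕ, ENNReal.ofReal (couplingWeight m' m (d - 3 + i - r) * 2 ^ (-(((i : ℝ) - 3) * a)))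

/-- Young's inequality applied to each term of the envelope; the powers of `j_t + r` cancel. -/
theorem avgNorm_flowEnvelope_le {Φ : MeyerProfile} {p m' m K : ℝ}
    {u v : ℝ → 𝓢'(Space n, ℂ)} (hB : CouplingBound Φ p m' m K u v) (M : ℕ) (j jt : ℤ) :
    avgNorm p (flowEnvelope Φ u v M j jt) ≤
      ENNReal.ofReal ((((2 : ℝ) ^ j) ^ n)⁻¹ *
        (∫⁻ x : Space n, ENNReal.ofReal (weight x)).toReal *
          (heatConst M * K) * 2 ^ (-((j : ℝ) * (n / p)))) *
        residualSum m' m (n / p) M (j - jt) := by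
  set w : ℝ := (∫⁻ x : Space n, ENNReal.ofReal (weight x)).toReal with hw
  have hwe : ∫⁻ x : Space n, ENNReal.ofReal (weight x) = ENNReal.ofReal w :=
    (ENNReal.ofReal_toReal lintegral_weight_lt_top.ne).symm
  have hw0 : 0 ≤ w := ENNReal.toReal_nonneg
  have hK := hB.pos
  have hH := heatConst_pos M
  have h2j : (0 : ℝ) < 2 ^ j := by positivity
  have hDm := measurable_productMajorant Φ u v
  have hκm : Measurable fun z : Space n => ENNReal.ofReal (weight ((2 : ℝ) ^ j • z)) :=
    (measurable_weight.comp (by fun_prop)).ennreal_ofReal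
  unfold flowEnvelope residualSum
  refine (avgNorm_tsum_le fun r => (Measurable.tsum fun i =>
    measurable_conv (hDm _ _) j).const_mul _).trans ?_
  rw [← ENNReal.tsum_mul_left]
  refine ENNReal.tsum_le_tsum fun r => ?_
  have hg := heatGain_pos M (j - jt) r
  refine (avgNorm_const_mul_le _ (Measurable.tsum fun i => measurable_conv (hDm _ _) j)).trans ?_
  refine (mul_le_mul_right (avgNorm_tsum_le fun i => measurable_conv (hDm _ _) j) _).trans ?_
  rw [← ENNReal.tsum_mul_left, ← ENNReal.tsum_mul_left, ← ENNReal.tsum_mul_left]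
  refine ENNReal.tsum_le_tsum fun i => ?_
  have hconv := avgNorm_convolution_le (p := p) (hDm (j - 3 + i) (jt + r)) hκm
  rw [lintegral_comp_smul h2j (fun z => ENNReal.ofReal (weight z)), hwe] at hconv
  refine (mul_le_mul_right (hconv.trans (mul_le_mul_right (hB.avg _ _) _)) _).trans (le_of_eq ?_)
  have hω := couplingWeight_pos m' m (j - jt - 3 + i - r)
  rw [show j - 3 + (i : ℤ) - (jt + r) = j - jt - 3 + i - r by ring]
  rw [← ENNReal.ofReal_mul (by positivity), ← ENNReal.ofReal_mul (by positivity),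
    ← ENNReal.ofReal_mul (by positivity), ← ENNReal.ofReal_mul (by positivity),
    ← ENNReal.ofReal_mul (by positivity)]
  congr 1
  set W := couplingWeight m' m (j - jt - 3 + i - r)
  set G := heatGain M (j - jt) r
  have e1 : (2 : ℝ) ^ (-(2 * ((jt + r : ℤ) : ℝ))) * 2 ^ (2 * ((jt + r : ℤ) : ℝ)) = 1 := by
    rw [← Real.rpow_add two_pos, neg_add_cancel, Real.rpow_zero]
  have e2 : (2 : ℝ) ^ (-(((j - 3 + i : ℤ) : ℝ) * (n / p))) =
      2 ^ (-((j : ℝ) * (n / p))) * 2 ^ (-(((i : ℝ) - 3) * (n / p))) := by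
    rw [← Real.rpow_add two_pos]
    congr 1
    push_cast
    ring
  rw [e2]
  linear_combination (heatConst M * G * ((((2 : ℝ) ^ j) ^ n)⁻¹ * w) * K * W *
    (2 ^ (-((j : ℝ) * (n / p))) * 2 ^ (-(((i : ℝ) - 3) * (n / p))))) * e1

/-- Termwise bound of `residualSum`. The growth bound of `couplingWeight` serves for `d < 0`, and for
`r ≥ 2`, where the heat decay is strong. For `d ≥ 0` and `r ≤ 1` the heat decay gains only `4^{-d}`,
and the rest comes from the decay of `couplingWeight`. -/
theorem heatGain_mul_couplingWeight_le {m' m a b : ℝ} (hm'0 : 0 ≤ m') (hm : 1 ≤ m) (hb : 0 < b)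
    (hb2 : b ≤ 1 / 2) (hb' : b ≤ 1 - 2 * m') {M : ℕ} (hM : m + 1 ≤ M) (d : ℤ) (r i : ℕ) :
    heatGain M d r * (couplingWeight m' m (d - 3 + i - r) * 2 ^ (-(((i : ℝ) - 3) * a))) ≤
      2 ^ (3 * a + 8 * (2 * m - 1) + 2 * b) *
          2 ^ (-(2 * b) * |(d : ℝ)| - 2 * d * flowOrder m' m d) *
        2 ^ (-(2 * b) * (r : ℝ)) * 2 ^ (-(a - 2 * b) * (i : ℝ)) := by
  have key : ∀ h w : ℝ, heatGain M d r ≤ 2 ^ h → couplingWeight m' m (d - 3 + i - r) ≤ 2 ^ w →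
      h + w - ((i : ℝ) - 3) * a ≤ 3 * a + 8 * (2 * m - 1) + 2 * b +
        (-(2 * b) * |(d : ℝ)| - 2 * d * flowOrder m' m d) + -(2 * b) * (r : ℝ) +
          -(a - 2 * b) * (i : ℝ) →
      heatGain M d r * (couplingWeight m' m (d - 3 + i - r) * 2 ^ (-(((i : ℝ) - 3) * a))) ≤
      2 ^ (3 * a + 8 * (2 * m - 1) + 2 * b) *
          2 ^ (-(2 * b) * |(d : ℝ)| - 2 * d * flowOrder m' m d) *
        2 ^ (-(2 * b) * (r : ℝ)) * 2 ^ (-(a - 2 * b) * (i : ℝ)) := by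
    intro h w hh hw hle
    rw [← Real.rpow_add two_pos, ← Real.rpow_add two_pos, ← Real.rpow_add two_pos]
    calc _ ≤ (2 : ℝ) ^ h * (2 ^ w * 2 ^ (-(((i : ℝ) - 3) * a))) := by
          have := couplingWeight_pos m' m (d - 3 + i - r)
          gcongr
      _ = 2 ^ (h + w - ((i : ℝ) - 3) * a) := by
          rw [← Real.rpow_add two_pos, ← Real.rpow_add two_pos]
          congr 1
          ring
      _ ≤ _ := Real.rpow_le_rpow_of_exponent_le one_le_two hle
  have hgrow := couplingWeight_le_growth hm hb.le hb' (d - 3 + i - r)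
  have hdec := couplingWeight_le_decay hm (show m' ≤ 1 / 2 by linarith) (d - 3 + i - r)
  push_cast at hgrow hdec
  have hi : (0 : ℝ) ≤ i := Nat.cast_nonneg i
  have hr0 : (0 : ℝ) ≤ r := Nat.cast_nonneg r
  by_cases hd : 0 ≤ d
  · have hd' : (0 : ℝ) ≤ d := by exact_mod_cast hd
    have hfo : flowOrder m' m d = m := if_pos hd
    by_cases hr : r ≤ 1
    · have hr' : (r : ℝ) ≤ 1 := by exact_mod_cast hr
      refine key (-(2 * (d : ℝ))) _ ?_ hdec ?_
      · rw [heatGain, if_pos hr]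
        exact min_le_right _ _
      · rw [hfo, abs_of_nonneg hd']
        have h1 : 0 ≤ (2 * m - 2 * b) * (d : ℝ) := mul_nonneg (by linarith) hd'
        have h2 : 0 ≤ (2 * (2 * m - 1) + 2 * b) * (i : ℝ) := mul_nonneg (by linarith) hi
        have h3 : 0 ≤ (2 * (2 * m - 1) + 2 * b) * (1 - (r : ℝ)) :=
          mul_nonneg (by linarith) (by linarith)
        nlinarith [mul_nonneg hb.le hr0]
    · refine key (-(2 * M * (d : ℝ))) _ ?_ hgrow ?_
      · rw [heatGain, if_neg hr]
        exact min_le_right _ _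
      · rw [hfo, abs_of_nonneg hd']
        have h1 : 0 ≤ (2 * M - 2 * m - 4 * b) * (d : ℝ) := mul_nonneg (by linarith) hd'
        nlinarith
  · have hd' : (d : ℝ) ≤ 0 := by exact_mod_cast (not_le.1 hd).le
    have hfo : flowOrder m' m d = m' := if_neg hd
    refine key 0 _ ?_ hgrow ?_
    · rw [heatGain, Real.rpow_zero]
      split_ifs <;> exact min_le_left _ _
    · rw [hfo, abs_of_nonpos hd']
      have h1 : 0 ≤ m' * (-(d : ℝ)) := mul_nonneg hm'0 (by linarith)
      nlinarith

/-- The factor `2^{-2b|d|}` is what remains after division by the weights of the flow norm. -/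
theorem exists_residualSum_le {m' m a b : ℝ} (hm'0 : 0 ≤ m') (hm : 1 ≤ m) (hb : 0 < b)
    (hb2 : b ≤ 1 / 2) (hb' : b ≤ 1 - 2 * m') (hba : 2 * b < a) {M : ℕ} (hM : m + 1 ≤ M) :
    ∃ C : ℝ, 0 ≤ C ∧ ∀ d : ℤ, residualSum m' m a M d ≤
      ENNReal.ofReal (C * 2 ^ (-(2 * b) * |(d : ℝ)| - 2 * d * flowOrder m' m d)) := by
  set S : ℝ≥0∞ := (∑' r : ℕ, ENNReal.ofReal ((2 : ℝ) ^ (-(2 * b) * (r : ℝ)))) *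
    ∑' i : ℕ, ENNReal.ofReal ((2 : ℝ) ^ (-(a - 2 * b) * (i : ℝ))) with hS
  have hSt : S ≠ ⊤ := (ENNReal.mul_lt_top (tsum_two_rpow_neg_nat_lt_top (by linarith))
    (tsum_two_rpow_neg_nat_lt_top (by linarith))).ne
  refine ⟨2 ^ (3 * a + 8 * (2 * m - 1) + 2 * b) * S.toReal, by positivity, fun d => ?_⟩
  rw [mul_right_comm, ENNReal.ofReal_mul (by positivity), ENNReal.ofReal_toReal hSt, hS,
    ← ENNReal.tsum_mul_right, ← ENNReal.tsum_mul_left]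
  refine ENNReal.tsum_le_tsum fun r => ?_
  rw [← mul_assoc, ← ENNReal.tsum_mul_left, ← ENNReal.tsum_mul_left]
  refine ENNReal.tsum_le_tsum fun i => ?_
  rw [← ENNReal.ofReal_mul (heatGain_pos M d r).le, ← ENNReal.ofReal_mul (by positivity),
    ← ENNReal.ofReal_mul (by positivity)]
  exact ENNReal.ofReal_le_ofReal (heatGain_mul_couplingWeight_le hm'0 hm hb hb2 hb' hM d r i)

/-- Geometric decay of the ring norms in `|j - j_t|` suffices for every `q`. -/
theorem flowNorm_lt_top_of_ringNorm_le {Φ : MeyerProfile} {p : ℝ} {q : ℝ≥0∞} (hq : 1 ≤ q)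
    {m' m : ℝ} {f : ℝ → 𝓢'(Space n, ℂ)} {C c : ℝ} (hC : 0 ≤ C) (hc : 0 < c)
    (h : ∀ j jt : ℤ, ringNorm Φ p (flowOrder m' m (j - jt)) f j jt ≤
      ENNReal.ofReal (C * 2 ^ (-c * |((j - jt : ℤ) : ℝ)|))) : flowNorm Φ p q m' m f < ⊤ := by
  have hm : ∀ jt : ℤ, ∀ j : Set.Ici jt, ringNorm Φ p m f j jt ≤
      ENNReal.ofReal (C * 2 ^ (-c * |((j - jt : ℤ) : ℝ)|)) := by
    rintro jt ⟨j, hj⟩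
    have h1 := h j jt
    rwa [flowOrder, if_pos (sub_nonneg.2 hj)] at h1
  have hm' : ∀ jt : ℤ, ∀ j : Set.Iio jt, ringNorm Φ p m' f j jt ≤
      ENNReal.ofReal (C * 2 ^ (-c * |((j - jt : ℤ) : ℝ)|)) := by
    rintro jt ⟨j, hj⟩
    have h1 := h j jt
    rwa [flowOrder, if_neg (not_le.2 (sub_neg.2 hj))] at h1
  unfold flowNorm
  split_ifs with hqt
  · have hle : ∀ j jt : ℤ, ENNReal.ofReal (C * 2 ^ (-c * |((j - jt : ℤ) : ℝ)|)) ≤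
        ENNReal.ofReal C := fun j jt => by
      refine ENNReal.ofReal_le_ofReal (mul_le_of_le_one_right hC ?_)
      refine Real.rpow_le_one_of_one_le_of_nonpos one_le_two ?_
      have := abs_nonneg ((j - jt : ℤ) : ℝ)
      nlinarith
    exact ENNReal.add_lt_top.2
      ⟨(iSup_le fun jt => iSup_le fun j => (hm jt j).trans (hle _ _)).trans_lt ENNReal.ofReal_lt_top,
       (iSup_le fun jt => iSup_le fun j => (hm' jt j).trans (hle _ _)).trans_lt
        ENNReal.ofReal_lt_top⟩
  · have hq0 : 0 < q.toReal := ENNReal.toReal_pos (zero_lt_one.trans_le hq).ne' hqt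
    set g : ℤ → ℝ≥0∞ := fun e => ENNReal.ofReal (C * 2 ^ (-c * |(e : ℝ)|)) ^ q.toReal with hg
    have hge : ∀ e, g e = ENNReal.ofReal (C ^ q.toReal) *
        ENNReal.ofReal (2 ^ (-(c * q.toReal) * |(e : ℝ)|)) := fun e => by
      simp only [hg]
      rw [ENNReal.ofReal_rpow_of_nonneg (by positivity) hq0.le, Real.mul_rpow hC (by positivity),
        ← Real.rpow_mul two_pos.le, ENNReal.ofReal_mul (by positivity)]
      congr 3
      ring
    have hgt : ∑' e, g e < ⊤ := by
      simp_rw [hge]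
      rw [ENNReal.tsum_mul_left]
      exact ENNReal.mul_lt_top ENNReal.ofReal_lt_top
        (tsum_two_rpow_neg_abs_lt_top (mul_pos hc hq0))
    have hsum : ∀ (jt : ℤ) (s : Set ℤ), ∑' j : s, g (j - jt) ≤ ∑' e, g e := fun jt s => by
      refine (ENNReal.tsum_comp_le_tsum_of_injective Subtype.val_injective
        (fun j : ℤ => g (j - jt))).trans (le_of_eq ?_)
      exact (Equiv.subRight jt).tsum_eq g
    refine lt_of_le_of_lt (iSup_le fun jt => add_le_add ?_ ?_) (ENNReal.add_lt_top.2 ⟨hgt, hgt⟩)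
    · refine le_trans (ENNReal.tsum_le_tsum fun j => ?_) (hsum jt (Set.Ici jt))
      exact ENNReal.rpow_le_rpow (hm jt j) hq0.le
    · refine le_trans (ENNReal.tsum_le_tsum fun j => ?_) (hsum jt (Set.Iio jt))
      exact ENNReal.rpow_le_rpow (hm' jt j) hq0.le

theorem exists_couplingFlow_memFlowSpace {Φ : MeyerProfile} {p : ℝ} (hp : 1 < p) {q : ℝ≥0∞}
    (hq : 1 ≤ q) {m' m : ℝ} (hm'0 : 0 ≤ m') (hm' : m' < 1 / 2) (hm : 1 ≤ m) (hn : 0 < n)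
    {u v : ℝ → 𝓢'(Space n, ℂ)} (hu : MemFlowSpace Φ p q m' m u) (hv : MemFlowSpace Φ p q m' m v)
    {P : Space n → ℂ} (hP : IsFirstOrder P) :
    ∃ F : ℝ → 𝓢'(Space n, ℂ), IsCouplingFlow Φ (fun τ ξ => heat τ ξ * P ξ) u v F ∧
      MemFlowSpace Φ p q m' m F := by
  have hp0 : 0 < p := by linarith
  have ha : 0 < (n : ℝ) / p := div_pos (Nat.cast_pos.2 hn) hp0
  obtain ⟨b, hb, hb2, hb', hba⟩ := exists_exponent hm' ha
  obtain ⟨K, hB⟩ := exists_couplingBound hp hq hu.norm_lt_top hv.norm_lt_top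
  obtain ⟨F, hF, hFm⟩ := exists_isCouplingFlow hB hp hm hb hb2 hb' hba hu.measurable hv.measurable hP
  refine ⟨F, hF, hFm, ?_⟩
  -- `M > m` makes the heat decay beat the weight `2^{2 (j - j_t) m}` of the flow norm
  set M : ℕ := ⌈m⌉₊ + 1 with hMdef
  have hM : m + 1 ≤ M := by
    rw [hMdef]
    push_cast
    linarith [Nat.le_ceil m]
  have hM2 : 2 ≤ M := by
    have : (2 : ℝ) ≤ M := by linarith
    exact_mod_cast this
  obtain ⟨C₁, hC₁, h₁⟩ := exists_ringFun_le hB hp hm hb hb' hba hP hF hM2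
  obtain ⟨C₂, hC₂, h₂⟩ := exists_residualSum_le hm'0 hm hb hb2 hb' hba hM
  set w : ℝ := (∫⁻ x : Space n, ENNReal.ofReal (weight x)).toReal with hw
  have hw0 : 0 ≤ w := ENNReal.toReal_nonneg
  have hK := hB.pos
  have hH := heatConst_pos M
  refine flowNorm_lt_top_of_ringNorm_le hq (C := C₁ * w * (heatConst M * K) * C₂)
    (c := 2 * b) (by positivity) (by linarith) fun j jt => ?_
  rw [ringNorm_le_iff]
  have hEm := measurable_flowEnvelope Φ u v M j jt
  have h2j : (0 : ℝ) < 2 ^ j := by positivity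
  calc weakNorm p (ringFun Φ F j jt)
      ≤ avgNorm p (fun y => ENNReal.ofReal (C₁ * ((2 : ℝ) ^ j) ^ n * 2 ^ j) *
          flowEnvelope Φ u v M j jt y) :=
        (weakNorm_mono hp0 (h₁ j jt)).trans (weakNorm_le_avgNorm hp (hEm.const_mul _))
    _ ≤ ENNReal.ofReal (C₁ * ((2 : ℝ) ^ j) ^ n * 2 ^ j) *
          (ENNReal.ofReal ((((2 : ℝ) ^ j) ^ n)⁻¹ * w * (heatConst M * K) *
            2 ^ (-((j : ℝ) * (n / p)))) *
          ENNReal.ofReal (C₂ * 2 ^ (-(2 * b) * |((j - jt : ℤ) : ℝ)| -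
            2 * (j - jt : ℤ) * flowOrder m' m (j - jt)))) :=
        (avgNorm_const_mul_le _ hEm).trans (mul_le_mul_right
          ((avgNorm_flowEnvelope_le hB M j jt).trans (mul_le_mul_right (h₂ _) _)) _)
    _ = _ := by
        rw [← ENNReal.ofReal_mul (by positivity), ← ENNReal.ofReal_mul (by positivity)]
        congr 1
        have e1 : ((2 : ℝ) ^ j) ^ n * (((2 : ℝ) ^ j) ^ n)⁻¹ = 1 := mul_inv_cancel₀ (by positivity)
        have e2 : (2 : ℝ) ^ j * 2 ^ (-((j : ℝ) * (n / p))) *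
            2 ^ (-(2 * b) * |((j - jt : ℤ) : ℝ)| - 2 * (j - jt : ℤ) * flowOrder m' m (j - jt)) =
            2 ^ (-(2 * b) * |((j - jt : ℤ) : ℝ)|) *
            2 ^ (-(2 * ((j : ℝ) - jt) * flowOrder m' m (j - jt)) - (j : ℝ) * ((n : ℝ) / p - 1)) := by
          rw [← Real.rpow_intCast, ← Real.rpow_add two_pos, ← Real.rpow_add two_pos,
            ← Real.rpow_add two_pos]
          congr 1
          push_cast
          ring
        linear_combination (C₁ * w * (heatConst M * K) * C₂ * (2 : ℝ) ^ j *
          2 ^ (-((j : ℝ) * (n / p))) * 2 ^ (-(2 * b) * |((j - jt : ℤ) : ℝ)| -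
            2 * (j - jt : ℤ) * flowOrder m' m (j - jt))) * e1 +
          (C₁ * w * (heatConst M * K) * C₂) * e2

theorem symbolOne_eq (l : Fin n) :
    symbolOne l = fun τ ξ => heat τ ξ * partialSymbol l ξ := rfl

theorem symbolThree_eq (l l' l'' : Fin n) :
    symbolThree l l' l'' = fun τ ξ => heat τ ξ * rieszSymbol l l' l'' ξ := by
  funext τ ξ
  rw [symbolThree, mul_div_assoc]
  rfl

end CouplingFlow

end

theorem theorem1p3 {n : ℕ} (Φ : CouplingFlow.MeyerProfile) (l l' l'' : Fin n)
    (p : ℝ) (hp : 1 < p) (q : ℝ≥0∞) (hq : 1 ≤ q)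
    (m' m : ℝ) (hm'0 : 0 ≤ m') (hm' : m' < 1 / 2) (hm : 1 < m)
    (u v : ℝ → 𝓢'(CouplingFlow.Space n, ℂ))
    (hu : CouplingFlow.MemFlowSpace Φ p q m' m u)
    (hv : CouplingFlow.MemFlowSpace Φ p q m' m v) :
    (∃ F : ℝ → 𝓢'(CouplingFlow.Space n, ℂ),
      CouplingFlow.IsCouplingFlow Φ (CouplingFlow.symbolOne l) u v F ∧
        CouplingFlow.MemFlowSpace Φ p q m' m F) ∧
    (∃ F : ℝ → 𝓢'(CouplingFlow.Space n, ℂ),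
      CouplingFlow.IsCouplingFlow Φ (CouplingFlow.symbolThree l l' l'') u v F ∧
        CouplingFlow.MemFlowSpace Φ p q m' m F) := by
  rw [CouplingFlow.symbolOne_eq, CouplingFlow.symbolThree_eq]
  exact ⟨CouplingFlow.exists_couplingFlow_memFlowSpace hp hq hm'0 hm' hm.le l.pos hu hv
      (CouplingFlow.isFirstOrder_partialSymbol l),
    CouplingFlow.exists_couplingFlow_memFlowSpace hp hq hm'0 hm' hm.le l.pos hu hv
      (CouplingFlow.isFirstOrder_rieszSymbol l l' l'')⟩
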